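/- **Setting.** Let $\mathcal P$ be a (possibly infinite) collection of pairwise disjoint non-empty open subintervals of $[0,1]$ whose union has full Lebesgue measure, and let $f:\bigcup_{p\in\mathcal P}p\to[0,1]$ be such that, for each $p\in\mathcal P$, $f\in C^1(p,\mathbb R)$, both $f$ and $1/f'$ extend continuously to $\bar p$, and $\inf_{p\in\mathcal P}\inf_{x\in p}|f'(x)|>1$. Let $\xi=e^{\phi}$ on $\bigcup_{p\in\mathcal P} p$, where the potential $\phi$ is complex valued and, for some $\beta\in(0,1]$, uniformly $\beta$-Hölder on the partition elements: there is $C$ with $|\phi(x)-\phi(y)|\le C|x-y|^\beta$ for all $p\in\mathcal P$ and $x,y\in p$. Assume that $\xi f'\in L^\infty$ and that, for some $\gamma\in[0,1)$, $$\sum_{p\in\mathcal P}\ \sup_{z\in p}\bigl(|\xi(z)|\,|f'(z)|^{\gamma}\bigr)^{\frac1{1-\gamma}}<\infty .$$ No integrability of $f'$ is assumed. For $\varphi\in C^1([0,1],\mathbb C)$ put $|\varphi|_\alpha=\sup_{x\in[0,1]}|\varphi(x)|+\sup_{x\neq y}\frac{|\varphi(x)-\varphi(y)|}{|x-y|^\alpha}$,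 and let $\mathcal B_\alpha$ be the space of those $h\in L^1([0,1],\mathbb C)$ with $\|h\|_\alpha=\sup\{|\int_0^1 h\varphi'|:\varphi\in C^1([0,1],\mathbb C),\ |\varphi|_\alpha\le1\}<\infty$, equipped with the norm $\|\cdot\|_\alpha$. **Theorem.** If $1>\alpha>\max\{\gamma,1-\beta\}$, then the transfer operator $$\mathcal L_\xi h(x)=\sum_{y\in f^{-1}(x)}\xi(y)h(y)$$ (the sum converging for almost every $x\in[0,1]$) is a bounded linear operator on $\mathcal B_\alpha$. Its spectral radius is at most $|\xi f'|_{L^\infty}$, and its essential spectral radius is at most $$\min\bigl\{|\xi f'|_{L^\infty},\ 8\,\bigl|\,|\xi|\,|f'|^{\alpha}\bigr|_{L^\infty}\bigr\}.$$ Here the essential spectral radius is the least $\rho\ge0$ such that every point of the spectrum of modulus greater than $\rho$ is an isolated point of the spectrum and an eigenvalue of finite algebraic multiplicity. -/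

import Mathlib

open MeasureTheory Set Filter Topology
open scoped ENNReal NNReal

namespace HolderBV

noncomputable section

/-- Lebesgue measure on `[0,1]`. -/
abbrev leb : Measure ℝ := volume.restrict (Icc (0 : ℝ) 1)

/-! ### The spaces `B_α` -/

/-- `|φ|_α = sup |φ(x)| + sup |φ(x) - φ(y)| / |x - y|^α` over `[0,1]`, as an extended real.
The diagonal terms `x = y` are `0` in `ℝ≥0∞`, so they do not contribute. -/
def holderNorm (α : ℝ) (φ : ℝ → ℂ) : ℝ≥0∞ :=
  (⨆ x ∈ Icc (0 : ℝ) 1, ‖φ x‖ₑ) +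
    ⨆ x ∈ Icc (0 : ℝ) 1, ⨆ y ∈ Icc (0 : ℝ) 1, edist (φ x) (φ y) / edist x y ^ α

/-- The admissible test functions: `φ ∈ C¹([0,1], ℂ)` with `|φ|_α ≤ 1`. -/
def testFunctions (α : ℝ) : Set (ℝ → ℂ) :=
  {φ | ContDiffOn ℝ 1 φ (Icc 0 1) ∧ holderNorm α φ ≤ 1}

/-- `∫₀¹ h φ'`. -/
def pairing (h : ℝ → ℂ) (φ : ℝ → ℂ) : ℂ :=
  ∫ x, h x * derivWithin φ (Icc 0 1) x ∂leb

/-- `‖h‖_α = sup |∫₀¹ h φ'|` over test functions, as an extended real. -/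
def eNormB (α : ℝ) (h : Lp ℂ 1 leb) : ℝ≥0∞ :=
  ⨆ φ ∈ testFunctions α, ‖pairing h φ‖ₑ

lemma integrable_pairing (h : Lp ℂ 1 leb) {φ : ℝ → ℂ} (hφ : ContDiffOn ℝ 1 φ (Icc 0 1)) :
    Integrable (fun x => h x * derivWithin φ (Icc 0 1) x) leb := by
  have hc : ContinuousOn (derivWithin φ (Icc 0 1)) (Icc 0 1) :=
    hφ.continuousOn_derivWithin (uniqueDiffOn_Icc zero_lt_one) le_rfl
  obtain ⟨C, hC⟩ := isCompact_Icc.exists_bound_of_continuousOn hc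
  refine (L1.integrable_coeFn h).mul_bdd (c := C)
    (hc.aestronglyMeasurable measurableSet_Icc) ?_
  exact (ae_restrict_iff' measurableSet_Icc).2 (Eventually.of_forall hC)

lemma pairing_add (h k : Lp ℂ 1 leb) {φ : ℝ → ℂ} (hφ : ContDiffOn ℝ 1 φ (Icc 0 1)) :
    pairing (h + k : Lp ℂ 1 leb) φ = pairing h φ + pairing k φ := by
  unfold pairing
  rw [← integral_add (integrable_pairing h hφ) (integrable_pairing k hφ)]
  refine integral_congr_ae ?_
  filter_upwards [Lp.coeFn_add h k] with x hx
  rw [hx, Pi.add_apply, add_mul]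

lemma pairing_smul (c : ℂ) (h : Lp ℂ 1 leb) (φ : ℝ → ℂ) :
    pairing (c • h : Lp ℂ 1 leb) φ = c * pairing h φ := by
  unfold pairing
  rw [← integral_const_mul]
  refine integral_congr_ae ?_
  filter_upwards [Lp.coeFn_smul c h] with x hx
  rw [hx, Pi.smul_apply, smul_eq_mul, mul_assoc]

lemma eNormB_add_le (α : ℝ) (h k : Lp ℂ 1 leb) :
    eNormB α (h + k) ≤ eNormB α h + eNormB α k := by
  refine iSup₂_le fun φ hφ => ?_
  rw [pairing_add h k hφ.1]
  exact (enorm_add_le _ _).trans (add_le_add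
    (le_iSup₂ (f := fun φ (_ : φ ∈ testFunctions α) => ‖pairing h φ‖ₑ) φ hφ)
    (le_iSup₂ (f := fun φ (_ : φ ∈ testFunctions α) => ‖pairing k φ‖ₑ) φ hφ))

lemma eNormB_smul (α : ℝ) (c : ℂ) (h : Lp ℂ 1 leb) :
    eNormB α (c • h) = ‖c‖ₑ * eNormB α h := by
  simp only [eNormB, pairing_smul, enorm_mul, ENNReal.mul_iSup]

lemma eNormB_zero (α : ℝ) : eNormB α 0 = 0 := by
  simpa using eNormB_smul α 0 0

/-- `B_α` as a set of densities: the `h ∈ L¹([0,1])` with `‖h‖_α < ∞`. -/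
def BSubmodule (α : ℝ) : Submodule ℂ (Lp ℂ 1 leb) where
  carrier := {h | eNormB α h < ⊤}
  add_mem' ha hb := (eNormB_add_le α _ _).trans_lt (ENNReal.add_lt_top.2 ⟨ha, hb⟩)
  zero_mem' := by simp [eNormB_zero]
  smul_mem' c h hh := by
    simp only [Set.mem_ofPred_eq, eNormB_smul] at hh ⊢
    exact ENNReal.mul_lt_top enorm_lt_top hh

/-- The space `B_α`, `0 ≤ α < 1`, with the norm `‖·‖_α` (not the `L¹` norm). -/
def BSpace (α : Ico (0 : ℝ) 1) : Type := BSubmodule (α : ℝ)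

instance (α : Ico (0 : ℝ) 1) : AddCommGroup (BSpace α) :=
  inferInstanceAs (AddCommGroup (BSubmodule (α : ℝ)))

instance (α : Ico (0 : ℝ) 1) : Module ℂ (BSpace α) :=
  inferInstanceAs (Module ℂ (BSubmodule (α : ℝ)))

/-- The density in `L¹([0,1])` underlying an element of `B_α`. -/
def BSpace.density {α : Ico (0 : ℝ) 1} (h : BSpace α) : Lp ℂ 1 leb := h.1

instance (α : Ico (0 : ℝ) 1) : Norm (BSpace α) := ⟨fun h => (eNormB α h.density).toReal⟩

/-- A `C¹` function whose derivative is bounded has finite Hölder norm on `[0,1]`. -/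
lemma holderNorm_le_of_lipschitz {α : ℝ} (hα : α ∈ Ico (0 : ℝ) 1) {φ : ℝ → ℂ} {C : ℝ≥0}
    (h0 : φ 0 = 0) (hφ : LipschitzWith C φ) : holderNorm α φ ≤ C + C := by
  have hd : ∀ x ∈ Icc (0 : ℝ) 1, ∀ y ∈ Icc (0 : ℝ) 1, edist x y ≤ 1 := by
    intro x hx y hy
    rw [edist_dist]
    refine ENNReal.ofReal_le_one.2 ?_
    rw [Real.dist_eq, abs_le]
    constructor <;> linarith [hx.1, hx.2, hy.1, hy.2]
  refine add_le_add ?_ ?_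
  · refine iSup₂_le fun x hx => ?_
    have h1 := hφ x 0
    rw [h0, edist_zero_right] at h1
    exact h1.trans (mul_le_of_le_one_right' (hd x hx 0 (by simp)))
  · refine iSup₂_le fun x hx => iSup₂_le fun y hy => ?_
    refine ENNReal.div_le_of_le_mul ((hφ x y).trans ?_)
    gcongr
    calc edist x y = edist x y ^ (1 : ℝ) := (ENNReal.rpow_one _).symm
      _ ≤ edist x y ^ α := ENNReal.rpow_le_rpow_of_exponent_ge (hd x hx y hy) hα.2.le

/-- `‖·‖_α` separates points. -/
lemma eq_zero_of_eNormB_eq_zero {α : ℝ} (hα : α ∈ Ico (0 : ℝ) 1) {h : Lp ℂ 1 leb}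
    (hh : eNormB α h = 0) : h = 0 := by
  have htest : ∀ φ ∈ testFunctions α, pairing h φ = 0 := by
    intro φ hφ
    have : ‖pairing h φ‖ₑ ≤ eNormB α h :=
      le_iSup₂ (f := fun φ (_ : φ ∈ testFunctions α) => ‖pairing h φ‖ₑ) φ hφ
    simpa [hh] using this
  have hint : IntegrableOn (fun x => h x) (Icc 0 1) volume := L1.integrable_coeFn h
  have key : ∀ᵐ x, x ∈ Ioo (0 : ℝ) 1 → h x = 0 := by
    refine isOpen_Ioo.ae_eq_zero_of_integral_contDiff_smul_eq_zero
      ((hint.mono_set Ioo_subset_Icc_self).locallyIntegrableOn) ?_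
    intro g hg hgc hgs
    have hgcont : Continuous g := hg.continuous
    obtain ⟨C, hC⟩ := hgc.exists_bound_of_continuous hgcont
    have hC0 : 0 ≤ C := (norm_nonneg _).trans (hC 0)
    set D : ℝ := C + 1 with hD
    have hDpos : 0 < D := by linarith
    set φ : ℝ → ℂ := fun x => ((2 * D)⁻¹ : ℝ) • ((∫ t in (0 : ℝ)..x, g t : ℝ) : ℂ) with hφdef
    have hder : ∀ x, HasDerivAt φ (((2 * D)⁻¹ : ℝ) • ((g x : ℝ) : ℂ)) x := fun x =>
      HasDerivAt.const_smul (F := ℂ) ((2 * D)⁻¹ : ℝ)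
        ((hgcont.integral_hasStrictDerivAt 0 x).hasDerivAt.ofReal_comp)
    have hCD : ContDiff ℝ 1 φ := by
      rw [contDiff_one_iff_deriv]
      refine ⟨fun x => (hder x).differentiableAt, ?_⟩
      rw [show deriv φ = fun x => ((2 * D)⁻¹ : ℝ) • ((g x : ℝ) : ℂ) from
        funext fun x => (hder x).deriv]
      fun_prop
    have hlip : LipschitzWith (1 / 2 : ℝ≥0) φ := by
      refine lipschitzWith_of_nnnorm_deriv_le (fun x => (hder x).differentiableAt) fun x => ?_
      rw [(hder x).deriv, ← NNReal.coe_le_coe, coe_nnnorm, norm_smul, Complex.norm_real,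
        Real.norm_of_nonneg (by positivity : (0 : ℝ) ≤ (2 * D)⁻¹)]
      push_cast
      rw [inv_mul_le_iff₀ (by positivity)]
      linarith [hC x]
    have hφ0 : φ 0 = 0 := by simp [hφdef]
    have hmem : φ ∈ testFunctions α := by
      refine ⟨hCD.contDiffOn, (holderNorm_le_of_lipschitz hα hφ0 hlip).trans ?_⟩
      rw [← ENNReal.coe_add, add_halves, ENNReal.coe_one]
    have hp := htest φ hmem
    unfold pairing at hp
    have h1 : ∫ x, h x * derivWithin φ (Icc 0 1) x ∂leb
        = ∫ x, ((2 * D)⁻¹ : ℝ) • (g x • h x) ∂leb := by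
      refine setIntegral_congr_fun measurableSet_Icc fun x hx => ?_
      rw [(hder x).hasDerivWithinAt.derivWithin (uniqueDiffOn_Icc zero_lt_one x hx)]
      simp only [Complex.real_smul]
      ring
    rw [h1, integral_smul, smul_eq_zero] at hp
    have h2 := hp.resolve_left (by positivity)
    rwa [setIntegral_eq_integral_of_forall_compl_eq_zero] at h2
    intro x hx
    have : g x = 0 := by
      by_contra hne
      exact hx (Ioo_subset_Icc_self (hgs (subset_tsupport _ hne)))
    simp [this]
  refine (Lp.eq_zero_iff_ae_eq_zero).2 ?_
  have h3 : ∀ᵐ x ∂(volume.restrict (Ioo (0 : ℝ) 1)), h x = 0 :=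
    (ae_restrict_iff' measurableSet_Ioo).2 key
  rwa [Measure.restrict_congr_set Ioo_ae_eq_Icc] at h3

lemma BSpace.core (α : Ico (0 : ℝ) 1) : NormedSpace.Core ℂ (BSpace α) where
  norm_nonneg _ := ENNReal.toReal_nonneg
  norm_smul c h := by
    change (eNormB α (c • h.density)).toReal = ‖c‖ * (eNormB α h.density).toReal
    rw [eNormB_smul, ENNReal.toReal_mul, toReal_enorm]
  norm_triangle h k := by
    change (eNormB α (h.density + k.density)).toReal ≤ _
    refine (ENNReal.toReal_mono ?_ (eNormB_add_le α _ _)).trans_eq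
      (ENNReal.toReal_add h.2.ne k.2.ne)
    exact (ENNReal.add_lt_top.2 ⟨h.2, k.2⟩).ne
  norm_eq_zero_iff h := by
    constructor
    · intro hh
      have h0 : eNormB α h.density = 0 :=
        ((ENNReal.toReal_eq_zero_iff _).1 hh).resolve_right h.2.ne
      exact Subtype.ext (eq_zero_of_eNormB_eq_zero α.2 h0)
    · rintro rfl
      change (eNormB α 0).toReal = 0
      simp [eNormB_zero]

instance (α : Ico (0 : ℝ) 1) : NormedAddCommGroup (BSpace α) :=
  NormedAddCommGroup.ofCore (BSpace.core α)

instance (α : Ico (0 : ℝ) 1) : NormedSpace ℂ (BSpace α) :=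
  NormedSpace.ofCore (BSpace.core α)

/-! ### Essential spectral radius -/

section Spectral

variable {E : Type*} [NormedAddCommGroup E] [NormedSpace ℂ E]

/-- `z` is an isolated point of the spectrum of `T` and an eigenvalue of finite algebraic
multiplicity: for some `n ≥ 1` the space splits as `ker (T - z)ⁿ ⊕ range (T - z)ⁿ`, the first
summand (the generalized eigenspace) being finite dimensional. -/
structure IsDiscreteEigenvalue (T : E →L[ℂ] E) (z : ℂ) : Prop where
  isolated : ¬ AccPt z (𝓟 (spectrum ℂ T))
  hasEigenvalue : Module.End.HasEigenvalue (T : E →ₗ[ℂ] E) z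
  finite_multiplicity : ∃ n : ℕ, 1 ≤ n ∧
    FiniteDimensional ℂ (LinearMap.ker (((T : E →ₗ[ℂ] E) - z • LinearMap.id) ^ n)) ∧
    IsCompl (LinearMap.ker (((T : E →ₗ[ℂ] E) - z • LinearMap.id) ^ n))
      (LinearMap.range (((T : E →ₗ[ℂ] E) - z • LinearMap.id) ^ n))

/-- The essential spectral radius: the least `ρ` such that every point of the spectrum of modulus
greater than `ρ` is an isolated eigenvalue of finite algebraic multiplicity. -/
def essSpectralRadius (T : E →L[ℂ] E) : ℝ≥0∞ :=
  ⨆ z ∈ {z ∈ spectrum ℂ T | ¬ IsDiscreteEigenvalue T z}, ‖z‖ₑ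

end Spectral

/-! ### Piecewise expanding maps and their transfer operators -/

/-- `f` is a piecewise `C¹` expanding map of `[0,1]`, defined (almost everywhere) on the union of
the (possibly infinite) family `P` of pairwise disjoint open intervals. -/
structure IsPiecewiseExpanding (f : ℝ → ℝ) (P : Set (Set ℝ)) : Prop where
  interval : ∀ p ∈ P, ∃ a b : ℝ, 0 ≤ a ∧ a < b ∧ b ≤ 1 ∧ p = Ioo a b
  disjoint : P.PairwiseDisjoint id
  full : volume (Icc (0 : ℝ) 1 \ ⋃₀ P) = 0
  mapsTo : ∀ p ∈ P, MapsTo f p (Icc 0 1)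
  contDiffOn : ∀ p ∈ P, ContDiffOn ℝ 1 f p
  extends_closure : ∀ p ∈ P, ∃ g : ℝ → ℝ, ContinuousOn g (closure p) ∧ EqOn g f p
  inv_deriv_extends_closure : ∀ p ∈ P, ∃ g : ℝ → ℝ,
    ContinuousOn g (closure p) ∧ EqOn g (fun x => (deriv f x)⁻¹) p
  expanding : ∃ c : ℝ, 1 < c ∧ ∀ p ∈ P, ∀ x ∈ p, c ≤ |deriv f x|

/-- `k = L_ξ h`, i.e. `k(x) = ∑_{y ∈ f⁻¹(x)} ξ(y) h(y)` for almost every `x ∈ [0,1]`, the sum being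
convergent; the preimages are taken in the domain `⋃₀ P` of `f`. -/
def IsTransfer (f : ℝ → ℝ) (P : Set (Set ℝ)) (ξ : ℝ → ℂ) (h k : ℝ → ℂ) : Prop :=
  ∀ᵐ x ∂leb, HasSum (fun y : {y : ℝ // y ∈ ⋃₀ P ∧ f y = x} => ξ y * h y) (k x)

end

end HolderBV

/-! The proof works on the dual side. Changing variables branch by branch, `∫ (L h) χ' = ∫ h ψ` with
`ψ = ξ |f'| (χ' ∘ f)`, so `‖L h‖_α` is controlled once a primitive of `ψ` is known to be `α`-Hölder:
averaging that primitive over short translates turns it into genuine test functions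
(`enorm_integral_mul_le`).

On one branch `F` of an iterate, with weight `w = exp Φ`, one has `ψ = ± w (χ ∘ F)'`, so `F'` never
has to be Hölder. Measured in the coordinate `F`, the function `χ ∘ F` is `α`-Hölder and `w` is
`β`-Hölder. As `α + β > 1`, Young's estimate for `∫ w dg` applies (`norm_integral_sub_le_young`).
Together with bounded distortion and the mean value theorem it bounds the integral of `ψ` over `[a,
b]` by `κ sup(|w| |F'|^α) (b - a)^α` (`IsBranch.norm_integral_le`). Expansion makes the distortion
bound, hence `κ`, the same for all iterates (`holder_comp_le`).

Infinitely many branches are summed by Hölder's inequality. Interpolating between `|ξ| |f'|^γ` and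
`|ξ f'|` gives `|ξ| |f'|^α ≤ A_p^(1-α)` with `A` summable, and `∑ A_p^(1-α) ℓ_p^α ≤ (∑ A_p)^(1-α) (∑
ℓ_p)^α`. This proves boundedness. For quasi-compactness, finitely many branches of `f^n` are set
aside so that the rest have a negligible sum of `A`. On those set aside the average of `ψ` is
subtracted, which is dual to removing a finite rank operator. Such branches then contribute only if
they contain an endpoint of the interval of integration, so at most two of them count
(`hasHolderPrimitive_subAverages`). Hence `L^n = K + R` with `K` of finite rank and `‖R‖ ≤ const *
M^n`, for any `M > sup |ξ| |f'|^α` and a constant independent of `n`.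

An argument in the style of Riesz (`isDiscreteEigenvalue_of_pow_eq`) then shows that every spectral
value of modulus above `sup |ξ| |f'|^α` is a discrete eigenvalue. Since `|f'| ≥ 1`, this supremum is
at most `|ξ f'|_∞`. A spectral value of modulus above `|ξ f'|_∞` would thus have an eigenvector,
contradicting `‖L h‖₁ ≤ |ξ f'|_∞ ‖h‖₁`. -/

namespace HolderBV

/-! ### Finite rank perturbations -/

section Algebra

variable {V : Type*} [AddCommGroup V] [Module ℂ V]

/-- A finite rank perturbation of a bijective map has index zero: if its kernel and its range are
disjoint, they are complementary. -/
lemma isCompl_ker_range_of_finite_rank {A B K : V →ₗ[ℂ] V} (hA : A = B + K)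
    (hB : Function.Bijective B) [FiniteDimensional ℂ (LinearMap.range K)]
    (hd : Disjoint (LinearMap.ker A) (LinearMap.range A)) :
    FiniteDimensional ℂ (LinearMap.ker A) ∧ IsCompl (LinearMap.ker A) (LinearMap.range A) := by
  let e := LinearEquiv.ofBijective B hB
  have he : ∀ x, B (e.symm x) = x := fun x => e.apply_symm_apply x
  -- `K` is injective on `ker A`: if `A x = 0` and `K x = 0`, then `B x = 0`.
  let g : LinearMap.ker A →ₗ[ℂ] LinearMap.range K :=
    K.rangeRestrict ∘ₗ (LinearMap.ker A).subtype
  have hg : Function.Injective g := by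
    rw [← LinearMap.ker_eq_bot, LinearMap.ker_eq_bot']
    rintro ⟨x, hx⟩ h
    have h1 : K x = 0 := congrArg Subtype.val h
    rw [LinearMap.mem_ker, hA, LinearMap.add_apply, h1, add_zero] at hx
    exact Subtype.ext (hB.1 (by simpa using hx))
  have hfin : FiniteDimensional ℂ (LinearMap.ker A) := FiniteDimensional.of_injective g hg
  refine ⟨hfin, hd, ?_⟩
  -- `D` is `A B⁻¹` restricted to `range K`. As `v = A B⁻¹ v - K B⁻¹ v`, the space `range K`
  -- surjects onto `V / range A`, and this surjection kills `range D`. So the codimension of `range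
  -- A` is at most `dim ker D`, which is at most `dim ker A` because `B⁻¹` embeds `ker D` in `ker
  -- A`.
  let D : LinearMap.range K →ₗ[ℂ] LinearMap.range K :=
    LinearMap.id + K.rangeRestrict ∘ₗ e.symm.toLinearMap ∘ₗ (LinearMap.range K).subtype
  have hD : ∀ w : LinearMap.range K, ((D w : LinearMap.range K) : V) = A (e.symm w) := by
    intro w
    have : B (e.symm (w : V)) = w := he w
    simp [D, hA, this]
  let q : LinearMap.range K →ₗ[ℂ] (V ⧸ LinearMap.range A) :=
    (LinearMap.range A).mkQ ∘ₗ (LinearMap.range K).subtype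
  have hq : Function.Surjective q := by
    intro y
    obtain ⟨v, rfl⟩ := Submodule.Quotient.mk_surjective _ y
    refine ⟨-⟨K (e.symm v), LinearMap.mem_range_self _ _⟩, ?_⟩
    simp only [q, LinearMap.comp_apply, Submodule.subtype_apply, map_neg, Submodule.mkQ_apply]
    rw [← Submodule.Quotient.mk_neg, Submodule.Quotient.eq]
    refine ⟨-e.symm v, ?_⟩
    rw [map_neg, hA, LinearMap.add_apply, he]
    abel
  have hker : LinearMap.range D ≤ LinearMap.ker q := by
    rintro _ ⟨w, rfl⟩
    rw [LinearMap.mem_ker]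
    simp only [q, LinearMap.comp_apply, Submodule.subtype_apply, Submodule.mkQ_apply, hD]
    rw [Submodule.Quotient.mk_eq_zero]
    exact LinearMap.mem_range_self _ _
  have : FiniteDimensional ℂ (V ⧸ LinearMap.range A) := Module.Finite.of_surjective q hq
  let j : LinearMap.ker D →ₗ[ℂ] LinearMap.ker A :=
    (e.symm.toLinearMap ∘ₗ (LinearMap.range K).subtype ∘ₗ (LinearMap.ker D).subtype).codRestrict _
      (by
        rintro ⟨w, hw⟩
        rw [LinearMap.mem_ker] at hw ⊢
        have := hD w
        rw [hw] at this
        exact this.symm)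
  have hj : Function.Injective j := by
    intro a b h
    have h1 := congrArg Subtype.val h
    simp only [j, LinearMap.codRestrict_apply, LinearMap.comp_apply] at h1
    exact Subtype.ext (Subtype.ext (e.symm.injective h1))
  have h1 := LinearMap.finrank_range_add_finrank_ker D
  have h2 := LinearMap.finrank_range_add_finrank_ker q
  rw [LinearMap.range_eq_top.2 hq, finrank_top] at h2
  have h3 := Submodule.finrank_mono hker
  have h4 := LinearMap.finrank_le_finrank_of_injective hj
  -- Disjointness gives the opposite inequality of dimensions, so `s` is bijective; its surjectivity
  -- says that kernel and range span.
  let s : LinearMap.ker A →ₗ[ℂ] (V ⧸ LinearMap.range A) :=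
    (LinearMap.range A).mkQ ∘ₗ (LinearMap.ker A).subtype
  have hs : Function.Injective s := by
    rw [← LinearMap.ker_eq_bot, LinearMap.ker_eq_bot']
    rintro ⟨x, hx⟩ h
    simp only [s, LinearMap.comp_apply, Submodule.subtype_apply, Submodule.mkQ_apply,
      Submodule.Quotient.mk_eq_zero] at h
    exact Subtype.ext (Submodule.disjoint_def.1 hd x hx h)
  have h5 := LinearMap.finrank_le_finrank_of_injective hs
  have hs' : Function.Surjective s :=
    (LinearMap.injective_iff_surjective_of_finrank_eq_finrank (by omega)).1 hs
  rw [codisjoint_iff, eq_top_iff]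
  intro v _
  obtain ⟨⟨x, hx⟩, hxv⟩ := hs' (Submodule.Quotient.mk v)
  simp only [s, LinearMap.comp_apply, Submodule.subtype_apply, Submodule.mkQ_apply] at hxv
  rw [Submodule.Quotient.eq] at hxv
  have := Submodule.sub_mem _ (Submodule.mem_sup_left (T := LinearMap.range A) hx)
    (Submodule.mem_sup_right (S := LinearMap.ker A) hxv)
  simpa using this

/-- If the kernels of the powers of `A` stabilize at `k`, kernel and range of `A ^ k` are
disjoint. -/
lemma disjoint_ker_range_pow {A : Module.End ℂ V} {k : ℕ}
    (hk : LinearMap.ker (A ^ (k + k)) ≤ LinearMap.ker (A ^ k)) :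
    Disjoint (LinearMap.ker (A ^ k)) (LinearMap.range (A ^ k)) := by
  rw [Submodule.disjoint_def]
  rintro _ hx ⟨y, rfl⟩
  exact hk (by rw [LinearMap.mem_ker, pow_add]; exact hx)

lemma ker_pow_mono (A : Module.End ℂ V) {k l : ℕ} (h : k ≤ l) :
    LinearMap.ker (A ^ k) ≤ LinearMap.ker (A ^ l) := by
  intro x hx
  obtain ⟨m, rfl⟩ := Nat.exists_eq_add_of_le h
  rw [LinearMap.mem_ker] at hx ⊢
  rw [add_comm, pow_add, Module.End.mul_apply, hx, map_zero]

/-- A factor `A` of `V = A Q = Q A` inherits finite ascent and descent from `V`. -/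
lemma exists_isCompl_ker_range_pow_of_factor {A Q S : Module.End ℂ V} (hAQ : Commute A Q)
    (hS : S = A * Q) {m : ℕ}
    (hm : ∀ k, m ≤ k → FiniteDimensional ℂ (LinearMap.ker (S ^ k)) ∧
      IsCompl (LinearMap.ker (S ^ k)) (LinearMap.range (S ^ k)))
    (hstab : ∀ k, LinearMap.ker (S ^ k) ≤ LinearMap.ker (S ^ m)) :
    ∃ k : ℕ, 1 ≤ k ∧ FiniteDimensional ℂ (LinearMap.ker (A ^ k)) ∧
      IsCompl (LinearMap.ker (A ^ k)) (LinearMap.range (A ^ k)) := by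
  have hpow : ∀ k, S ^ k = A ^ k * Q ^ k := fun k => by rw [hS, hAQ.mul_pow]
  have hle : ∀ k, LinearMap.ker (A ^ k) ≤ LinearMap.ker (S ^ k) := by
    intro k x hx
    rw [LinearMap.mem_ker] at hx ⊢
    rw [hpow, (hAQ.pow_pow k k).eq, Module.End.mul_apply, hx, map_zero]
  have hfin : ∀ k, FiniteDimensional ℂ (LinearMap.ker (A ^ k)) := fun k =>
    have := (hm m le_rfl).1
    Submodule.finiteDimensional_of_le ((hle k).trans (hstab k))
  -- dimensions of the kernels are bounded, so they stabilize
  obtain ⟨k0, hk0⟩ : ∃ k0, ∀ k, Module.finrank ℂ (LinearMap.ker (A ^ k)) ≤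
      Module.finrank ℂ (LinearMap.ker (A ^ k0)) := by
    have hb : BddAbove (range fun k => Module.finrank ℂ (LinearMap.ker (A ^ k))) := by
      refine ⟨Module.finrank ℂ (LinearMap.ker (S ^ m)), ?_⟩
      rintro _ ⟨k, rfl⟩
      have := (hm m le_rfl).1
      exact Submodule.finrank_mono ((hle k).trans (hstab k))
    obtain ⟨k0, hk0⟩ := Nat.sSup_mem (range_nonempty _) hb
    refine ⟨k0, fun k => ?_⟩
    have h1 := le_csSup hb (mem_range_self k)
    exact h1.trans hk0.symm.le
  -- `k0` stabilizes the kernels, `m` makes the decomposition for `S ^ k` available, and `1`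
  -- excludes the trivial power.
  set k := max (max k0 m) 1 with hkdef
  have hstabA : LinearMap.ker (A ^ (k + k)) ≤ LinearMap.ker (A ^ k) := by
    have h1 : LinearMap.ker (A ^ k0) ≤ LinearMap.ker (A ^ (k + k)) := ker_pow_mono A (by omega)
    have := hfin (k + k)
    rw [← Submodule.eq_of_le_of_finrank_le h1 (hk0 _)]
    exact ker_pow_mono A (by omega)
  have hdis := disjoint_ker_range_pow hstabA
  refine ⟨k, by omega, hfin k, hdis, ?_⟩
  obtain ⟨hN, hNc⟩ := hm k (by omega)
  -- on the finite dimensional `N = ker (S ^ k)`, `A ^ k` has complementary kernel and range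
  have hinv : ∀ x ∈ LinearMap.ker (S ^ k), (A ^ k) x ∈ LinearMap.ker (S ^ k) := by
    intro x hx
    rw [LinearMap.mem_ker] at hx ⊢
    have hc : Commute (S ^ k) (A ^ k) := by
      rw [hS]; exact ((Commute.refl A).mul_left hAQ.symm).pow_pow k k
    rw [← Module.End.mul_apply, hc.eq, Module.End.mul_apply, hx, map_zero]
  let g : LinearMap.ker (S ^ k) →ₗ[ℂ] LinearMap.ker (S ^ k) := (A ^ k).restrict hinv
  have hgd : Disjoint (LinearMap.ker g) (LinearMap.range g) := by
    rw [Submodule.disjoint_def]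
    rintro _ hx ⟨y, rfl⟩
    refine Subtype.ext (Submodule.disjoint_def.1 hdis _ ?_ ⟨(y : V), rfl⟩)
    exact congrArg Subtype.val hx
  have hgt : LinearMap.ker g ⊔ LinearMap.range g = ⊤ := by
    refine Submodule.eq_top_of_disjoint _ _ ?_ hgd
    rw [add_comm, LinearMap.finrank_range_add_finrank_ker]
  -- Split `V` as `ker (S ^ k) ⊕ range (S ^ k)`: the first summand is handled by the finite
  -- dimensional argument, the second lies in `range (A ^ k)` because `S ^ k = A ^ k * Q ^ k`.
  rw [codisjoint_iff, eq_top_iff, ← codisjoint_iff.1 hNc.2]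
  refine sup_le ?_ ?_
  · intro x hx
    have : (⟨x, hx⟩ : LinearMap.ker (S ^ k)) ∈ LinearMap.ker g ⊔ LinearMap.range g := by
      rw [hgt]; trivial
    obtain ⟨y, hy, z, ⟨w, rfl⟩, hyz⟩ := Submodule.mem_sup.1 this
    refine Submodule.mem_sup.2 ⟨y, ?_, _, ⟨(w : V), rfl⟩, congrArg Subtype.val hyz⟩
    exact congrArg Subtype.val hy
  · refine le_trans ?_ le_sup_right
    rintro _ ⟨y, rfl⟩
    rw [hpow]
    exact ⟨(Q ^ k) y, rfl⟩

end Algebra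
/-! ### Quasi-compactness -/

section Quasicompact

variable {E : Type*} [NormedAddCommGroup E] [NormedSpace ℂ E]

/-- A vector of norm one of `G` at distance at least `1/2` from a closed strict subspace `F`. -/
lemma exists_unit_far {F G : Submodule ℂ E} (hF : IsClosed (F : Set E)) (hFG : F < G) :
    ∃ x ∈ G, ‖x‖ = 1 ∧ ∀ y ∈ F, 1 / 2 ≤ ‖x - y‖ := by
  have hcl : IsClosed ((F.comap G.subtype : Submodule ℂ G) : Set G) :=
    hF.preimage continuous_subtype_val
  obtain ⟨v, hvG, hvF⟩ := SetLike.exists_of_lt hFG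
  obtain ⟨x, hx, h⟩ := riesz_lemma hcl ⟨⟨v, hvG⟩, hvF⟩ (r := 1 / 2) (by norm_num)
  have hx0 : (x : E) ≠ 0 := fun h0 => hx (by simp [Submodule.mem_comap, h0])
  have hn : 0 < ‖(x : E)‖ := norm_pos_iff.2 hx0
  refine ⟨((‖(x : E)‖⁻¹ : ℝ) : ℂ) • (x : E), G.smul_mem _ x.2, ?_, fun y hy => ?_⟩
  · rw [norm_smul, Complex.norm_real, norm_inv, norm_norm, inv_mul_cancel₀ hn.ne']
  · have h1 := h ⟨((‖(x : E)‖ : ℝ) : ℂ) • y, hFG.le (F.smul_mem _ hy)⟩ (F.smul_mem _ hy)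
    have h2 : ‖(x : E) - ((‖(x : E)‖ : ℝ) : ℂ) • y‖ = ‖(x : E)‖ *
        ‖((‖(x : E)‖⁻¹ : ℝ) : ℂ) • (x : E) - y‖ := by
      have h4 : (x : E) - ((‖(x : E)‖ : ℝ) : ℂ) • y =
          ((‖(x : E)‖ : ℝ) : ℂ) • (((‖(x : E)‖⁻¹ : ℝ) : ℂ) • (x : E) - y) := by
        rw [smul_sub, smul_smul, ← Complex.ofReal_mul, mul_inv_cancel₀ hn.ne', Complex.ofReal_one,
          one_smul]
      rw [h4, norm_smul, Complex.norm_real, norm_norm]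
    have h3 : 1 / 2 * ‖(x : E)‖ ≤ ‖(x : E) - ((‖(x : E)‖ : ℝ) : ℂ) • y‖ := h1
    rw [h2, mul_comm] at h3
    exact le_of_mul_le_mul_left h3 hn

/-- There is no infinite flag along which a small perturbation of a finite rank operator acts by
large scalars. -/
lemma no_infinite_flag {S K R : E →L[ℂ] E} (hS : S = K + R)
    [FiniteDimensional ℂ (LinearMap.range (K : E →ₗ[ℂ] E))] {ρ : ℝ} (hρ : 4 * ‖R‖ < ρ)
    (w : ℕ → ℂ) (hw : ∀ k, ρ ≤ ‖w k‖) (F : ℕ → Submodule ℂ E)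
    (hcl : ∀ k, IsClosed (F k : Set E)) (hlt : ∀ k, F k < F (k + 1))
    (hF : ∀ k, ∀ x ∈ F (k + 1), S x - w k • x ∈ F k) : False := by
  choose y hyF hy1 hyd using fun k => exists_unit_far (hcl k) (hlt k)
  have hmono : Monotone F := monotone_nat_of_le_succ fun k => (hlt k).le
  have hSF : ∀ k, S (y k) ∈ F (k + 1) := by
    intro k
    have := (F (k + 1)).add_mem (hmono k.le_succ (hF k _ (hyF k))) ((F (k + 1)).smul_mem (w k) (hyF k))
    simpa using this
  have hρ0 : 0 < ρ := lt_of_le_of_lt (by positivity) hρ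
  -- Modulo `F m`, the vector `S (y m) - S (y l)` equals `w m • y m`, and `y m` is at distance at
  -- least `1/2` from `F m`.
  have hfar : ∀ l m, l < m → ρ / 2 ≤ ‖S (y m) - S (y l)‖ := by
    intro l m hlm
    have hw0 : w m ≠ 0 := norm_pos_iff.1 (hρ0.trans_le (hw m))
    have hu : (w m)⁻¹ • (S (y l) - (S (y m) - w m • y m)) ∈ F m :=
      (F m).smul_mem _ ((F m).sub_mem (hmono hlm (hSF l)) (hF m _ (hyF m)))
    have h1 := hyd m _ hu
    have h2 : S (y m) - S (y l) = w m • (y m - (w m)⁻¹ • (S (y l) - (S (y m) - w m • y m))) := by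
      rw [smul_sub, smul_smul, mul_inv_cancel₀ hw0, one_smul]; abel
    rw [h2, norm_smul]
    calc ρ / 2 = ρ * (1 / 2) := by ring
      _ ≤ _ := by gcongr; exact hw m
  let k : ℕ → LinearMap.range (K : E →ₗ[ℂ] E) := fun n => ⟨K (y n), ⟨y n, rfl⟩⟩
  have hkb : ∀ n, k n ∈ Metric.closedBall 0 ‖K‖ := by
    intro n
    rw [mem_closedBall_zero_iff]
    change ‖K (y n)‖ ≤ _
    simpa [hy1] using K.le_opNorm (y n)
  have : ProperSpace (LinearMap.range (K : E →ₗ[ℂ] E)) := FiniteDimensional.proper ℂ _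
  obtain ⟨a, -, φ, hφ, hlim⟩ := (isCompact_closedBall _ _).tendsto_subseq hkb
  have hc := hlim.cauchySeq
  rw [Metric.cauchySeq_iff'] at hc
  -- The vectors `K (y n)` stay in a bounded part of a finite dimensional space, so a subsequence is
  -- Cauchy. The two `R` terms cost at most `2‖R‖`; positivity of `ρ / 2 - 2‖R‖` is where the factor
  -- `4` comes from.
  obtain ⟨N, hN⟩ := hc (ρ / 2 - 2 * ‖R‖) (by linarith)
  have h1 := hN (N + 1) N.le_succ
  have h2 := hfar _ _ (hφ N.lt_succ_self)
  have h3 : ‖K (y (φ (N + 1))) - K (y (φ N))‖ < ρ / 2 - 2 * ‖R‖ := by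
    rw [dist_eq_norm] at h1; exact h1
  have h4 : ‖S (y (φ (N + 1))) - S (y (φ N))‖ ≤
      ‖K (y (φ (N + 1))) - K (y (φ N))‖ + (‖R‖ + ‖R‖) := by
    have : S (y (φ (N + 1))) - S (y (φ N)) = (K (y (φ (N + 1))) - K (y (φ N))) +
        (R (y (φ (N + 1))) - R (y (φ N))) := by
      simp only [hS, _root_.add_apply]; abel
    rw [this]
    refine (norm_add_le _ _).trans (add_le_add le_rfl ((norm_sub_le _ _).trans ?_))
    refine add_le_add ?_ ?_ <;> exact (R.le_opNorm _).trans (by rw [hy1, mul_one])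
  simp only [Nat.succ_eq_add_one] at h2
  linarith

variable [CompleteSpace E]

lemma bijective_sub_smul_of_norm_lt {R : E →L[ℂ] E} {w : ℂ} (hw : ‖R‖ < ‖w‖) :
    Function.Bijective (R - w • (1 : E →L[ℂ] E)) := by
  rw [← ContinuousLinearMap.isUnit_iff_bijective]
  by_contra h
  have : w ∈ spectrum ℂ R := by
    rw [spectrum.mem_iff, Algebra.algebraMap_eq_smul_one, ← IsUnit.neg_iff, neg_sub]
    exact h
  rcases subsingleton_or_nontrivial E with hE | hE
  · have h1 : Subsingleton (E →L[ℂ] E) := inferInstance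
    exact h (isUnit_of_subsingleton _)
  · have := spectrum.norm_le_norm_of_mem this
    linarith

lemma mem_spectrum_iff_not_bijective {T : E →L[ℂ] E} {z : ℂ} :
    z ∈ spectrum ℂ T ↔ ¬ Function.Bijective (T - z • (1 : E →L[ℂ] E)) := by
  rw [← ContinuousLinearMap.isUnit_iff_bijective, spectrum.mem_iff,
    Algebra.algebraMap_eq_smul_one, ← IsUnit.neg_iff, neg_sub]

/-- Powers of `B + K` with `K` of finite rank. -/
lemma exists_finite_rank_pow {V : Type*} [AddCommGroup V] [Module ℂ V] (B K : Module.End ℂ V)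
    [FiniteDimensional ℂ (LinearMap.range K)] (m : ℕ) :
    ∃ K' : Module.End ℂ V, FiniteDimensional ℂ (LinearMap.range K') ∧ (B + K) ^ m = B ^ m + K' := by
  induction m with
  | zero => exact ⟨0, by rw [LinearMap.range_zero]; infer_instance, by simp⟩
  | succ m ih =>
    obtain ⟨K', hK', h⟩ := ih
    refine ⟨K' * (B + K) + B ^ m * K, ?_, by rw [pow_succ, h, pow_succ]; noncomm_ring⟩
    have h1 : FiniteDimensional ℂ (LinearMap.range (K' * (B + K))) :=
      Submodule.finiteDimensional_of_le (LinearMap.range_comp_le_range (B + K) K')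
    have h2 : FiniteDimensional ℂ (LinearMap.range (B ^ m * K)) := by
      rw [Module.End.mul_eq_comp, LinearMap.range_comp]; infer_instance
    exact Submodule.finiteDimensional_of_le (LinearMap.range_add_le _ _)

/-- Outside the disc of radius `4‖R‖`, the operator `K + R - w` has finite ascent and descent. -/
lemma exists_ascent {S K R : E →L[ℂ] E} (hS : S = K + R)
    [FiniteDimensional ℂ (LinearMap.range (K : E →ₗ[ℂ] E))] {w : ℂ} (hw : 4 * ‖R‖ < ‖w‖) :
    ∃ m : ℕ, (∀ k, LinearMap.ker (((S : E →ₗ[ℂ] E) - w • LinearMap.id : Module.End ℂ E) ^ k) ≤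
        LinearMap.ker (((S : E →ₗ[ℂ] E) - w • LinearMap.id : Module.End ℂ E) ^ m)) ∧
      ∀ k, m ≤ k →
        FiniteDimensional ℂ
          (LinearMap.ker (((S : E →ₗ[ℂ] E) - w • LinearMap.id : Module.End ℂ E) ^ k)) ∧
        IsCompl (LinearMap.ker (((S : E →ₗ[ℂ] E) - w • LinearMap.id : Module.End ℂ E) ^ k))
          (LinearMap.range (((S : E →ₗ[ℂ] E) - w • LinearMap.id : Module.End ℂ E) ^ k)) := by
  set A : Module.End ℂ E := (S : E →ₗ[ℂ] E) - w • LinearMap.id with hA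
  have hcl : ∀ k, IsClosed (LinearMap.ker (A ^ k) : Set E) := by
    intro k
    have : A ^ k = (((S - w • (1 : E →L[ℂ] E)) ^ k : E →L[ℂ] E) : E →ₗ[ℂ] E) := by
      rw [ContinuousLinearMap.toLinearMap_pow]; rfl
    rw [this]
    exact ((S - w • (1 : E →L[ℂ] E)) ^ k).isClosed_ker
  -- If the kernels of the powers never stabilized, they would form a forbidden infinite flag, since
  -- `A` maps each kernel into the previous one.
  obtain ⟨m, hm⟩ : ∃ m, LinearMap.ker (A ^ (m + 1)) ≤ LinearMap.ker (A ^ m) := by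
    by_contra! hcon
    refine no_infinite_flag hS hw (fun _ => w) (fun _ => le_rfl) (fun k => LinearMap.ker (A ^ k))
      hcl (fun k => lt_of_le_not_ge (ker_pow_mono A k.le_succ) (hcon k)) ?_
    intro k x hx
    rw [LinearMap.mem_ker] at hx ⊢
    have : S x - w • x = A x := rfl
    rw [this, ← Module.End.mul_apply, ← pow_succ, hx]
  have hstab : ∀ j, LinearMap.ker (A ^ (m + j)) ≤ LinearMap.ker (A ^ m) := by
    intro j
    induction j with
    | zero => exact le_rfl
    | succ j ih =>
      intro x hx
      rw [LinearMap.mem_ker, ← add_assoc, add_right_comm, pow_add, Module.End.mul_apply] at hx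
      apply ih
      rw [LinearMap.mem_ker, pow_add, Module.End.mul_apply]
      have h1 : (A ^ j) x ∈ LinearMap.ker (A ^ (m + 1)) := hx
      exact hm h1
  have hall : ∀ k, LinearMap.ker (A ^ k) ≤ LinearMap.ker (A ^ m) := fun k =>
    (ker_pow_mono A (Nat.le_add_left k m)).trans (hstab k)
  refine ⟨m, hall, fun k hk => ?_⟩
  -- `R - w` is invertible because `‖R‖ < ‖w‖`, so every `A ^ k` is an invertible operator plus one
  -- of finite rank.
  let B : Module.End ℂ E := (R : E →ₗ[ℂ] E) - w • LinearMap.id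
  have hB : Function.Bijective B :=
    bijective_sub_smul_of_norm_lt (lt_of_le_of_lt (by linarith [norm_nonneg R]) hw)
  have hAB : A = B + (K : E →ₗ[ℂ] E) := by
    ext x
    simp only [A, B, hS, LinearMap.sub_apply, LinearMap.add_apply, ContinuousLinearMap.coe_coe,
      _root_.add_apply]
    abel
  obtain ⟨K', hK', hpow⟩ := exists_finite_rank_pow B (K : E →ₗ[ℂ] E) k
  refine isCompl_ker_range_of_finite_rank (B := B ^ k) (K := K') (by rw [hAB, hpow]) ?_ ?_
  · rw [Module.End.coe_pow]
    exact hB.iterate k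
  · exact disjoint_ker_range_pow ((hall _).trans (ker_pow_mono A hk))

/-- Fredholm alternative: injectivity of `S - w` makes the kernels of its powers trivial, and the
complementary range of a high power is then everything. -/
lemma exists_eigenvector_of_mem_spectrum {S K R : E →L[ℂ] E} (hS : S = K + R)
    [FiniteDimensional ℂ (LinearMap.range (K : E →ₗ[ℂ] E))] {w : ℂ} (hw : 4 * ‖R‖ < ‖w‖)
    (hwS : w ∈ spectrum ℂ S) : ∃ x, x ≠ 0 ∧ S x = w • x := by
  by_contra! hcon
  rw [mem_spectrum_iff_not_bijective] at hwS
  obtain ⟨m, hall, hm⟩ := exists_ascent hS hw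
  have hker : LinearMap.ker ((S : E →ₗ[ℂ] E) - w • LinearMap.id : Module.End ℂ E) = ⊥ := by
    rw [LinearMap.ker_eq_bot']
    intro x hx
    by_contra h0
    refine hcon x h0 ?_
    have : S x - w • x = 0 := hx
    exact sub_eq_zero.1 this
  have hinj : Function.Injective ((S : E →ₗ[ℂ] E) - w • LinearMap.id : Module.End ℂ E) :=
    LinearMap.ker_eq_bot.1 hker
  refine hwS ⟨hinj, ?_⟩
  -- The exponent `m + 1`, not `m`, leaves one factor of `S - w` to provide the preimage.
  have h2 := (hm (m + 1) (Nat.le_succ m)).2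
  have h3 : LinearMap.ker (((S : E →ₗ[ℂ] E) - w • LinearMap.id : Module.End ℂ E) ^ (m + 1)) = ⊥ := by
    rw [LinearMap.ker_eq_bot, Module.End.coe_pow]
    exact hinj.iterate _
  rw [h3] at h2
  have h4 := h2.sup_eq_top
  rw [bot_sup_eq, LinearMap.range_eq_top] at h4
  intro y
  obtain ⟨x, hx⟩ := h4 y
  refine ⟨(((S : E →ₗ[ℂ] E) - w • LinearMap.id : Module.End ℂ E) ^ m) x, ?_⟩
  rw [pow_succ'] at hx
  exact hx

/-- Infinitely many such points would give independent eigenvectors `x k`. Their successive spans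
form a flag on which `S - w k` lowers the index, because it kills `x k`. -/
lemma finite_spectrum_outside {S K R : E →L[ℂ] E} (hS : S = K + R)
    [FiniteDimensional ℂ (LinearMap.range (K : E →ₗ[ℂ] E))] {ρ : ℝ} (hρ : 4 * ‖R‖ < ρ) :
    {w | w ∈ spectrum ℂ S ∧ ρ ≤ ‖w‖}.Finite := by
  by_contra hinf
  have hinf' : {w | w ∈ spectrum ℂ S ∧ ρ ≤ ‖w‖}.Infinite := hinf
  let w : ℕ ↪ {w | w ∈ spectrum ℂ S ∧ ρ ≤ ‖w‖} := hinf'.natEmbedding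
  have hex : ∀ k, ∃ x, x ≠ 0 ∧ S x = (w k : ℂ) • x := fun k =>
    exists_eigenvector_of_mem_spectrum hS (hρ.trans_le (w k).2.2) (w k).2.1
  choose x hx0 hx using hex
  have hli : LinearIndependent ℂ x := by
    refine Module.End.eigenvectors_linearIndependent' (S : E →ₗ[ℂ] E) (fun k => (w k : ℂ))
      (fun i j h => w.injective (Subtype.ext h)) x fun k => ?_
    rw [Module.End.hasEigenvector_iff, Module.End.mem_eigenspace_iff]
    exact ⟨hx k, hx0 k⟩
  refine no_infinite_flag hS hρ (fun k => (w k : ℂ)) (fun k => (w k).2.2)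
    (fun k => Submodule.span ℂ (x '' Iio k)) (fun k => ?_) (fun k => ?_) ?_
  · have : FiniteDimensional ℂ (Submodule.span ℂ (x '' Iio k)) :=
      FiniteDimensional.span_of_finite ℂ ((finite_Iio k).image x)
    exact Submodule.closed_of_finiteDimensional _
  · refine lt_of_le_of_ne (Submodule.span_mono (image_mono (Iio_subset_Iio k.le_succ))) ?_
    intro h
    have h1 : x k ∈ Submodule.span ℂ (x '' Iio (k + 1)) :=
      Submodule.subset_span ⟨k, by simp, rfl⟩
    rw [← h] at h1
    exact hli.notMem_span_image (s := Iio k) (by simp) h1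
  · intro k y hy
    refine Submodule.span_induction ?_ ?_ ?_ ?_ hy
    · rintro _ ⟨j, hj, rfl⟩
      rw [hx, ← sub_smul]
      rcases (Nat.lt_succ_iff_lt_or_eq.1 hj) with h | h
      · exact Submodule.smul_mem _ _ (Submodule.subset_span ⟨j, h, rfl⟩)
      · rw [h, sub_self, zero_smul]; exact Submodule.zero_mem _
    · simp
    · intro a b _ _ ha hb
      have := Submodule.add_mem _ ha hb
      convert this using 1
      rw [map_add, smul_add]; abel
    · intro c a _ ha
      have := Submodule.smul_mem _ c ha
      convert this using 1
      rw [map_smul, smul_sub, smul_comm]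

/-- Quasi-compactness: if `Tⁿ` is a small perturbation of a finite rank operator, the points of
large modulus in the spectrum of `T` are discrete eigenvalues. -/
theorem isDiscreteEigenvalue_of_pow_eq {T K R : E →L[ℂ] E} {n : ℕ} (hn : n ≠ 0)
    (hT : T ^ n = K + R) [FiniteDimensional ℂ (LinearMap.range (K : E →ₗ[ℂ] E))] {z : ℂ}
    (hzR : 4 * ‖R‖ < ‖z‖ ^ n) (hz : z ∈ spectrum ℂ T) : IsDiscreteEigenvalue T z := by
  have hw : 4 * ‖R‖ < ‖z ^ n‖ := by rwa [norm_pow]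
  obtain ⟨m, hall, hm⟩ := exists_ascent hT hw
  set A : Module.End ℂ E := (T : E →ₗ[ℂ] E) - z • LinearMap.id with hA
  set V : Module.End ℂ E := ((T ^ n : E →L[ℂ] E) : E →ₗ[ℂ] E) - z ^ n • LinearMap.id with hV
  -- The cofactor in `Tⁿ - zⁿ = (T - z) Q`, which transfers the finite ascent and descent of `Tⁿ -
  -- zⁿ` to `T - z`.
  set Q : Module.End ℂ E := ∑ i ∈ Finset.range n,
    (T : Module.End ℂ E) ^ i * (z • (1 : Module.End ℂ E)) ^ (n - 1 - i) with hQ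
  have hcomm : Commute (T : Module.End ℂ E) (z • (1 : Module.End ℂ E)) :=
    (Commute.one_right _).smul_right z
  have hcomm2 : Commute A (T : Module.End ℂ E) :=
    (Commute.refl _).sub_left hcomm.symm
  have hcomm3 : Commute A (z • (1 : Module.End ℂ E)) := (Commute.one_right _).smul_right z
  have hAQ : Commute A Q :=
    Commute.sum_right _ _ _ fun i _ => (hcomm2.pow_right _).mul_right (hcomm3.pow_right _)
  have hVAQ : V = A * Q := by
    have h1 := hcomm.mul_geom_sum₂ n
    have h2 : V = (T : Module.End ℂ E) ^ n - (z • (1 : Module.End ℂ E)) ^ n := by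
      rw [hV, ContinuousLinearMap.toLinearMap_pow, smul_pow, one_pow]; rfl
    rw [h2, ← h1]; rfl
  have hmult := exists_isCompl_ker_range_pow_of_factor hAQ hVAQ hm hall
  refine ⟨?_, ?_, hmult⟩
  · obtain ⟨ρ, h1, h2⟩ := exists_between hw
    have hfin := finite_spectrum_outside hT h1
    -- The `n`-th power maps this set into a finite part of the spectrum of `Tⁿ`, and each value has
    -- finitely many `n`-th roots.
    have hfin2 : {u | u ∈ spectrum ℂ T ∧ ρ ≤ ‖u ^ n‖}.Finite := by
      refine Finite.subset (Finite.preimage' hfin (f := fun u : ℂ => u ^ n) fun b _ => ?_) ?_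
      · have : (Polynomial.X ^ n - Polynomial.C b : Polynomial ℂ) ≠ 0 :=
          Polynomial.X_pow_sub_C_ne_zero (Nat.pos_of_ne_zero hn) b
        refine (Polynomial.finite_setOfPred_isRoot this).subset fun u hu => ?_
        simp only [mem_preimage, mem_singleton_iff] at hu
        simp [hu]
      · rintro u ⟨hu, hu2⟩
        exact ⟨spectrum.pow_mem_pow T n hu, hu2⟩
    have hopen : {u : ℂ | ρ < ‖u ^ n‖} ∈ 𝓝 z :=
      (isOpen_lt continuous_const (by fun_prop)).mem_nhds h2
    intro hacc
    have := (accPt_iff_frequently.1 hacc)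
    have h3 := this.and_eventually hopen
    refine (frequently_iff.1 h3 (U := ({u | u ∈ spectrum ℂ T ∧ ρ ≤ ‖u ^ n‖} \ {z})ᶜ) ?_).elim ?_
    · exact (hfin2.subset sdiff_subset).isClosed.isOpen_compl.mem_nhds (by simp)
    · rintro u ⟨hu, ⟨hu1, hu2⟩, hu3⟩
      exact hu ⟨⟨hu2, le_of_lt hu3⟩, hu1⟩
  · rw [Module.End.hasEigenvalue_iff]
    intro hbot
    rw [mem_spectrum_iff_not_bijective] at hz
    have hinj : Function.Injective A := by
      rw [← LinearMap.ker_eq_bot, ← hbot, Module.End.eigenspace_def]; rfl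
    -- Without eigenvectors, `ker (A ^ k) = 0`, so `A ^ k` is onto. Then `T - z` is bijective,
    -- against `z` being in the spectrum.
    obtain ⟨k, hk1, -, hk⟩ := hmult
    have h3 : LinearMap.ker (A ^ k) = ⊥ := by
      rw [LinearMap.ker_eq_bot, Module.End.coe_pow]
      exact hinj.iterate _
    have h4 := hk.sup_eq_top
    rw [h3, bot_sup_eq, LinearMap.range_eq_top] at h4
    refine hz ⟨hinj, fun y => ?_⟩
    obtain ⟨x, hx⟩ := h4 y
    obtain ⟨j, rfl⟩ := Nat.exists_eq_add_of_le' hk1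
    refine ⟨(A ^ j) x, ?_⟩
    rw [pow_succ'] at hx
    exact hx

end Quasicompact
/-! ### Test functions and duality -/

section Duality

variable {α : ℝ}

lemma holderNorm_le (hα : 0 ≤ α) {K : ℝ} (hK : 0 ≤ K) {φ : ℝ → ℂ}
    (h1 : ∀ x ∈ Icc (0 : ℝ) 1, ‖φ x‖ ≤ K)
    (h2 : ∀ x ∈ Icc (0 : ℝ) 1, ∀ y ∈ Icc (0 : ℝ) 1, ‖φ x - φ y‖ ≤ K * |x - y| ^ α) :
    holderNorm α φ ≤ ENNReal.ofReal (2 * K) := by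
  rw [two_mul, ENNReal.ofReal_add hK hK]
  refine add_le_add (iSup₂_le fun x hx => ?_) (iSup₂_le fun x hx => iSup₂_le fun y hy => ?_)
  · rw [← ofReal_norm]
    exact ENNReal.ofReal_le_ofReal (h1 x hx)
  · refine ENNReal.div_le_of_le_mul ?_
    rw [edist_dist, edist_dist, dist_eq_norm, Real.dist_eq,
      ENNReal.ofReal_rpow_of_nonneg (abs_nonneg _) hα, ← ENNReal.ofReal_mul hK]
    exact ENNReal.ofReal_le_ofReal (h2 x hx y hy)

lemma norm_sub_le_of_mem_testFunctions (hα : 0 ≤ α) {φ : ℝ → ℂ} (hφ : φ ∈ testFunctions α)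
    {x y : ℝ} (hx : x ∈ Icc (0 : ℝ) 1) (hy : y ∈ Icc (0 : ℝ) 1) :
    ‖φ x - φ y‖ ≤ |x - y| ^ α := by
  rcases eq_or_ne x y with rfl | hxy
  · simpa using Real.rpow_nonneg le_rfl α
  have h1 : edist (φ x) (φ y) / edist x y ^ α ≤ 1 := by
    refine le_trans ?_ hφ.2
    refine le_trans ?_ le_add_self
    exact le_iSup₂_of_le x hx (le_iSup₂_of_le y hy le_rfl)
  have h0 : edist x y ≠ 0 := by simpa using hxy
  have ht : edist x y ≠ ⊤ := edist_ne_top x y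
  rw [ENNReal.div_le_iff (by simp [ENNReal.rpow_eq_zero_iff, h0, ht])
    (ENNReal.rpow_ne_top_of_nonneg hα ht), one_mul, edist_dist, edist_dist, dist_eq_norm,
    Real.dist_eq, ENNReal.ofReal_rpow_of_nonneg (abs_nonneg _) hα,
    ENNReal.ofReal_le_ofReal_iff (by positivity)] at h1
  exact h1

lemma pairing_const_smul (h : ℝ → ℂ) (c : ℂ) (φ : ℝ → ℂ) :
    pairing h (c • φ) = c * pairing h φ := by
  unfold pairing
  rw [← integral_const_mul]
  refine integral_congr_ae (Eventually.of_forall fun x => ?_)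
  simp only
  rw [derivWithin_const_smul_field, smul_eq_mul]
  ring

/-- Homogeneity: rescaling by `k⁻¹` produces an admissible test function. -/
lemma enorm_pairing_le (h : Lp ℂ 1 leb) {φ : ℝ → ℂ} (hφ : ContDiffOn ℝ 1 φ (Icc 0 1)) {k : ℝ}
    (hk : 0 < k) (hn : holderNorm α φ ≤ ENNReal.ofReal k) :
    ‖pairing h φ‖ₑ ≤ ENNReal.ofReal k * eNormB α h := by
  have hkc : ‖((k⁻¹ : ℝ) : ℂ)‖ₑ = ENNReal.ofReal k⁻¹ := by
    rw [← ofReal_norm, Complex.norm_real, Real.norm_of_nonneg (by positivity)]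
  have hmul : ENNReal.ofReal k⁻¹ * ENNReal.ofReal k = 1 := by
    rw [← ENNReal.ofReal_mul (by positivity), inv_mul_cancel₀ hk.ne', ENNReal.ofReal_one]
  have hmem : ((k⁻¹ : ℝ) : ℂ) • φ ∈ testFunctions α := by
    refine ⟨hφ.const_smul ((k⁻¹ : ℝ) : ℂ), ?_⟩
    have : holderNorm α (((k⁻¹ : ℝ) : ℂ) • φ) ≤ ENNReal.ofReal k⁻¹ * holderNorm α φ := by
      unfold holderNorm
      rw [mul_add]
      refine add_le_add (iSup₂_le fun x hx => ?_) (iSup₂_le fun x hx => iSup₂_le fun y hy => ?_)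
      · rw [Pi.smul_apply, enorm_smul, hkc]
        gcongr
        exact le_iSup₂_of_le x hx le_rfl
      · rw [Pi.smul_apply, Pi.smul_apply, edist_smul₀, ENNReal.smul_def,
          smul_eq_mul, ← enorm_eq_nnnorm, hkc, mul_div_assoc]
        gcongr
        exact le_iSup₂_of_le x hx (le_iSup₂_of_le y hy le_rfl)
    refine this.trans ?_
    calc _ ≤ ENNReal.ofReal k⁻¹ * ENNReal.ofReal k := by gcongr
      _ = 1 := hmul
  have h1 : ‖pairing h (((k⁻¹ : ℝ) : ℂ) • φ)‖ₑ ≤ eNormB α h :=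
    le_iSup₂ (f := fun φ (_ : φ ∈ testFunctions α) => ‖pairing h φ‖ₑ) _ hmem
  rw [pairing_const_smul, enorm_mul, hkc] at h1
  calc ‖pairing h φ‖ₑ = (ENNReal.ofReal k⁻¹ * ENNReal.ofReal k) * ‖pairing h φ‖ₑ := by
        rw [hmul, one_mul]
    _ = ENNReal.ofReal k * (ENNReal.ofReal k⁻¹ * ‖pairing h φ‖ₑ) := by ring
    _ ≤ _ := by gcongr

/-- The primitives of `ψ` are `α`-Hölder at scale one, with constant `K`. -/
def HasHolderPrimitive (α K : ℝ) (ψ : ℝ → ℂ) : Prop :=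
  ∀ u v : ℝ, u ≤ v → v - u ≤ 1 → ‖∫ t in u..v, ψ t‖ ≤ K * (v - u) ^ α

lemma intervalIntegrable_of_bounded {ψ : ℝ → ℂ} (hm : Measurable ψ) {D : ℝ}
    (hD : ∀ x, ‖ψ x‖ ≤ D) (u v : ℝ) : IntervalIntegrable ψ volume u v := by
  refine (intervalIntegrable_const (c := D)).mono_fun hm.aestronglyMeasurable ?_
  exact Eventually.of_forall fun x => (hD x).trans (le_abs_self D)

/-- The difference quotients of the primitive of a bounded function `ψ` are derivatives of
functions whose Hölder norm is controlled. -/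
lemma exists_smooth_approx (hα : 0 ≤ α) {K : ℝ} (hK : 0 < K) {ψ : ℝ → ℂ} (hm : Measurable ψ)
    {D : ℝ} (hD : ∀ x, ‖ψ x‖ ≤ D) (hψ : HasHolderPrimitive α K ψ) {ε : ℝ} (hε : 0 < ε) :
    ∃ φ : ℝ → ℂ, ContDiff ℝ 1 φ ∧ holderNorm α φ ≤ ENNReal.ofReal (2 * K) ∧
      ∀ x, HasDerivAt φ (((ε⁻¹ : ℝ) : ℂ) * ∫ t in x..(x + ε), ψ t) x := by
  have hint := intervalIntegrable_of_bounded hm hD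
  set H : ℝ → ℂ := fun x => ∫ t in (0 : ℝ)..x, ψ t with hH
  have hHc : Continuous H := intervalIntegral.continuous_primitive hint 0
  have hHd : ∀ x y, H y - H x = ∫ t in x..y, ψ t := fun x y =>
    intervalIntegral.integral_interval_sub_left (hint _ _) (hint _ _)
  have hH1 : ∀ x y : ℝ, |x - y| ≤ 1 → ‖H x - H y‖ ≤ K * |x - y| ^ α := by
    intro x y hxy
    rcases le_total x y with h | h
    · rw [norm_sub_rev, hHd, abs_sub_comm, abs_of_nonneg (by linarith)]
      rw [abs_sub_comm, abs_of_nonneg (by linarith)] at hxy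
      exact hψ x y h hxy
    · rw [hHd, abs_of_nonneg (by linarith)]
      rw [abs_of_nonneg (by linarith)] at hxy
      exact hψ y x h hxy
  set G : ℝ → ℂ := fun x => ∫ t in (0 : ℝ)..x, H t with hG
  have hGd : ∀ x, HasDerivAt G (H x) x := fun x => (hHc.integral_hasStrictDerivAt 0 x).hasDerivAt
  set Φ : ℝ → ℂ := fun x => ((ε⁻¹ : ℝ) : ℂ) * (G (x + ε) - G x) with hΦ
  have hΦd : ∀ x, HasDerivAt Φ (((ε⁻¹ : ℝ) : ℂ) * (H (x + ε) - H x)) x := fun x =>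
    (((hGd (x + ε)).comp_add_const x ε).sub (hGd x)).const_mul _
  -- `Φ` is an average of translates of the primitive `H`, so it inherits the Hölder bound of `H`
  -- with the same constant.
  have hΦi : ∀ x, Φ x = ((ε⁻¹ : ℝ) : ℂ) * ∫ t in (0 : ℝ)..ε, H (x + t) := by
    intro x
    have h1 : G (x + ε) - G x = ∫ t in x..(x + ε), H t :=
      intervalIntegral.integral_interval_sub_left (hHc.intervalIntegrable _ _)
        (hHc.intervalIntegrable _ _)
    have h2 := intervalIntegral.integral_comp_add_left (a := 0) (b := ε) H x
    rw [add_zero] at h2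
    simp only [hΦ]
    rw [h1, h2]
  have hΦ1 : ∀ x y : ℝ, |x - y| ≤ 1 → ‖Φ x - Φ y‖ ≤ K * |x - y| ^ α := by
    intro x y hxy
    have hi : ∀ z, IntervalIntegrable (fun t => H (z + t)) volume 0 ε := fun z =>
      (hHc.comp (by fun_prop)).intervalIntegrable _ _
    rw [hΦi, hΦi, ← mul_sub, ← intervalIntegral.integral_sub (hi x) (hi y), norm_mul,
      Complex.norm_real, Real.norm_of_nonneg (by positivity), inv_mul_le_iff₀ hε]
    have h1 := intervalIntegral.norm_integral_le_of_norm_le_const (a := 0) (b := ε)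
      (f := fun t => H (x + t) - H (y + t)) (C := K * |x - y| ^ α) (fun t _ => by
        have := hH1 (x + t) (y + t) (by rwa [add_sub_add_right_eq_sub])
        rwa [add_sub_add_right_eq_sub] at this)
    rw [sub_zero, abs_of_pos hε] at h1
    linarith
  have habs : ∀ x ∈ Icc (0 : ℝ) 1, ∀ y ∈ Icc (0 : ℝ) 1, |x - y| ≤ 1 := by
    intro x hx y hy
    rw [abs_le]; constructor <;> linarith [hx.1, hx.2, hy.1, hy.2]
  have hder : ∀ x, HasDerivAt (fun x => Φ x - Φ 0)
      (((ε⁻¹ : ℝ) : ℂ) * ∫ t in x..(x + ε), ψ t) x := fun x => by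
    have := (hΦd x).sub_const (Φ 0)
    rwa [hHd] at this
  -- Subtracting `Φ 0` makes the function vanish at `0`, so the Hölder bound at scale one also
  -- bounds its supremum. The two halves of the Hölder norm add up to `2 * K`.
  refine ⟨fun x => Φ x - Φ 0, ?_, ?_, hder⟩
  · rw [contDiff_one_iff_deriv]
    refine ⟨fun x => (hder x).differentiableAt, ?_⟩
    rw [show deriv (fun x => Φ x - Φ 0) = fun x => ((ε⁻¹ : ℝ) : ℂ) * (H (x + ε) - H x) from
      funext fun x => by rw [(hder x).deriv, hHd]]
    fun_prop
  · refine holderNorm_le hα hK.le (fun x hx => ?_) fun x hx y hy => ?_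
    · have h0 : (0 : ℝ) ∈ Icc (0 : ℝ) 1 := by simp
      refine (hΦ1 x 0 (habs x hx 0 h0)).trans ?_
      have : |x - 0| ^ α ≤ 1 := Real.rpow_le_one (abs_nonneg _) (habs x hx 0 h0) hα
      nlinarith
    · rw [sub_sub_sub_cancel_right]
      exact hΦ1 x y (habs x hx y hy)

/-- The duality pairing extends to bounded functions with a Hölder primitive. -/
lemma enorm_integral_mul_le (hα : 0 ≤ α) {K : ℝ} (hK : 0 < K) {ψ : ℝ → ℂ} (hm : Measurable ψ)
    {D : ℝ} (hD : ∀ x, ‖ψ x‖ ≤ D) (hψ : HasHolderPrimitive α K ψ) (h : Lp ℂ 1 leb) :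
    ‖∫ x, h x * ψ x ∂leb‖ₑ ≤ ENNReal.ofReal (2 * K) * eNormB α h := by
  have hint := intervalIntegrable_of_bounded hm hD
  have hD0 : 0 ≤ D := (norm_nonneg _).trans (hD 0)
  set ε : ℕ → ℝ := fun n => 1 / ((n : ℝ) + 1) with hε
  have hεpos : ∀ n, 0 < ε n := fun n => by positivity
  choose φ hφc hφn hφd using fun n => exists_smooth_approx hα hK hm hD hψ (hεpos n)
  have hder : ∀ n, ∀ x ∈ Icc (0 : ℝ) 1, derivWithin (φ n) (Icc 0 1) x =
      (((ε n)⁻¹ : ℝ) : ℂ) * ∫ t in x..(x + ε n), ψ t := fun n x hx =>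
    (hφd n x).hasDerivWithinAt.derivWithin (uniqueDiffOn_Icc zero_lt_one x hx)
  have hloc : LocallyIntegrable ψ volume := by
    rw [locallyIntegrable_iff]
    intro k hk
    refine Measure.integrableOn_of_bounded (M := D) hk.measure_lt_top.ne
      hm.aestronglyMeasurable (Eventually.of_forall hD)
  -- The difference quotients converge to `ψ` almost everywhere by Lebesgue differentiation and are
  -- bounded by `D`, so dominated convergence applies.
  have hlim : Tendsto (fun n => pairing h (φ n)) atTop (𝓝 (∫ x, h x * ψ x ∂leb)) := by
    unfold pairing
    refine tendsto_integral_of_dominated_convergence (fun x => ‖h x‖ * D)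
      (fun n => (integrable_pairing h (hφc n).contDiffOn).aestronglyMeasurable)
      ((L1.integrable_coeFn h).norm.mul_const D) (fun n => ?_) ?_
    · refine (ae_restrict_iff' measurableSet_Icc).2 (Eventually.of_forall fun x hx => ?_)
      rw [hder n x hx, norm_mul]
      gcongr
      rw [norm_mul, Complex.norm_real, Real.norm_of_nonneg (by have := hεpos n; positivity),
        inv_mul_le_iff₀ (hεpos n)]
      have := intervalIntegral.norm_integral_le_of_norm_le_const (a := x) (b := x + ε n) (f := ψ)
        (C := D) fun t _ => hD t
      rw [add_sub_cancel_left, abs_of_pos (hεpos n)] at this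
      linarith
    · have h1 := ae_restrict_of_ae (s := Icc (0 : ℝ) 1) (_root_.LocallyIntegrable.ae_hasDerivAt_integral hloc)
      filter_upwards [h1, ae_restrict_mem measurableSet_Icc] with x hx hx01
      have h2 := (hx 0).tendsto_slope_zero
      have h3 : Tendsto ε atTop (𝓝[≠] 0) := by
        refine tendsto_nhdsWithin_iff.2 ⟨tendsto_one_div_add_atTop_nhds_zero_nat, ?_⟩
        exact Eventually.of_forall fun n => (hεpos n).ne'
      have h4 := h2.comp h3
      refine Tendsto.congr (fun n => ?_) (h4.const_mul (h x))
      rw [hder n x hx01, Function.comp_apply,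
        intervalIntegral.integral_interval_sub_left (hint _ _) (hint _ _), Complex.real_smul]
  refine le_of_tendsto hlim.enorm (Eventually.of_forall fun n => ?_)
  exact enorm_pairing_le h (hφc n).contDiffOn (by positivity) (hφn n)

/-- `‖h‖₁ ≤ 2 ‖h‖_α`. -/
lemma enorm_le_eNormB (hα0 : 0 ≤ α) (hα1 : α ≤ 1) (h : Lp ℂ 1 leb) :
    ‖h‖ₑ ≤ 2 * eNormB α h := by
  -- The conjugate phase of `h`, equal to `0` where `h` vanishes: it is bounded by `1`, so its
  -- primitive is Lipschitz, hence `α`-Hölder with constant `1` at scale one, and `h ψ = |h|`.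
  set ψ : ℝ → ℂ := fun x => (starRingEnd ℂ (h x)) * ((‖h x‖⁻¹ : ℝ) : ℂ) with hψ
  have hhm : Measurable (h : ℝ → ℂ) := (Lp.stronglyMeasurable h).measurable
  have hm : Measurable ψ :=
    (Complex.continuous_conj.measurable.comp hhm).mul
      (Complex.measurable_ofReal.comp hhm.norm.inv)
  have hb : ∀ x, ‖ψ x‖ ≤ 1 := by
    intro x
    rw [hψ]
    simp only
    rw [norm_mul, Complex.norm_real, RCLike.norm_conj, norm_inv, norm_norm]
    exact mul_inv_le_one
  have hprim : HasHolderPrimitive α 1 ψ := by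
    intro u v huv h1
    have := intervalIntegral.norm_integral_le_of_norm_le_const (a := u) (b := v) (f := ψ)
        (C := 1) fun t _ => hb t
    rw [abs_of_nonneg (by linarith), one_mul] at this
    rw [one_mul]
    refine this.trans ?_
    calc v - u = (v - u) ^ (1 : ℝ) := (Real.rpow_one _).symm
      _ ≤ (v - u) ^ α := by
        rcases eq_or_lt_of_le huv with rfl | hlt
        · simpa using Real.rpow_nonneg le_rfl α
        · exact Real.rpow_le_rpow_of_exponent_ge (by linarith) h1 hα1
  have h1 := enorm_integral_mul_le hα0 one_pos hm hb hprim h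
  have h2 : ∫ x, h x * ψ x ∂leb = ((‖h‖ : ℝ) : ℂ) := by
    rw [L1.norm_eq_integral_norm, ← integral_complex_ofReal]
    refine integral_congr_ae (Eventually.of_forall fun x => ?_)
    simp only [hψ]
    rw [← mul_assoc, Complex.mul_conj, Complex.normSq_eq_norm_sq, ← Complex.ofReal_mul]
    congr 1
    rcases eq_or_ne (‖h x‖) 0 with h0 | h0
    · rw [h0]; simp
    · field_simp
  rw [h2, ← ofReal_norm, Complex.norm_real, norm_norm, ofReal_norm] at h1
  simpa using h1

end Duality
/-! ### Completeness of `B_α` -/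

section Complete

lemma integrable_mul_of_bounded (h : Lp ℂ 1 leb) {u : ℝ → ℂ} (hm : AEStronglyMeasurable u leb)
    {D : ℝ} (hD : ∀ x ∈ Icc (0 : ℝ) 1, ‖u x‖ ≤ D) : Integrable (fun x => h x * u x) leb :=
  (L1.integrable_coeFn h).mul_bdd (c := D) hm
    ((ae_restrict_iff' measurableSet_Icc).2 (Eventually.of_forall hD))

/-- Integration against a bounded function, as a continuous functional on `L¹`. -/
noncomputable def integralMul (u : ℝ → ℂ) (hm : AEStronglyMeasurable u leb) (D : ℝ)
    (hD : ∀ x ∈ Icc (0 : ℝ) 1, ‖u x‖ ≤ D) : Lp ℂ 1 leb →L[ℂ] ℂ :=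
  LinearMap.mkContinuous
    { toFun := fun h => ∫ x, h x * u x ∂leb
      map_add' := fun h k => by
        rw [← integral_add (integrable_mul_of_bounded h hm hD) (integrable_mul_of_bounded k hm hD)]
        refine integral_congr_ae ?_
        filter_upwards [Lp.coeFn_add h k] with x hx
        rw [hx, Pi.add_apply, add_mul]
      map_smul' := fun c h => by
        rw [RingHom.id_apply, smul_eq_mul, ← integral_const_mul]
        refine integral_congr_ae ?_
        filter_upwards [Lp.coeFn_smul c h] with x hx
        rw [hx, Pi.smul_apply, smul_eq_mul, mul_assoc] }
    D fun h => by
      rw [L1.norm_eq_integral_norm, ← integral_const_mul]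
      refine norm_integral_le_of_norm_le ((L1.integrable_coeFn h).norm.const_mul D) ?_
      refine (ae_restrict_iff' measurableSet_Icc).2 (Eventually.of_forall fun x hx => ?_)
      rw [norm_mul, mul_comm]
      gcongr
      exact hD x hx

@[simp] lemma integralMul_apply (u : ℝ → ℂ) (hm : AEStronglyMeasurable u leb) (D : ℝ)
    (hD : ∀ x ∈ Icc (0 : ℝ) 1, ‖u x‖ ≤ D) (h : Lp ℂ 1 leb) :
    integralMul u hm D hD h = ∫ x, h x * u x ∂leb := rfl

lemma continuous_pairing {φ : ℝ → ℂ} (hφ : ContDiffOn ℝ 1 φ (Icc 0 1)) :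
    Continuous fun h : Lp ℂ 1 leb => pairing h φ := by
  have hc : ContinuousOn (derivWithin φ (Icc 0 1)) (Icc 0 1) :=
    hφ.continuousOn_derivWithin (uniqueDiffOn_Icc zero_lt_one) le_rfl
  obtain ⟨C, hC⟩ := isCompact_Icc.exists_bound_of_continuousOn hc
  exact (integralMul _ (hc.aestronglyMeasurable measurableSet_Icc) C hC).continuous

variable {α : Ico (0 : ℝ) 1}

lemma BSpace.norm_def (h : BSpace α) : ‖h‖ = (eNormB α h.density).toReal := rfl

lemma BSpace.eNormB_lt_top (h : BSpace α) : eNormB α h.density < ⊤ := h.2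

lemma BSpace.ofReal_norm (h : BSpace α) : ENNReal.ofReal ‖h‖ = eNormB α h.density :=
  ENNReal.ofReal_toReal h.eNormB_lt_top.ne

lemma BSpace.density_sub (h k : BSpace α) : (h - k).density = h.density - k.density := rfl

lemma BSpace.density_add (h k : BSpace α) : (h + k).density = h.density + k.density := rfl

lemma BSpace.density_smul (c : ℂ) (h : BSpace α) : (c • h).density = c • h.density := rfl

lemma BSpace.density_injective : Function.Injective (BSpace.density (α := α)) :=
  Subtype.val_injective

lemma BSpace.norm_le_of_eNormB_le {h : BSpace α} {C : ℝ} (hC : 0 ≤ C)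
    (hh : eNormB α h.density ≤ ENNReal.ofReal C) : ‖h‖ ≤ C := by
  rw [BSpace.norm_def]
  exact ENNReal.toReal_le_of_le_ofReal hC hh

/-- The inclusion of `B_α` into `L¹`. -/
noncomputable def BSpace.toL1 : BSpace α →L[ℂ] Lp ℂ 1 leb :=
  LinearMap.mkContinuous
    { toFun := BSpace.density
      map_add' := fun _ _ => rfl
      map_smul' := fun _ _ => rfl }
    2 fun h => by
      have h1 := enorm_le_eNormB α.2.1 α.2.2.le h.density
      rw [← h.ofReal_norm, ← _root_.ofReal_norm,
        show (2 : ℝ≥0∞) = ENNReal.ofReal 2 by simp, ← ENNReal.ofReal_mul (by norm_num)] at h1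
      exact (ENNReal.ofReal_le_ofReal_iff (by positivity)).1 h1

/-- A Cauchy sequence converges in `L¹`. As a supremum of moduli of `L¹`-continuous functionals,
`eNormB` is lower semicontinuous there, so the Cauchy bounds pass to the limit. -/
instance : CompleteSpace (BSpace α) := by
  refine Metric.complete_of_cauchySeq_tendsto fun u hu => ?_
  obtain ⟨g, hg⟩ := cauchySeq_tendsto_of_complete
    ((BSpace.toL1 (α := α)).uniformContinuous.comp_cauchySeq hu)
  have key : ∀ ε : ℝ, 0 < ε → ∃ N, ∀ n ≥ N,
      eNormB α ((u n).density - g) ≤ ENNReal.ofReal ε := by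
    intro ε hε
    obtain ⟨N, hN⟩ := Metric.cauchySeq_iff.1 hu ε hε
    refine ⟨N, fun n hn => iSup₂_le fun φ hφ => ?_⟩
    have hlim : Tendsto (fun m => pairing ((u n).density - (u m).density : Lp ℂ 1 leb) φ) atTop
        (𝓝 (pairing ((u n).density - g : Lp ℂ 1 leb) φ)) :=
      ((continuous_pairing hφ.1).tendsto _).comp (tendsto_const_nhds.sub hg)
    refine le_of_tendsto hlim.enorm (eventually_atTop.2 ⟨N, fun m hm => ?_⟩)
    have h1 := hN n hn m hm
    rw [dist_eq_norm] at h1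
    refine le_trans ?_ (ENNReal.ofReal_le_ofReal h1.le)
    rw [BSpace.ofReal_norm, BSpace.density_sub]
    exact le_iSup₂ (f := fun φ (_ : φ ∈ testFunctions α) =>
      ‖pairing ((u n).density - (u m).density : Lp ℂ 1 leb) φ‖ₑ) φ hφ
  have hgmem : g ∈ BSubmodule (α : ℝ) := by
    obtain ⟨N, hN⟩ := key 1 one_pos
    have h1 : (u N).density - g ∈ BSubmodule (α : ℝ) :=
      (hN N le_rfl).trans_lt ENNReal.ofReal_lt_top
    have h2 := (BSubmodule (α : ℝ)).sub_mem (u N).2 h1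
    rwa [show ((u N).1 - ((u N).density - g) : Lp ℂ 1 leb) = g from sub_sub_cancel _ _] at h2
  let g' : BSpace α := ⟨g, hgmem⟩
  refine ⟨g', Metric.tendsto_atTop.2 fun ε hε => ?_⟩
  obtain ⟨N, hN⟩ := key (ε / 2) (half_pos hε)
  refine ⟨N, fun n hn => ?_⟩
  rw [dist_eq_norm]
  refine lt_of_le_of_lt (BSpace.norm_le_of_eNormB_le (half_pos hε).le ?_) (half_lt_self hε)
  exact hN n hn

end Complete
/-! ### The transfer operator on `L¹` -/

namespace IsPiecewiseExpanding

variable {f : ℝ → ℝ} {P : Set (Set ℝ)}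

lemma isOpen (hf : IsPiecewiseExpanding f P) {p : Set ℝ} (hp : p ∈ P) : IsOpen p := by
  obtain ⟨a, b, -, -, -, rfl⟩ := hf.interval p hp
  exact isOpen_Ioo

lemma subset_Icc (hf : IsPiecewiseExpanding f P) {p : Set ℝ} (hp : p ∈ P) : p ⊆ Icc 0 1 := by
  obtain ⟨a, b, ha, -, hb, rfl⟩ := hf.interval p hp
  exact fun x hx => ⟨ha.trans hx.1.le, hx.2.le.trans hb⟩

lemma ordConnected (hf : IsPiecewiseExpanding f P) {p : Set ℝ} (hp : p ∈ P) :
    p.OrdConnected := by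
  obtain ⟨a, b, -, -, -, rfl⟩ := hf.interval p hp
  exact ordConnected_Ioo

lemma nonempty (hf : IsPiecewiseExpanding f P) {p : Set ℝ} (hp : p ∈ P) : p.Nonempty := by
  obtain ⟨a, b, -, hab, -, rfl⟩ := hf.interval p hp
  exact nonempty_Ioo.2 hab

lemma countable (hf : IsPiecewiseExpanding f P) : P.Countable :=
  hf.disjoint.countable_of_isOpen (fun _ hp => hf.isOpen hp) fun _ hp => hf.nonempty hp

lemma isOpen_sUnion (hf : IsPiecewiseExpanding f P) : IsOpen (⋃₀ P) :=
  _root_.isOpen_sUnion fun _ hp => hf.isOpen hp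

lemma sUnion_subset (hf : IsPiecewiseExpanding f P) : ⋃₀ P ⊆ Icc 0 1 :=
  Set.sUnion_subset fun _ hp => hf.subset_Icc hp

lemma hasDerivAt (hf : IsPiecewiseExpanding f P) {p : Set ℝ} (hp : p ∈ P) {x : ℝ} (hx : x ∈ p) :
    HasDerivAt f (deriv f x) x :=
  (((hf.contDiffOn p hp).differentiableOn one_ne_zero).differentiableAt
    ((hf.isOpen hp).mem_nhds hx)).hasDerivAt

lemma continuousOn (hf : IsPiecewiseExpanding f P) {p : Set ℝ} (hp : p ∈ P) : ContinuousOn f p :=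
  (hf.contDiffOn p hp).continuousOn

lemma continuousOn_deriv (hf : IsPiecewiseExpanding f P) {p : Set ℝ} (hp : p ∈ P) :
    ContinuousOn (deriv f) p :=
  (hf.contDiffOn p hp).continuousOn_deriv_of_isOpen (hf.isOpen hp) le_rfl

end IsPiecewiseExpanding

/-- A lower bound of the derivative on an interval bounds the expansion from below. -/
lemma mul_abs_sub_le_of_deriv {F F' : ℝ → ℝ} {I : Set ℝ} (hI : I.OrdConnected)
    (hF : ∀ x ∈ I, HasDerivAt F (F' x) x) {c : ℝ} (hc : ∀ x ∈ I, c ≤ |F' x|) {x y : ℝ}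
    (hx : x ∈ I) (hy : y ∈ I) : c * |x - y| ≤ |F x - F y| := by
  wlog hxy : x < y generalizing x y
  · rcases eq_or_lt_of_le (not_lt.1 hxy) with rfl | h
    · simp
    · rw [abs_sub_comm, abs_sub_comm (F x)]
      exact this hy hx h
  have hsub : Icc x y ⊆ I := hI.out hx hy
  obtain ⟨z, hz, h⟩ := exists_hasDerivAt_eq_slope F F' hxy
    (fun t ht => (hF t (hsub ht)).continuousAt.continuousWithinAt)
    (fun t ht => hF t (hsub (Ioo_subset_Icc_self ht)))
  have h1 := hc z (hsub (Ioo_subset_Icc_self hz))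
  have h2 : F y - F x = F' z * (y - x) := by
    rw [h, div_mul_cancel₀ _ (sub_ne_zero.2 hxy.ne')]
  rw [abs_sub_comm x, abs_sub_comm (F x), h2, abs_mul]
  gcongr

namespace IsPiecewiseExpanding

variable {f : ℝ → ℝ} {P : Set (Set ℝ)}

lemma injOn (hf : IsPiecewiseExpanding f P) {p : Set ℝ} (hp : p ∈ P) : InjOn f p := by
  obtain ⟨c, hc, h⟩ := hf.expanding
  intro x hx y hy hxy
  have h1 := mul_abs_sub_le_of_deriv (hf.ordConnected hp) (fun x hx => hf.hasDerivAt hp hx)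
    (h p hp) hx hy
  rw [hxy, sub_self, abs_zero] at h1
  have h2 : |x - y| ≤ 0 := by nlinarith [abs_nonneg (x - y)]
  exact sub_eq_zero.1 (abs_nonpos_iff.1 h2)

end IsPiecewiseExpanding

section Transfer

variable {f : ℝ → ℝ} {P : Set (Set ℝ)} {ξ : ℝ → ℂ}

/-- The dual of the transfer operator: `u ↦ ξ |f'| u ∘ f`, extended by `0` off the domain
of `f`. -/
noncomputable def dualTransfer (f : ℝ → ℝ) (P : Set (Set ℝ)) (ξ : ℝ → ℂ) (u : ℝ → ℂ) : ℝ → ℂ :=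
  (⋃₀ P).indicator fun x => ξ x * ((|deriv f x| : ℝ) : ℂ) * u (f x)

lemma norm_dualTransfer_le {Λ : ℝ} (hΛ0 : 0 ≤ Λ)
    (hΛ : ∀ p ∈ P, ∀ x ∈ p, ‖ξ x‖ * |deriv f x| ≤ Λ) {u : ℝ → ℂ} {D : ℝ}
    (hD : ∀ x, ‖u x‖ ≤ D) (x : ℝ) : ‖dualTransfer f P ξ u x‖ ≤ Λ * D := by
  have hD0 : 0 ≤ D := (norm_nonneg _).trans (hD 0)
  unfold dualTransfer
  by_cases hx : x ∈ ⋃₀ P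
  · rw [indicator_of_mem hx, norm_mul, norm_mul, Complex.norm_real, Real.norm_of_nonneg
      (abs_nonneg _)]
    obtain ⟨p, hp, hxp⟩ := hx
    exact mul_le_mul (hΛ p hp x hxp) (hD _) (norm_nonneg _) hΛ0
  · rw [indicator_of_notMem hx, norm_zero]
    positivity

lemma continuousOn_sUnion (hf : IsPiecewiseExpanding f P) {E : Type*} [TopologicalSpace E]
    {g : ℝ → E} (hg : ∀ p ∈ P, ContinuousOn g p) : ContinuousOn g (⋃₀ P) := by
  rintro x ⟨p, hp, hx⟩
  exact ((hg p hp).continuousAt ((hf.isOpen hp).mem_nhds hx)).continuousWithinAt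

lemma measurable_dualTransfer (hf : IsPiecewiseExpanding f P)
    (hξ : ∀ p ∈ P, ContinuousOn ξ p) {u : ℝ → ℂ} (hu : Measurable u) :
    Measurable (dualTransfer f P ξ u) := by
  have hms : MeasurableSet (⋃₀ P) := hf.isOpen_sUnion.measurableSet
  have hw : ContinuousOn (fun x => ξ x * ((|deriv f x| : ℝ) : ℂ)) (⋃₀ P) :=
    continuousOn_sUnion hf fun p hp => (hξ p hp).mul
      (Complex.continuous_ofReal.comp_continuousOn (hf.continuousOn_deriv hp).abs)
  have hfm : Measurable ((⋃₀ P).domRestrict f) :=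
    (continuousOn_iff_continuous_domRestrict.1
      (continuousOn_sUnion hf fun p hp => hf.continuousOn hp)).measurable
  refine measurable_of_restrict_of_restrict_compl hms ?_ ?_
  · have : (⋃₀ P).domRestrict (dualTransfer f P ξ u) =
        (⋃₀ P).domRestrict (fun x => ξ x * ((|deriv f x| : ℝ) : ℂ)) *
          (u ∘ (⋃₀ P).domRestrict f) := by
      ext x
      simp [dualTransfer, domRestrict_apply]
    rw [this]
    exact (continuousOn_iff_continuous_domRestrict.1 hw).measurable.mul (hu.comp hfm)
  · have : (⋃₀ P)ᶜ.domRestrict (dualTransfer f P ξ u) = 0 := by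
      ext x
      simp only [dualTransfer, domRestrict_apply, Pi.zero_apply]
      exact indicator_of_notMem x.2 _
    rw [this]
    exact measurable_zero

/-- The contribution of the branch `p` to `L_ξ h`. -/
noncomputable def branchTransfer (f : ℝ → ℝ) (ξ h : ℝ → ℂ) (p : Set ℝ) : ℝ → ℂ :=
  (f '' p).indicator fun x => ξ (Function.invFunOn f p x) * h (Function.invFunOn f p x)

lemma branchTransfer_apply (hf : IsPiecewiseExpanding f P) (h : ℝ → ℂ) {p : Set ℝ} (hp : p ∈ P)
    {y : ℝ} (hy : y ∈ p) : branchTransfer f ξ h p (f y) = ξ y * h y := by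
  unfold branchTransfer
  rw [indicator_of_mem (mem_image_of_mem f hy), (hf.injOn hp).leftInvOn_invFunOn hy]

lemma measurableSet_image (hf : IsPiecewiseExpanding f P) {p : Set ℝ} (hp : p ∈ P) :
    MeasurableSet (f '' p) :=
  ((hf.ordConnected hp).isPreconnected.image f (hf.continuousOn hp)).ordConnected.measurableSet

lemma leb_restrict_of_subset {s : Set ℝ} (hm : MeasurableSet s) (hs : s ⊆ Icc 0 1) :
    leb.restrict s = volume.restrict s := by
  rw [Measure.restrict_restrict hm, inter_eq_left.2 hs]

lemma integrableOn_weight_mul (hf : IsPiecewiseExpanding f P)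
    (hξ : ∀ p ∈ P, ContinuousOn ξ p) {Λ : ℝ} (hΛ : ∀ p ∈ P, ∀ x ∈ p, ‖ξ x‖ * |deriv f x| ≤ Λ)
    {h : ℝ → ℂ} (hh : Integrable h leb) :
    IntegrableOn (fun x => |deriv f x| • (ξ x * h x)) (⋃₀ P) volume := by
  have h1 : IntegrableOn h (⋃₀ P) volume := IntegrableOn.mono_set hh hf.sUnion_subset
  have hms : MeasurableSet (⋃₀ P) := hf.isOpen_sUnion.measurableSet
  have hw : ContinuousOn (fun x => ξ x * ((|deriv f x| : ℝ) : ℂ)) (⋃₀ P) :=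
    continuousOn_sUnion hf fun p hp => (hξ p hp).mul
      (Complex.continuous_ofReal.comp_continuousOn (hf.continuousOn_deriv hp).abs)
  have h2 := h1.mul_bdd (c := Λ) (hw.aestronglyMeasurable hms)
    ((ae_restrict_iff' hms).2 (Eventually.of_forall fun x hx => by
      obtain ⟨p, hp, hxp⟩ := hx
      rw [norm_mul, Complex.norm_real, Real.norm_of_nonneg (abs_nonneg _)]
      exact hΛ p hp x hxp))
  refine h2.congr (Eventually.of_forall fun x => ?_)
  simp only [Complex.real_smul]
  ring

lemma integrable_branchTransfer (hf : IsPiecewiseExpanding f P)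
    (hξ : ∀ p ∈ P, ContinuousOn ξ p) {Λ : ℝ} (hΛ : ∀ p ∈ P, ∀ x ∈ p, ‖ξ x‖ * |deriv f x| ≤ Λ)
    {h : ℝ → ℂ} (hh : Integrable h leb) {p : Set ℝ} (hp : p ∈ P) :
    Integrable (branchTransfer f ξ h p) leb := by
  have hmi := measurableSet_image hf hp
  have hsub : f '' p ⊆ Icc 0 1 := (hf.mapsTo p hp).image_subset
  have h1 : IntegrableOn (branchTransfer f ξ h p) (f '' p) volume := by
    rw [integrableOn_image_iff_integrableOn_abs_deriv_smul (hf.isOpen hp).measurableSet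
      (fun x hx => (hf.hasDerivAt hp hx).hasDerivWithinAt) (hf.injOn hp)]
    refine ((integrableOn_weight_mul hf hξ hΛ hh).mono_set (subset_sUnion_of_mem hp)).congr_fun
      (fun x hx => ?_) (hf.isOpen hp).measurableSet
    simp only [branchTransfer_apply hf h hp hx]
  have h2 : Integrable (branchTransfer f ξ h p) volume := by
    rw [← integrable_indicator_iff hmi] at h1
    rwa [branchTransfer, indicator_indicator, inter_self] at h1
  exact h2.restrict

lemma lintegral_enorm_branchTransfer (hf : IsPiecewiseExpanding f P) (h : ℝ → ℂ)
    {p : Set ℝ} (hp : p ∈ P) :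
    ∫⁻ x, ‖branchTransfer f ξ h p x‖ₑ ∂leb = ∫⁻ x in p, ‖|deriv f x| • (ξ x * h x)‖ₑ := by
  have hmi := measurableSet_image hf hp
  have hsub : f '' p ⊆ Icc 0 1 := (hf.mapsTo p hp).image_subset
  have h1 : ∫⁻ x, ‖branchTransfer f ξ h p x‖ₑ ∂leb =
      ∫⁻ x in f '' p, ‖branchTransfer f ξ h p x‖ₑ := by
    rw [← leb_restrict_of_subset hmi hsub, ← lintegral_indicator hmi]
    refine lintegral_congr fun x => ?_
    by_cases hx : x ∈ f '' p
    · rw [indicator_of_mem hx]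
    · rw [indicator_of_notMem hx, branchTransfer, indicator_of_notMem hx, enorm_zero]
  rw [h1, lintegral_image_eq_lintegral_abs_deriv_mul (hf.isOpen hp).measurableSet
      (fun x hx => (hf.hasDerivAt hp hx).hasDerivWithinAt) (hf.injOn hp)]
  refine setLIntegral_congr_fun (hf.isOpen hp).measurableSet fun x hx => ?_
  rw [branchTransfer_apply hf h hp hx, enorm_smul, Real.enorm_eq_ofReal_abs, abs_abs]

/-- Change of variables on the injective branch: the Jacobian `|f'|` joins `ξ` and the test
function, whence the form of `dualTransfer`. -/
lemma integral_branchTransfer_mul (hf : IsPiecewiseExpanding f P) (h u : ℝ → ℂ)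
    {p : Set ℝ} (hp : p ∈ P) :
    ∫ x, branchTransfer f ξ h p x * u x ∂leb = ∫ x in p, h x * dualTransfer f P ξ u x := by
  have hmi := measurableSet_image hf hp
  have hsub : f '' p ⊆ Icc 0 1 := (hf.mapsTo p hp).image_subset
  have h1 : ∫ x, branchTransfer f ξ h p x * u x ∂leb =
      ∫ x in f '' p, branchTransfer f ξ h p x * u x := by
    rw [← leb_restrict_of_subset hmi hsub, ← integral_indicator hmi]
    refine integral_congr_ae (Eventually.of_forall fun x => ?_)
    by_cases hx : x ∈ f '' p
    · simp only [indicator_of_mem hx]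
    · simp only [indicator_of_notMem hx]
      rw [branchTransfer, indicator_of_notMem hx, zero_mul]
  rw [h1, integral_image_eq_integral_abs_deriv_smul (hf.isOpen hp).measurableSet
      (fun x hx => (hf.hasDerivAt hp hx).hasDerivWithinAt) (hf.injOn hp)]
  refine setIntegral_congr_fun (hf.isOpen hp).measurableSet fun x hx => ?_
  rw [branchTransfer_apply hf h hp hx, dualTransfer, indicator_of_mem (mem_sUnion_of_mem hx hp),
    Complex.real_smul]
  ring

/-- The transfer operator on `L¹`. -/
theorem exists_transfer (hf : IsPiecewiseExpanding f P)
    (hξ : ∀ p ∈ P, ContinuousOn ξ p) {Λ : ℝ} (hΛ0 : 0 ≤ Λ)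
    (hΛ : ∀ p ∈ P, ∀ x ∈ p, ‖ξ x‖ * |deriv f x| ≤ Λ) (h : Lp ℂ 1 leb) :
    ∃ k : Lp ℂ 1 leb, IsTransfer f P ξ h k ∧ ‖k‖ ≤ Λ * ‖h‖ ∧
      ∀ u : ℝ → ℂ, Measurable u → (∃ D, ∀ x, ‖u x‖ ≤ D) →
        ∫ x, k x * u x ∂leb = ∫ x, h x * dualTransfer f P ξ u x ∂leb := by
  have hcount : Countable P := hf.countable.to_subtype
  have hh := L1.integrable_coeFn h
  have hint : ∀ p : P, Integrable (branchTransfer f ξ h p) leb := fun p =>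
    integrable_branchTransfer hf hξ hΛ hh p.2
  have hms : ∀ p : P, MeasurableSet (p : Set ℝ) := fun p => (hf.isOpen p.2).measurableSet
  have hdis : Pairwise (Function.onFun Disjoint fun p : P => (p : Set ℝ)) := fun p q hpq =>
    hf.disjoint p.2 q.2 fun h => hpq (Subtype.ext h)
  have hU : ⋃₀ P = ⋃ p : P, (p : Set ℝ) := sUnion_eq_iUnion
  have hUms : MeasurableSet (⋃₀ P) := hf.isOpen_sUnion.measurableSet
  set κ : P → Lp ℂ 1 leb := fun p => (hint p).toL1 _ with hκ
  have hκn : ∀ p, ‖κ p‖ₑ = ∫⁻ x in (p : Set ℝ), ‖|deriv f x| • (ξ x * h x)‖ₑ := fun p => by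
    rw [hκ, Lp.enorm_def, eLpNorm_one_eq_lintegral_enorm, ← lintegral_enorm_branchTransfer hf h p.2]
    refine lintegral_congr_ae ?_
    filter_upwards [(hint p).coeFn_toL1] with x hx
    rw [hx]
  -- By change of variables, the `L¹` norms of the branch contributions add up to an integral of `|ξ
  -- f' h|`, so their series converges absolutely in `L¹`.
  have htot : ∑' p, ‖κ p‖ₑ ≤ ENNReal.ofReal Λ * ‖h‖ₑ := by
    calc ∑' p, ‖κ p‖ₑ = ∫⁻ x in ⋃₀ P, ‖|deriv f x| • (ξ x * h x)‖ₑ := by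
          rw [hU, lintegral_iUnion hms hdis]
          exact tsum_congr hκn
      _ ≤ ∫⁻ x in ⋃₀ P, ENNReal.ofReal Λ * ‖h x‖ₑ := by
          refine setLIntegral_mono' hUms fun x hx => ?_
          obtain ⟨p, hp, hxp⟩ := hx
          rw [enorm_smul, enorm_mul, ← mul_assoc, mul_comm ‖|deriv f x|‖ₑ, Real.enorm_eq_ofReal_abs,
            abs_abs, ← _root_.ofReal_norm, ← ENNReal.ofReal_mul (norm_nonneg _)]
          gcongr
          exact hΛ p hp x hxp
      _ ≤ ∫⁻ x, ENNReal.ofReal Λ * ‖h x‖ₑ ∂leb := lintegral_mono_set hf.sUnion_subset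
      _ = ENNReal.ofReal Λ * ‖h‖ₑ := by
          rw [lintegral_const_mul' _ _ ENNReal.ofReal_ne_top, Lp.enorm_def, eLpNorm_one_eq_lintegral_enorm]
  have hfin : ∑' p, ‖κ p‖ₑ ≠ ∞ :=
    (htot.trans_lt (ENNReal.mul_lt_top ENNReal.ofReal_lt_top enorm_lt_top)).ne
  have hsum : Summable κ := Summable.of_enorm hfin
  have hsumn : Summable fun p => ‖κ p‖ := tsum_enorm_ne_top_iff_summable_norm.1 hfin
  refine ⟨∑' p, κ p, ?_, ?_, ?_⟩
  · have hae : ∀ᵐ x ∂leb, ∀ p, κ p x = branchTransfer f ξ h p x :=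
      ae_all_iff.2 fun p => (hint p).coeFn_toL1
    unfold IsTransfer
    filter_upwards [hae, Lp.hasSum_coeFn_tsum hfin] with x hx hs
    simp only [hx] at hs
    have hch : ∀ y : {y : ℝ // y ∈ ⋃₀ P ∧ f y = x}, ∃ p : P, (y : ℝ) ∈ (p : Set ℝ) := by
      rintro ⟨y, ⟨p, hp, hy⟩, -⟩
      exact ⟨⟨p, hp⟩, hy⟩
    -- Each preimage of `x` is labelled by the branch containing it. The labelling is injective
    -- because branches are, and branches without a preimage contribute zero, so the sum over
    -- branches is the sum over preimages.
    choose e he using hch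
    have hinj : Function.Injective e := by
      intro y z hyz
      refine Subtype.ext (hf.injOn (e y).2 (he y) (hyz ▸ he z) ?_)
      rw [y.2.2, z.2.2]
    have hz : ∀ p ∉ range e, branchTransfer f ξ h p x = 0 := by
      intro p hp
      refine indicator_of_notMem ?_ _
      rintro ⟨y, hy, hyx⟩
      refine hp ⟨⟨y, mem_sUnion_of_mem hy p.2, hyx⟩, ?_⟩
      by_contra hne
      exact disjoint_left.1 (hdis hne) (he _) hy
    convert (hinj.hasSum_iff hz).2 hs using 1
    ext y
    have := branchTransfer_apply (ξ := ξ) hf h (e y).2 (he y)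
    rw [y.2.2] at this
    exact this.symm
  · have h1 : ‖∑' p, κ p‖ₑ ≤ ENNReal.ofReal Λ * ‖h‖ₑ := by
      refine le_trans ?_ htot
      rw [← _root_.ofReal_norm]
      refine (ENNReal.ofReal_le_ofReal (norm_tsum_le_tsum_norm hsumn)).trans_eq ?_
      rw [ENNReal.ofReal_tsum_of_nonneg (fun _ => norm_nonneg _) hsumn]
      simp only [_root_.ofReal_norm]
    rw [← _root_.ofReal_norm, ← _root_.ofReal_norm h, ← ENNReal.ofReal_mul hΛ0] at h1
    exact (ENNReal.ofReal_le_ofReal_iff (by positivity)).1 h1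
  · rintro u hu ⟨D, hD⟩
    have h1 := (integralMul u hu.aestronglyMeasurable D fun x _ => hD x).map_tsum hsum
    simp only [integralMul_apply] at h1
    rw [h1]
    have h2 : ∀ p, ∫ x, κ p x * u x ∂leb =
        ∫ x in (p : Set ℝ), h x * dualTransfer f P ξ u x := fun p => by
      rw [← integral_branchTransfer_mul hf h u p.2]
      refine integral_congr_ae ?_
      filter_upwards [(hint p).coeFn_toL1] with x hx
      rw [hx]
    rw [tsum_congr h2]
    have hi : Integrable (fun x => h x * dualTransfer f P ξ u x) leb :=
      integrable_mul_of_bounded h (measurable_dualTransfer hf hξ hu).aestronglyMeasurable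
        (D := Λ * D) fun x _ => norm_dualTransfer_le hΛ0 hΛ hD x
    have h3 : IntegrableOn (fun x => h x * dualTransfer f P ξ u x) (⋃ p : P, (p : Set ℝ)) volume :=
      hU ▸ IntegrableOn.mono_set hi hf.sUnion_subset
    rw [← integral_iUnion hms hdis h3, ← hU]
    rw [← leb_restrict_of_subset hUms hf.sUnion_subset, ← integral_indicator hUms]
    refine integral_congr_ae (Eventually.of_forall fun x => ?_)
    by_cases hx : x ∈ ⋃₀ P
    · simp only [indicator_of_mem hx]
    · simp only [indicator_of_notMem hx]
      rw [dualTransfer, indicator_of_notMem hx, mul_zero]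

end Transfer
/-! ### Young's estimate for `∫ w dg` -/

section Young

/-- The constant in Young's estimate. -/
noncomputable def youngConst (θ : ℝ) : ℝ := 2 ^ (-θ) / (1 - 2 ^ (1 - θ))

lemma youngConst_nonneg {θ : ℝ} (hθ : 1 < θ) : 0 ≤ youngConst θ := by
  have : (2 : ℝ) ^ (1 - θ) < 1 := Real.rpow_lt_one_of_one_lt_of_neg (by norm_num) (by linarith)
  unfold youngConst
  have h1 : 0 < 1 - (2 : ℝ) ^ (1 - θ) := by linarith
  positivity

/-- Young's estimate, all moduli of continuity being measured through an expanding
coordinate `F`. -/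
lemma norm_integral_sub_le_young {a b : ℝ} (hab : a ≤ b) {F : ℝ → ℝ} {w g g' : ℝ → ℂ}
    {α β Cw Cg : ℝ} (hα1 : α ≤ 1) (hβ : 0 < β) (hθ : 1 < α + β) (hCw : 0 ≤ Cw)
    (hFc : ContinuousOn F (Icc a b))
    (hF : ∀ x ∈ Icc a b, ∀ y ∈ Icc a b, |x - y| ≤ |F x - F y|)
    (hF1 : ∀ x ∈ Icc a b, ∀ y ∈ Icc a b, |F x - F y| ≤ 1)
    (hwc : ContinuousOn w (Icc a b))
    (hw : ∀ x ∈ Icc a b, ∀ y ∈ Icc a b, ‖w x - w y‖ ≤ Cw * |F x - F y| ^ β)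
    (hg : ∀ x ∈ Icc a b, HasDerivAt g (g' x) x) (hg' : ContinuousOn g' (Icc a b))
    (hgα : ∀ x ∈ Icc a b, ∀ y ∈ Icc a b, ‖g x - g y‖ ≤ Cg * |F x - F y| ^ α) :
    ‖(∫ t in a..b, w t * g' t) - w a * (g b - g a)‖ ≤
      youngConst (α + β) * (Cw * Cg) * |F a - F b| ^ (α + β) := by
  obtain ⟨D, hD⟩ := isCompact_Icc.exists_bound_of_continuousOn hg'
  have hD0 : 0 ≤ D := (norm_nonneg _).trans (hD a (left_mem_Icc.2 hab))
  have hinj : InjOn F (Icc a b) := by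
    intro x hx y hy hxy
    have := hF x hx y hy
    rw [hxy, sub_self, abs_zero] at this
    exact sub_eq_zero.1 (abs_nonpos_iff.1 this)
  have hmono : ∀ x ∈ Icc a b, ∀ t ∈ Icc a b, ∀ y ∈ Icc a b, x ≤ t → t ≤ y →
      |F t - F x| ≤ |F x - F y| := by
    intro x hx t ht y hy hxt hty
    rcases hFc.strictMonoOn_of_injOn_Icc' hab hinj with h | h
    · have h1 := h.monotoneOn hx ht hxt
      have h2 := h.monotoneOn ht hy hty
      rw [abs_of_nonneg (by linarith), abs_of_nonpos (by linarith)]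
      linarith
    · have h1 := h.antitoneOn hx ht hxt
      have h2 := h.antitoneOn ht hy hty
      rw [abs_of_nonpos (by linarith), abs_of_nonneg (by linarith)]
      linarith
  have hsub : ∀ x ∈ Icc a b, ∀ y ∈ Icc a b, x ≤ y → uIcc x y ⊆ Icc a b := by
    intro x hx y hy hxy
    rw [uIcc_of_le hxy]
    exact Icc_subset_Icc hx.1 hy.2
  have hiw : ∀ c : ℂ, ∀ x ∈ Icc a b, ∀ y ∈ Icc a b, x ≤ y →
      IntervalIntegrable (fun t => (w t - c) * g' t) volume x y := fun c x hx y hy hxy =>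
    (((hwc.sub continuousOn_const).mul hg').mono (hsub x hx y hy hxy)).intervalIntegrable
  have hig : ∀ x ∈ Icc a b, ∀ y ∈ Icc a b, x ≤ y →
      IntervalIntegrable g' volume x y := fun x hx y hy hxy =>
    (hg'.mono (hsub x hx y hy hxy)).intervalIntegrable
  have hftc : ∀ x ∈ Icc a b, ∀ y ∈ Icc a b, x ≤ y → ∫ t in x..y, g' t = g y - g x :=
    fun x hx y hy hxy => intervalIntegral.integral_eq_sub_of_hasDerivAt
      (fun t ht => hg t (hsub x hx y hy hxy ht)) (hig x hx y hy hxy)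
  set θ := α + β with hθdef
  set q : ℝ := 2 ^ (1 - θ) with hq
  have hq1 : q < 1 := Real.rpow_lt_one_of_one_lt_of_neg (by norm_num) (by linarith)
  have hq0 : 0 < q := by positivity
  set c : ℝ := Cw * Cg * 2 ^ (-θ) with hc
  -- The fixed point of the recursion `s ↦ q * s + c` produced by one bisection.
  set S : ℝ := c / (1 - q) with hS
  have hSq : q * S + c = S := by
    have : (1 - q) ≠ 0 := by linarith
    rw [hS]; field_simp; ring
  -- Only the term with `q ^ n` contains the bound `D` of `g'`. It disappears as `n → ∞`, leaving an
  -- estimate in the Hölder constants alone.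
  have key : ∀ n : ℕ, ∀ x ∈ Icc a b, ∀ y ∈ Icc a b, x ≤ y →
      ‖∫ t in x..y, (w t - w x) * g' t‖ ≤ (q ^ n * (Cw * D - S) + S) * |F x - F y| ^ θ := by
    intro n
    induction n with
    | zero =>
      intro x hx y hy hxy
      rw [pow_zero, one_mul, sub_add_cancel]
      set ℓ := |F x - F y| with hℓ
      have hℓ0 : 0 ≤ ℓ := abs_nonneg _
      have h1 := intervalIntegral.norm_integral_le_of_norm_le_const (a := x) (b := y)
        (f := fun t => (w t - w x) * g' t) (C := Cw * ℓ ^ β * D) (fun t ht => by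
          have htx : t ∈ Icc x y := by
            rw [uIoc_of_le hxy] at ht
            exact Ioc_subset_Icc_self ht
          have htab : t ∈ Icc a b := ⟨hx.1.trans htx.1, htx.2.trans hy.2⟩
          rw [norm_mul]
          refine mul_le_mul ((hw t htab x hx).trans ?_) (hD t htab) (norm_nonneg _) (by positivity)
          gcongr
          exact hmono x hx t htab y hy htx.1 htx.2)
      refine h1.trans ?_
      have h2 : |y - x| ≤ ℓ := by rw [abs_sub_comm]; exact hF x hx y hy
      have hℓ1 : ℓ ≤ 1 := hF1 x hx y hy
      rcases eq_or_lt_of_le hℓ0 with h0 | hpos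
      · rw [← h0, Real.zero_rpow hβ.ne', Real.zero_rpow (by linarith)]
        simp
      · calc Cw * ℓ ^ β * D * |y - x| ≤ Cw * ℓ ^ β * D * ℓ := by gcongr
          _ = Cw * D * ℓ ^ (1 + β) := by
              rw [Real.rpow_add hpos, Real.rpow_one]; ring
          _ ≤ Cw * D * ℓ ^ θ := by
              gcongr Cw * D * ?_
              exact Real.rpow_le_rpow_of_exponent_ge hpos hℓ1 (by linarith)
    | succ n ih =>
      intro x hx y hy hxy
      set s := q ^ n * (Cw * D - S) + S with hs
      have hnext : q ^ (n + 1) * (Cw * D - S) + S = q * s + c := by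
        rw [hs, pow_succ]
        linear_combination -hSq
      rw [hnext]
      -- Bisect in the coordinate `F`, not in the interval. Each half has `F`-length `ℓ / 2`, so the
      -- halves together contribute `2 * 2 ^ (-θ) = q` times the previous bound; replacing `w x` by
      -- `w m` on the second half costs `c * ℓ ^ θ`.
      obtain ⟨m, hm, hFm⟩ : ∃ m ∈ Icc x y, F m = (F x + F y) / 2 := by
        have hivt := intermediate_value_uIcc (hFc.mono (hsub x hx y hy hxy))
        have : (F x + F y) / 2 ∈ uIcc (F x) (F y) := by
          rw [mem_uIcc]
          rcases le_total (F x) (F y) with h | h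
          · left; constructor <;> linarith
          · right; constructor <;> linarith
        obtain ⟨m, hm, h⟩ := hivt this
        rw [uIcc_of_le hxy] at hm
        exact ⟨m, hm, h⟩
      have hmab : m ∈ Icc a b := ⟨hx.1.trans hm.1, hm.2.trans hy.2⟩
      set ℓ := |F x - F y| with hℓ
      have hℓ0 : 0 ≤ ℓ := abs_nonneg _
      have hxm : |F x - F m| = ℓ / 2 := by
        rw [hFm, show F x - (F x + F y) / 2 = (F x - F y) / 2 by ring, abs_div,
          abs_of_pos (by norm_num : (0 : ℝ) < 2)]
      have hmy : |F m - F y| = ℓ / 2 := by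
        rw [hFm, show (F x + F y) / 2 - F y = (F x - F y) / 2 by ring, abs_div,
          abs_of_pos (by norm_num : (0 : ℝ) < 2)]
      have hsplit : ∫ t in x..y, (w t - w x) * g' t = (∫ t in x..m, (w t - w x) * g' t) +
          (∫ t in m..y, (w t - w m) * g' t) + (w m - w x) * (g y - g m) := by
        rw [← intervalIntegral.integral_add_adjacent_intervals (hiw _ x hx m hmab hm.1)
          (hiw _ m hmab y hy hm.2), add_assoc]
        congr 1
        rw [← hftc m hmab y hy hm.2, ← intervalIntegral.integral_const_mul,
          ← intervalIntegral.integral_add (hiw _ m hmab y hy hm.2)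
            ((hig m hmab y hy hm.2).const_mul _)]
        congr 1
        ext t
        ring
      rw [hsplit]
      have h1 := ih x hx m hmab hm.1
      have h2 := ih m hmab y hy hm.2
      have h3 : ‖(w m - w x) * (g y - g m)‖ ≤ Cw * (ℓ / 2) ^ β * (Cg * (ℓ / 2) ^ α) := by
        rw [norm_mul]
        refine mul_le_mul ?_ ?_ (norm_nonneg _) (by positivity)
        · have := hw m hmab x hx
          rwa [abs_sub_comm, hxm] at this
        · have := hgα y hy m hmab
          rwa [abs_sub_comm, hmy] at this
      rw [hxm] at h1
      rw [hmy] at h2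
      have hhalf : (ℓ / 2) ^ θ = ℓ ^ θ * 2 ^ (-θ) := by
        rw [Real.div_rpow hℓ0 (by norm_num), Real.rpow_neg (by norm_num), div_eq_mul_inv]
      have hq2 : q = 2 * 2 ^ (-θ) := by
        rw [hq, sub_eq_add_neg, Real.rpow_add (by norm_num), Real.rpow_one]
      have hprod : (ℓ / 2) ^ β * (ℓ / 2) ^ α = (ℓ / 2) ^ θ := by
        rcases eq_or_lt_of_le hℓ0 with h0 | hpos
        · rw [← h0, zero_div, Real.zero_rpow hβ.ne', zero_mul, Real.zero_rpow (by linarith)]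
        · rw [← Real.rpow_add (by positivity), hθdef, add_comm]
      calc _ ≤ s * (ℓ / 2) ^ θ + s * (ℓ / 2) ^ θ + Cw * (ℓ / 2) ^ β * (Cg * (ℓ / 2) ^ α) :=
            (norm_add_le _ _).trans (add_le_add ((norm_add_le _ _).trans (add_le_add h1 h2)) h3)
        _ = 2 * s * (ℓ / 2) ^ θ + Cw * Cg * ((ℓ / 2) ^ β * (ℓ / 2) ^ α) := by ring
        _ = (q * s + c) * ℓ ^ θ := by rw [hprod, hhalf, hc, hq2]; ring
  have ha := left_mem_Icc.2 hab
  have hb := right_mem_Icc.2 hab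
  have hE : (∫ t in a..b, w t * g' t) - w a * (g b - g a) = ∫ t in a..b, (w t - w a) * g' t := by
    have hi : IntervalIntegrable (fun t => w t * g' t) volume a b := by
      simpa using hiw 0 a ha b hb hab
    rw [← hftc a ha b hb hab, ← intervalIntegral.integral_const_mul,
      ← intervalIntegral.integral_sub hi ((hig a ha b hb hab).const_mul _)]
    congr 1
    ext t
    ring
  rw [hE]
  have hlim : Tendsto (fun n : ℕ => (q ^ n * (Cw * D - S) + S) * |F a - F b| ^ θ) atTop
      (𝓝 ((0 * (Cw * D - S) + S) * |F a - F b| ^ θ)) :=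
    (((tendsto_pow_atTop_nhds_zero_of_lt_one hq0.le hq1).mul_const _).add_const _).mul_const _
  have hSy : youngConst θ * (Cw * Cg) = 0 * (Cw * D - S) + S := by
    rw [hS, hc, youngConst]; ring
  rw [hSy]
  exact ge_of_tendsto hlim (Eventually.of_forall fun n => key n a ha b hb hab)

end Young

/-! ### Estimates on one branch -/

/-- A smooth expanding branch `F` with weight `exp Φ` on an open interval `I`. -/
structure IsBranch (β B : ℝ) (I : Set ℝ) (F F' : ℝ → ℝ) (Φ : ℝ → ℂ) : Prop where
  isOpen : IsOpen I
  ordConnected : I.OrdConnected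
  subset_Icc : I ⊆ Icc 0 1
  mapsTo : MapsTo F I (Icc 0 1)
  hasDerivAt : ∀ x ∈ I, HasDerivAt F (F' x) x
  continuousOn_deriv : ContinuousOn F' I
  one_le : ∀ x ∈ I, 1 ≤ |F' x|
  holder : ∀ x ∈ I, ∀ y ∈ I, ‖Φ x - Φ y‖ ≤ B * |F x - F y| ^ β

namespace IsBranch

variable {α β B : ℝ} {I : Set ℝ} {F F' : ℝ → ℝ} {Φ : ℝ → ℂ}

lemma abs_sub_le (h : IsBranch β B I F F' Φ) {x y : ℝ} (hx : x ∈ I) (hy : y ∈ I) :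
    |x - y| ≤ |F x - F y| := by
  simpa using mul_abs_sub_le_of_deriv h.ordConnected h.hasDerivAt h.one_le hx hy

lemma abs_image_sub_le_one (h : IsBranch β B I F F' Φ) {x y : ℝ} (hx : x ∈ I) (hy : y ∈ I) :
    |F x - F y| ≤ 1 := by
  have h1 := h.mapsTo hx
  have h2 := h.mapsTo hy
  rw [abs_le]; constructor <;> linarith [h1.1, h1.2, h2.1, h2.2]

lemma continuousOn (h : IsBranch β B I F F' Φ) : ContinuousOn F I := fun x hx =>
  (h.hasDerivAt x hx).continuousAt.continuousWithinAt

/-- From `|e^z - 1| ≤ |z| e^|z|`, where `|z| ≤ B` because the image of the branch has diameter at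
most one. -/
lemma norm_exp_sub_le (h : IsBranch β B I F F' Φ) (hβ : 0 < β) (hB : 0 ≤ B) {x y : ℝ}
    (hx : x ∈ I) (hy : y ∈ I) :
    ‖Complex.exp (Φ x) - Complex.exp (Φ y)‖ ≤
      B * Real.exp B * ‖Complex.exp (Φ y)‖ * |F x - F y| ^ β := by
  have h1 : Complex.exp (Φ x) - Complex.exp (Φ y) =
      Complex.exp (Φ y) * (Complex.exp (Φ x - Φ y) - 1) := by
    rw [mul_sub, ← Complex.exp_add, mul_one]; congr 2; ring
  have h2 : ‖Complex.exp (Φ x - Φ y) - 1‖ ≤ ‖Φ x - Φ y‖ * Real.exp ‖Φ x - Φ y‖ := by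
    have := Complex.norm_exp_sub_sum_le_norm_mul_exp (Φ x - Φ y) 1
    simpa using this
  have h3 := h.holder x hx y hy
  have h4 : B * |F x - F y| ^ β ≤ B := by
    have := Real.rpow_le_one (abs_nonneg _) (h.abs_image_sub_le_one hx hy) hβ.le
    nlinarith
  rw [h1, norm_mul]
  calc ‖Complex.exp (Φ y)‖ * ‖Complex.exp (Φ x - Φ y) - 1‖
      ≤ ‖Complex.exp (Φ y)‖ * ((B * |F x - F y| ^ β) * Real.exp B) := by
        gcongr
        refine h2.trans ?_
        gcongr
        exact h3.trans h4
    _ = _ := by ring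

/-- Bounded distortion: the weight at one point of a branch controls it at all others. -/
lemma norm_exp_le (h : IsBranch β B I F F' Φ) (hβ : 0 < β) (hB : 0 ≤ B) {x y : ℝ}
    (hx : x ∈ I) (hy : y ∈ I) :
    ‖Complex.exp (Φ x)‖ ≤ (1 + B * Real.exp B) * ‖Complex.exp (Φ y)‖ := by
  have h1 := h.norm_exp_sub_le hβ hB hx hy
  have h2 : |F x - F y| ^ β ≤ 1 :=
    Real.rpow_le_one (abs_nonneg _) (h.abs_image_sub_le_one hx hy) hβ.le
  have h3 : ‖Complex.exp (Φ x)‖ ≤ ‖Complex.exp (Φ x) - Complex.exp (Φ y)‖ + ‖Complex.exp (Φ y)‖ := by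
    simpa using norm_add_le (Complex.exp (Φ x) - Complex.exp (Φ y)) (Complex.exp (Φ y))
  have h4 : 0 ≤ B * Real.exp B * ‖Complex.exp (Φ y)‖ := by positivity
  nlinarith

lemma continuousOn_exp (h : IsBranch β B I F F' Φ) (hβ : 0 < β) (hB : 0 ≤ B) :
    ContinuousOn (fun x => Complex.exp (Φ x)) I := by
  intro x hx
  rw [ContinuousWithinAt, tendsto_iff_norm_sub_tendsto_zero]
  have h1 : Tendsto (fun y => B * Real.exp B * ‖Complex.exp (Φ x)‖ * |F y - F x| ^ β) (𝓝[I] x)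
      (𝓝 (B * Real.exp B * ‖Complex.exp (Φ x)‖ * |F x - F x| ^ β)) := by
    refine Tendsto.const_mul _ ?_
    refine Tendsto.rpow_const ?_ (Or.inr hβ.le)
    exact ((h.continuousOn x hx).sub tendsto_const_nhds).abs
  rw [sub_self, abs_zero, Real.zero_rpow hβ.ne', mul_zero] at h1
  refine squeeze_zero' (Eventually.of_forall fun _ => norm_nonneg _) ?_ h1
  filter_upwards [self_mem_nhdsWithin] with y hy using h.norm_exp_sub_le hβ hB hy hx

/-- The distortion constant of the branches with Hölder constant `B`. -/
noncomputable def distConst (α β B : ℝ) : ℝ :=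
  (1 + youngConst (α + β) * (B * Real.exp B * (1 + B * Real.exp B))) * (1 + B * Real.exp B)

lemma distConst_nonneg (hθ : 1 < α + β) (hB : 0 ≤ B) : 0 ≤ distConst α β B := by
  have := youngConst_nonneg hθ
  unfold distConst
  positivity

/-- The sign of the derivative is constant on a branch. -/
lemma exists_sign (h : IsBranch β B I F F' Φ) :
    ∃ σ : ℝ, |σ| = 1 ∧ ∀ x ∈ I, |F' x| = σ * F' x := by
  have hne : ∀ x ∈ I, F' x ≠ 0 := fun x hx h0 => by
    have := h.one_le x hx
    rw [h0, abs_zero] at this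
    linarith
  by_cases hpos : ∃ x ∈ I, 0 < F' x
  · obtain ⟨x, hx, hx0⟩ := hpos
    refine ⟨1, by simp, fun y hy => ?_⟩
    rw [one_mul, abs_of_pos]
    by_contra hcon
    have hy0 : F' y < 0 := lt_of_le_of_ne (not_lt.1 hcon) (hne y hy)
    obtain ⟨z, hz, hz0⟩ := h.ordConnected.isPreconnected.intermediate_value hy hx
      h.continuousOn_deriv ⟨hy0.le, hx0.le⟩
    exact hne z hz hz0
  · push Not at hpos
    exact ⟨-1, by simp, fun y hy => by rw [abs_of_nonpos (hpos y hy)]; ring⟩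

/-- The pull-back of `φ'` by the weighted branch has `α`-Hölder primitive on the branch. -/
lemma norm_integral_le (h : IsBranch β B I F F' Φ) (hα0 : 0 ≤ α) (hα1 : α ≤ 1) (hβ : 0 < β)
    (hθ : 1 < α + β) (hB : 0 ≤ B) {m : ℝ}
    (hm : ∀ x ∈ I, ‖Complex.exp (Φ x)‖ * |F' x| ^ α ≤ m) {φ : ℝ → ℂ} (hφ : φ ∈ testFunctions α)
    {a b : ℝ} (ha : a ∈ I) (hb : b ∈ I) (hab : a ≤ b) :
    ‖∫ t in a..b, Complex.exp (Φ t) * ((|F' t| : ℝ) : ℂ) * derivWithin φ (Icc 0 1) (F t)‖ ≤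
      distConst α β B * m * (b - a) ^ α := by
  have hsub : Icc a b ⊆ I := h.ordConnected.out ha hb
  set B' := B * Real.exp B with hB'
  have hB'0 : 0 ≤ B' := by positivity
  -- The constant sign turns `|F'| (φ' ∘ F)` into `σ (φ ∘ F)'`, the form required by Young's
  -- estimate.
  obtain ⟨σ, hσ1, hσ⟩ := h.exists_sign
  have hderφ : ContinuousOn (derivWithin φ (Icc 0 1)) (Icc 0 1) :=
    hφ.1.continuousOn_derivWithin (uniqueDiffOn_Icc zero_lt_one) le_rfl
  set g : ℝ → ℂ := φ ∘ F with hg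
  set g' : ℝ → ℂ := fun x => F' x • derivWithin φ (Icc 0 1) (F x) with hg'
  have hgd : ∀ x ∈ I, HasDerivAt g (g' x) x := fun x hx =>
    (HasDerivWithinAt.scomp x
      ((hφ.1.differentiableOn one_ne_zero _ (h.mapsTo hx)).hasDerivWithinAt)
      (h.hasDerivAt x hx).hasDerivWithinAt h.mapsTo).hasDerivAt (h.isOpen.mem_nhds hx)
  have hg'c : ContinuousOn g' I :=
    h.continuousOn_deriv.smul (hderφ.comp h.continuousOn h.mapsTo)
  have hgα : ∀ x ∈ I, ∀ y ∈ I, ‖g x - g y‖ ≤ 1 * |F x - F y| ^ α := fun x hx y hy => by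
    rw [one_mul]
    exact norm_sub_le_of_mem_testFunctions hα0 hφ (h.mapsTo hx) (h.mapsTo hy)
  set w : ℝ → ℂ := fun x => Complex.exp (Φ x) with hw
  -- The Hölder constant of `w` is normalized by its value at the single point `a`, using bounded
  -- distortion.
  have hyoung := norm_integral_sub_le_young hab hα1 hβ hθ
    (Cw := B' * (1 + B') * ‖w a‖) (Cg := 1) (by positivity)
    (h.continuousOn.mono hsub) (fun x hx y hy => h.abs_sub_le (hsub hx) (hsub hy))
    (fun x hx y hy => h.abs_image_sub_le_one (hsub hx) (hsub hy))
    ((h.continuousOn_exp hβ hB).mono hsub) (fun x hx y hy => by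
      refine (h.norm_exp_sub_le hβ hB (hsub hx) (hsub hy)).trans ?_
      rw [mul_assoc B' (1 + B')]
      gcongr
      exact h.norm_exp_le hβ hB (hsub hy) ha)
    (fun x hx => hgd x (hsub hx)) (hg'c.mono hsub)
    (fun x hx y hy => hgα x (hsub hx) y (hsub hy))
  have hint : ∫ t in a..b, Complex.exp (Φ t) * ((|F' t| : ℝ) : ℂ) * derivWithin φ (Icc 0 1) (F t) =
      (σ : ℂ) * ∫ t in a..b, w t * g' t := by
    rw [← intervalIntegral.integral_const_mul]
    refine intervalIntegral.integral_congr fun t ht => ?_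
    rw [uIcc_of_le hab] at ht
    simp only [hw, hg', hσ t (hsub ht), Complex.real_smul]
    push_cast
    ring
  rw [hint, norm_mul, Complex.norm_real, Real.norm_eq_abs, hσ1, one_mul]
  set ℓ := |F a - F b| with hℓ
  have hℓ0 : 0 ≤ ℓ := abs_nonneg _
  have hℓ1 : ℓ ≤ 1 := h.abs_image_sub_le_one ha hb
  have hκ := youngConst_nonneg hθ
  have h1 : ‖∫ t in a..b, w t * g' t‖ ≤
      (1 + youngConst (α + β) * (B' * (1 + B'))) * ‖w a‖ * ℓ ^ α := by
    have h2 : ‖w a * (g b - g a)‖ ≤ ‖w a‖ * ℓ ^ α := by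
      rw [norm_mul]
      gcongr
      have := hgα b hb a ha
      rwa [one_mul, abs_sub_comm] at this
    have h3 : ℓ ^ (α + β) ≤ ℓ ^ α := by
      rcases eq_or_lt_of_le hℓ0 with h0 | hpos
      · rw [← h0, Real.zero_rpow (by linarith)]
        exact Real.rpow_nonneg le_rfl α
      · exact Real.rpow_le_rpow_of_exponent_ge hpos hℓ1 (by linarith)
    have h4 : ‖∫ t in a..b, w t * g' t‖ ≤ ‖(∫ t in a..b, w t * g' t) - w a * (g b - g a)‖ +
        ‖w a * (g b - g a)‖ := by
      simpa using norm_add_le ((∫ t in a..b, w t * g' t) - w a * (g b - g a)) (w a * (g b - g a))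
    calc _ ≤ youngConst (α + β) * (B' * (1 + B') * ‖w a‖ * 1) * ℓ ^ α + ‖w a‖ * ℓ ^ α := by
          refine h4.trans (add_le_add (hyoung.trans ?_) h2)
          gcongr
      _ = _ := by ring
  rcases eq_or_lt_of_le hab with rfl | hlt
  · rw [intervalIntegral.integral_same, norm_zero, sub_self]
    have h5 : 0 ≤ m := le_trans (by positivity) (hm a ha)
    have := distConst_nonneg hθ hB
    positivity
  -- The mean value theorem gives `ℓ = |F' z| (b - a)`. Distortion moves the weight from `a` to the
  -- same `z`, so that the bound on `|w| |F'|^α` applies at one point.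
  obtain ⟨z, hz, hslope⟩ := exists_hasDerivAt_eq_slope F F' hlt (h.continuousOn.mono hsub)
    (fun t ht => h.hasDerivAt t (hsub (Ioo_subset_Icc_self ht)))
  have hzI : z ∈ I := hsub (Ioo_subset_Icc_self hz)
  have hℓz : ℓ = |F' z| * (b - a) := by
    rw [hslope, abs_div, abs_of_pos (sub_pos.2 hlt), div_mul_cancel₀ _ (sub_pos.2 hlt).ne', hℓ,
      abs_sub_comm]
  calc _ ≤ (1 + youngConst (α + β) * (B' * (1 + B'))) * ((1 + B') * ‖w z‖) * ℓ ^ α := by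
        refine h1.trans ?_
        gcongr
        exact h.norm_exp_le hβ hB ha hzI
    _ = distConst α β B * (‖w z‖ * |F' z| ^ α) * (b - a) ^ α := by
        rw [hℓz, Real.mul_rpow (abs_nonneg _) (sub_pos.2 hlt).le, distConst, ← hB']
        ring
    _ ≤ _ := by
        have := distConst_nonneg hθ hB
        gcongr
        exact hm z hzI

end IsBranch
/-! ### Gluing Hölder primitives -/

section Gluing

lemma exists_eq_Ioo {I : Set ℝ} (ho : IsOpen I) (hc : I.OrdConnected) (hI : I ⊆ Icc 0 1) :
    ∃ a b : ℝ, I = Ioo a b := by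
  rcases I.eq_empty_or_nonempty with rfl | hne
  · exact ⟨0, 0, by simp⟩
  have hb : BddBelow I := ⟨0, fun x hx => (hI hx).1⟩
  have ha : BddAbove I := ⟨1, fun x hx => (hI hx).2⟩
  refine ⟨sInf I, sSup I, subset_antisymm (fun x hx => ?_)
    (IsConnected.Ioo_csInf_csSup_subset ⟨hne, hc.isPreconnected⟩ hb ha)⟩
  obtain ⟨ε, hε, hball⟩ := Metric.isOpen_iff.1 ho x hx
  rw [Real.ball_eq_Ioo] at hball
  constructor
  · refine lt_of_le_of_lt (csInf_le hb (hball (?_ : x - ε / 2 ∈ _))) (by linarith)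
    constructor <;> linarith
  · refine lt_of_lt_of_le (?_ : x < x + ε / 2) (le_csSup ha (hball ?_))
    · linarith
    · constructor <;> linarith

variable {α : ℝ} {ψ : ℝ → ℂ}

lemma integrableOn_of_bounded (hm : Measurable ψ) {D : ℝ} (hD : ∀ x, ‖ψ x‖ ≤ D) {s : Set ℝ}
    (hs : volume s ≠ ⊤) : IntegrableOn ψ s volume :=
  Measure.integrableOn_of_bounded (M := D) hs hm.aestronglyMeasurable (Eventually.of_forall hD)

/-- A Hölder bound for the integrals of `ψ` over compact subintervals of an open interval passes
to all its subintervals. -/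
lemma norm_setIntegral_le_of_subinterval (hα : 0 ≤ α) (hm : Measurable ψ) {D : ℝ}
    (hD : ∀ x, ‖ψ x‖ ≤ D) {a b C : ℝ} (hC : 0 ≤ C)
    (h : ∀ x ∈ Ioo a b, ∀ y ∈ Ioo a b, x ≤ y → ‖∫ t in x..y, ψ t‖ ≤ C * (y - x) ^ α) (u v : ℝ) :
    ‖∫ t in Ioc u v ∩ Ioo a b, ψ t‖ ≤ C * (volume.real (Ioc u v ∩ Ioo a b)) ^ α := by
  have hint := intervalIntegrable_of_bounded hm hD
  set x := max u a with hx
  set y := min v b with hy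
  rcases le_or_gt y x with hyx | hxy
  · have : Ioc u v ∩ Ioo a b = ∅ := by
      rw [eq_empty_iff_forall_notMem]
      rintro t ⟨ht1, ht2⟩
      have h1 : x < t := max_lt ht1.1 ht2.1
      have h2 : t ≤ y := le_min ht1.2 ht2.2.le
      linarith
    rw [this]
    simp only [Measure.restrict_empty, integral_zero_measure, norm_zero]
    positivity
  · have hae : (Ioc u v ∩ Ioo a b : Set ℝ) =ᵐ[volume] Ioc x y := by
      have h1 : Ioc u v ∩ Ioc a b = Ioc x y := Ioc_inter_Ioc
      rw [← h1]
      exact (ae_eq_refl _).inter Ioo_ae_eq_Ioc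
    rw [setIntegral_congr_set hae, measureReal_congr hae, Real.volume_real_Ioc_of_le hxy.le,
      ← intervalIntegral.integral_of_le hxy.le]
    have hcont : Continuous fun z => ∫ t in (0 : ℝ)..z, ψ t :=
      intervalIntegral.continuous_primitive hint 0
    have hdiff : ∀ p q : ℝ, ∫ t in p..q, ψ t = (∫ t in (0 : ℝ)..q, ψ t) - ∫ t in (0 : ℝ)..p, ψ t :=
      fun p q => (intervalIntegral.integral_interval_sub_left (hint _ _) (hint _ _)).symm
    -- The endpoints `x`, `y` may be `a`, `b` themselves, which lie outside the open interval; they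
    -- are approached from inside.
    have hl : Tendsto (fun ε : ℝ => ‖∫ t in (x + ε)..(y - ε), ψ t‖) (𝓝[>] 0)
        (𝓝 ‖∫ t in x..y, ψ t‖) := by
      have : Continuous fun ε : ℝ => ‖∫ t in (x + ε)..(y - ε), ψ t‖ := by
        rw [show (fun ε : ℝ => ‖∫ t in (x + ε)..(y - ε), ψ t‖) = fun ε =>
          ‖(∫ t in (0 : ℝ)..(y - ε), ψ t) - ∫ t in (0 : ℝ)..(x + ε), ψ t‖ from
          funext fun ε => by rw [hdiff]]
        exact ((hcont.comp (by fun_prop)).sub (hcont.comp (by fun_prop))).norm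
      have h2 := (this.tendsto 0).mono_left (nhdsWithin_le_nhds (s := Ioi 0))
      simpa using h2
    refine le_of_tendsto hl ?_
    have h3 : Ioo (0 : ℝ) ((y - x) / 2) ∈ 𝓝[>] (0 : ℝ) := Ioo_mem_nhdsGT (by linarith)
    filter_upwards [h3] with ε hε
    have hax : a ≤ x := le_max_right _ _
    have hyb : y ≤ b := min_le_right _ _
    have h0 : x + ε ≤ y - ε := by linarith [hε.2]
    refine (h (x + ε) ⟨by linarith [hε.1], by linarith [hε.1]⟩ (y - ε)
      ⟨by linarith [hε.1], by linarith [hε.1]⟩ h0).trans ?_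
    gcongr
    · linarith [hε.1]
    · linarith [hε.1]

variable {ι : Type*}

/-- Subtract from `ψ` its averages over the intervals `I i`, `i ∈ T`. -/
noncomputable def subAverages (ψ : ℝ → ℂ) (I : ι → Set ℝ) (T : Finset ι) : ℝ → ℂ := fun x =>
  ψ x - ∑ i ∈ T, (I i).indicator (fun _ => ((volume.real (I i))⁻¹ : ℂ) * ∫ t in I i, ψ t) x

lemma measurable_subAverages (hm : Measurable ψ) {I : ι → Set ℝ} (hI : ∀ i, IsOpen (I i))
    (T : Finset ι) : Measurable (subAverages ψ I T) :=
  hm.sub (Finset.measurable_sum _ fun i _ => measurable_const.indicator (hI i).measurableSet)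

lemma exists_bound_subAverages {D : ℝ} (hD : ∀ x, ‖ψ x‖ ≤ D) (I : ι → Set ℝ) (T : Finset ι) :
    ∃ D', ∀ x, ‖subAverages ψ I T x‖ ≤ D' := by
  refine ⟨D + ∑ i ∈ T, ‖((volume.real (I i))⁻¹ : ℂ) * ∫ t in I i, ψ t‖, fun x => ?_⟩
  refine (norm_sub_le _ _).trans (add_le_add (hD x) ((norm_sum_le _ _).trans ?_))
  exact Finset.sum_le_sum fun i _ => norm_indicator_le_norm_self _ _

lemma subAverages_apply_of_mem {I : ι → Set ℝ} (hdis : Pairwise (Function.onFun Disjoint I))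
    {T : Finset ι} {i : ι} (hi : i ∈ T) {x : ℝ} (hx : x ∈ I i) :
    subAverages ψ I T x = ψ x - ((volume.real (I i))⁻¹ : ℂ) * ∫ t in I i, ψ t := by
  unfold subAverages
  rw [Finset.sum_eq_single_of_mem i hi, indicator_of_mem hx]
  intro j _ hj
  exact indicator_of_notMem (fun hxj => disjoint_left.1 (hdis hj) hxj hx) _

lemma subAverages_apply_of_forall_notMem {I : ι → Set ℝ} {T : Finset ι} {x : ℝ}
    (hx : ∀ i ∈ T, x ∉ I i) : subAverages ψ I T x = ψ x := by
  unfold subAverages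
  rw [Finset.sum_eq_zero fun i hi => indicator_of_notMem (hx i hi) _, sub_zero]

/-- On an interval, subtracting the average costs a factor two, and kills the integral over the
whole interval. -/
lemma norm_setIntegral_sub_average_le (hα : 0 ≤ α) (hα1 : α ≤ 1) (hm : Measurable ψ) {D : ℝ}
    (hD : ∀ x, ‖ψ x‖ ≤ D) {I : Set ℝ} (hIo : IsOpen I) (hIc : I.OrdConnected)
    (hI : I ⊆ Icc 0 1) {C : ℝ} (hC : 0 ≤ C)
    (h : ∀ x ∈ I, ∀ y ∈ I, x ≤ y → ‖∫ t in x..y, ψ t‖ ≤ C * (y - x) ^ α) {u v : ℝ} (huv : u ≤ v) :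
    ‖∫ t in Ioc u v ∩ I, (ψ t - ((volume.real I)⁻¹ : ℂ) * ∫ s in I, ψ s)‖ ≤
      (I.indicator (fun _ => (1 : ℝ)) u + I.indicator (fun _ => (1 : ℝ)) v) *
        (2 * C * (v - u) ^ α) := by
  classical
  have hvI : volume I ≠ ⊤ := measure_ne_top_of_subset hI (by simp)
  have hvJ : volume (Ioc u v ∩ I) ≠ ⊤ := measure_ne_top_of_subset inter_subset_right hvI
  have hmJ : MeasurableSet (Ioc u v ∩ I) := measurableSet_Ioc.inter hIo.measurableSet
  set A := ∫ s in I, ψ s with hA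
  set ℓ := volume.real I with hℓ
  have heq : ∫ t in Ioc u v ∩ I, (ψ t - ((ℓ : ℂ))⁻¹ * A) =
      (∫ t in Ioc u v ∩ I, ψ t) - (volume.real (Ioc u v ∩ I) : ℂ) * ((ℓ : ℂ)⁻¹ * A) := by
    rw [integral_sub (integrableOn_of_bounded hm hD hvJ) (integrableOn_const hvJ),
      setIntegral_const, Complex.real_smul]
  rw [heq]
  have hi0 : ∀ z : ℝ, 0 ≤ I.indicator (fun _ => (1 : ℝ)) z := fun z =>
    indicator_nonneg (fun _ _ => zero_le_one) z
  have hvu : 0 ≤ (v - u) ^ α := Real.rpow_nonneg (by linarith) α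
  obtain ⟨a, b, hab⟩ := exists_eq_Ioo hIo hIc hI
  rcases (Ioc u v ∩ I).eq_empty_or_nonempty with hempty | ⟨s, hs1, hs2⟩
  · rw [hempty]
    simp only [Measure.restrict_empty, integral_zero_measure, measureReal_empty,
      Complex.ofReal_zero, zero_mul, sub_zero, norm_zero]
    have := hi0 u
    have := hi0 v
    positivity
  -- An interval wholly inside `(u, v]` contributes nothing after subtracting the average. Any other
  -- interval meeting `(u, v]` contains `u` or `v`, so the indicators sum to at least `1`.
  by_cases hsub : I ⊆ Ioc u v
  · rw [inter_eq_right.2 hsub, ← hA, ← hℓ]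
    have hℓ0 : (ℓ : ℂ) ≠ 0 := by
      have : 0 < volume I := hIo.measure_pos volume ⟨s, hs2⟩
      rw [Complex.ofReal_ne_zero, hℓ, Measure.real]
      exact (ENNReal.toReal_pos this.ne' hvI).ne'
    rw [← mul_assoc, mul_inv_cancel₀ hℓ0, one_mul, sub_self, norm_zero]
    have := hi0 u
    have := hi0 v
    positivity
  · obtain ⟨r, hrI, hr⟩ := not_subset.1 hsub
    have h1 : 1 ≤ I.indicator (fun _ => (1 : ℝ)) u + I.indicator (fun _ => (1 : ℝ)) v := by
      by_cases hru : r ≤ u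
      · have : u ∈ I := hIc.out hrI hs2 ⟨hru, hs1.1.le⟩
        rw [indicator_of_mem this]
        linarith [hi0 v]
      · have hvr : v < r := by
          by_contra hcon
          exact hr ⟨not_le.1 hru, not_lt.1 hcon⟩
        have : v ∈ I := hIc.out hs2 hrI ⟨hs1.2, hvr.le⟩
        rw [indicator_of_mem this]
        linarith [hi0 u]
    have hsubI : ∀ p q : ℝ, ‖∫ t in Ioc p q ∩ I, ψ t‖ ≤ C * (volume.real (Ioc p q ∩ I)) ^ α := by
      rw [hab] at h ⊢
      exact norm_setIntegral_le_of_subinterval hα hm hD hC h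
    set τ := volume.real (Ioc u v ∩ I) with hτ
    have hτ0 : 0 ≤ τ := measureReal_nonneg
    have hτu : τ ≤ v - u := by
      rw [← Real.volume_real_Ioc_of_le huv]
      exact measureReal_mono inter_subset_left (by simp)
    have hτℓ : τ ≤ ℓ := measureReal_mono inter_subset_right hvI
    have hA1 : ‖A‖ ≤ C * ℓ ^ α := by
      have h2 := hsubI (-1) 1
      have h01 : I ⊆ Ioc (-1 : ℝ) 1 := fun x hx => ⟨by linarith [(hI hx).1], (hI hx).2⟩
      rwa [inter_eq_right.2 h01] at h2
    have hℓ0 : 0 < ℓ := by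
      have : 0 < volume I := hIo.measure_pos volume ⟨s, hs2⟩
      exact ENNReal.toReal_pos this.ne' hvI
    -- The share of the average on a subinterval of length `τ ≤ ℓ` is at most `C τ ℓ^(α-1) ≤ C τ^α`,
    -- because `α ≤ 1`.
    have h3 : τ * (ℓ⁻¹ * (C * ℓ ^ α)) ≤ C * τ ^ α := by
      rcases eq_or_lt_of_le hτ0 with h0 | hpos
      · rw [← h0, zero_mul]
        exact mul_nonneg hC (Real.rpow_nonneg le_rfl _)
      · have h4 : ℓ ^ (α - 1) ≤ τ ^ (α - 1) :=
          Real.rpow_le_rpow_of_nonpos hpos hτℓ (by linarith)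
        calc τ * (ℓ⁻¹ * (C * ℓ ^ α)) = C * (τ * ℓ ^ (α - 1)) := by
              rw [Real.rpow_sub_one hℓ0.ne']; ring
          _ ≤ C * (τ * τ ^ (α - 1)) := by gcongr
          _ = C * τ ^ α := by
              rw [Real.rpow_sub_one hpos.ne']; field_simp
    calc _ ≤ ‖∫ t in Ioc u v ∩ I, ψ t‖ + ‖(τ : ℂ) * ((ℓ : ℂ)⁻¹ * A)‖ := norm_sub_le _ _
      _ ≤ C * τ ^ α + τ * (ℓ⁻¹ * (C * ℓ ^ α)) := by
          refine add_le_add (hsubI u v) ?_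
          rw [norm_mul, norm_mul, norm_inv, Complex.norm_real, Complex.norm_real,
            Real.norm_of_nonneg hτ0, Real.norm_of_nonneg hℓ0.le]
          gcongr
      _ ≤ 1 * (2 * C * τ ^ α) := by linarith
      _ ≤ _ := by gcongr

/-- The two bounds serve different branches. For those in `T`, the uniform bound `C` suffices, as
only intervals containing `u` or `v` contribute: two endpoints times a factor two give `4 * C`.
Outside `T` the number of intervals is not controlled, and the summable `A` makes Hölder's
inequality work. -/
lemma hasHolderPrimitive_subAverages [Countable ι] (hα : 0 < α) (hα1 : α < 1)
    (hm : Measurable ψ) {D : ℝ} (hD : ∀ x, ‖ψ x‖ ≤ D) {I : ι → Set ℝ} (hIo : ∀ i, IsOpen (I i))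
    (hIc : ∀ i, (I i).OrdConnected) (hI : ∀ i, I i ⊆ Icc 0 1)
    (hdis : Pairwise (Function.onFun Disjoint I)) (hsupp : ∀ x, (∀ i, x ∉ I i) → ψ x = 0)
    {C : ℝ} (hC : 0 ≤ C)
    (h : ∀ i, ∀ x ∈ I i, ∀ y ∈ I i, x ≤ y → ‖∫ t in x..y, ψ t‖ ≤ C * (y - x) ^ α)
    {K : ℝ} (hK : 0 ≤ K) {A : ι → ℝ} (hA : ∀ i, 0 ≤ A i)
    (h' : ∀ i, ∀ x ∈ I i, ∀ y ∈ I i, x ≤ y →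
      ‖∫ t in x..y, ψ t‖ ≤ K * A i ^ (1 - α) * (y - x) ^ α)
    {T : Finset ι} {η : ℝ} (hη : 0 ≤ η) (hT : ∀ s : Finset ι, Disjoint s T → ∑ i ∈ s, A i ≤ η) :
    HasHolderPrimitive α (4 * C + K * η ^ (1 - α)) (subAverages ψ I T) := by
  classical
  intro u v huv _
  set Ψ := subAverages ψ I T with hΨ
  have hΨm : Measurable Ψ := measurable_subAverages hm hIo T
  obtain ⟨D', hD'⟩ := exists_bound_subAverages hD I T
  have hms : ∀ i, MeasurableSet (Ioc u v ∩ I i) := fun i =>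
    measurableSet_Ioc.inter (hIo i).measurableSet
  have hdis' : Pairwise (Function.onFun Disjoint fun i => Ioc u v ∩ I i) := fun i j hij =>
    (hdis hij).mono inter_subset_right inter_subset_right
  have hU : (⋃ i, Ioc u v ∩ I i) = Ioc u v ∩ ⋃ i, I i := by rw [inter_iUnion]
  have hvol : volume (⋃ i, Ioc u v ∩ I i) ≠ ⊤ :=
    measure_ne_top_of_subset (s := Ioc u v) (hU ▸ inter_subset_left) (by simp)
  have hsum := hasSum_integral_iUnion hms hdis' (integrableOn_of_bounded hΨm hD' hvol)
  have hmain : ∫ t in u..v, Ψ t = ∫ t in ⋃ i, Ioc u v ∩ I i, Ψ t := by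
    rw [intervalIntegral.integral_of_le huv]
    refine setIntegral_eq_of_subset_of_forall_sdiff_eq_zero (f := Ψ) measurableSet_Ioc
      (hU ▸ inter_subset_left) ?_
    rintro x ⟨hx, hx'⟩
    have hxI : ∀ i, x ∉ I i := fun i hi => hx' (hU ▸ ⟨hx, mem_iUnion_of_mem i hi⟩)
    rw [hΨ, subAverages_apply_of_forall_notMem fun i _ => hxI i]
    exact hsupp x hxI
  rw [hmain]
  have hvu : 0 ≤ (v - u) ^ α := Real.rpow_nonneg (by linarith) α
  -- By disjointness, a point lies in at most one interval.
  have hone : ∀ (s : Finset ι) (z : ℝ), ∑ i ∈ s, (I i).indicator (fun _ => (1 : ℝ)) z ≤ 1 := by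
    intro s z
    by_cases hz : ∃ i, z ∈ I i
    · obtain ⟨i, hi⟩ := hz
      have h0 : ∀ j, j ≠ i → (I j).indicator (fun _ => (1 : ℝ)) z = 0 := fun j hj =>
        indicator_of_notMem (fun hzj => disjoint_left.1 (hdis hj) hzj hi) _
      by_cases his : i ∈ s
      · rw [Finset.sum_eq_single_of_mem i his fun j _ hj => h0 j hj, indicator_of_mem hi]
      · rw [Finset.sum_eq_zero fun j hj => h0 j fun hji => his (hji ▸ hj)]
        exact zero_le_one
    · push Not at hz
      rw [Finset.sum_eq_zero fun j _ => indicator_of_notMem (hz j) _]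
      exact zero_le_one
  refine le_of_tendsto hsum.norm (Eventually.of_forall fun s => ?_)
  refine (norm_sum_le _ _).trans ?_
  rw [← Finset.sum_filter_add_sum_filter_not s (· ∈ T), add_mul]
  refine add_le_add ?_ ?_
  · calc ∑ i ∈ s with i ∈ T, ‖∫ t in Ioc u v ∩ I i, Ψ t‖
        ≤ ∑ i ∈ s with i ∈ T, ((I i).indicator (fun _ => (1 : ℝ)) u +
            (I i).indicator (fun _ => (1 : ℝ)) v) * (2 * C * (v - u) ^ α) := by
          refine Finset.sum_le_sum fun i hi => ?_
          rw [setIntegral_congr_fun (hms i) fun x hx =>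
            subAverages_apply_of_mem hdis (Finset.mem_filter.1 hi).2 hx.2]
          exact norm_setIntegral_sub_average_le hα.le hα1.le hm hD (hIo i) (hIc i) (hI i) hC (h i)
            huv
      _ ≤ (1 + 1) * (2 * C * (v - u) ^ α) := by
          rw [← Finset.sum_mul, Finset.sum_add_distrib]
          gcongr
          · exact hone _ _
          · exact hone _ _
      _ = 4 * C * (v - u) ^ α := by ring
  · set s' := s.filter (¬ · ∈ T) with hs'
    have hsT : Disjoint s' T := Finset.disjoint_left.2 fun i hi => (Finset.mem_filter.1 hi).2
    have hlen : ∑ i ∈ s', volume.real (Ioc u v ∩ I i) ≤ v - u := by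
      rw [← measureReal_biUnion_finset (fun i _ j _ hij => hdis' hij) (fun i _ => hms i)
        (fun i _ => measure_ne_top_of_subset inter_subset_left (by simp)),
        ← Real.volume_real_Ioc_of_le huv]
      exact measureReal_mono (iUnion₂_subset fun i _ => inter_subset_left) (by simp)
    calc ∑ i ∈ s', ‖∫ t in Ioc u v ∩ I i, Ψ t‖
        ≤ ∑ i ∈ s', K * (A i ^ (1 - α) * volume.real (Ioc u v ∩ I i) ^ α) := by
          refine Finset.sum_le_sum fun i hi => ?_
          have hiT : i ∉ T := (Finset.mem_filter.1 hi).2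
          rw [setIntegral_congr_fun (g := ψ) (hms i) fun x hx =>
            subAverages_apply_of_forall_notMem fun j hj hxj => ?_]
          · have h1 : 0 ≤ K * A i ^ (1 - α) := mul_nonneg hK (Real.rpow_nonneg (hA i) _)
            obtain ⟨a, b, hab⟩ := exists_eq_Ioo (hIo i) (hIc i) (hI i)
            have h2 := h' i
            rw [hab] at h2 ⊢
            rw [← mul_assoc]
            exact norm_setIntegral_le_of_subinterval hα.le hm hD h1 h2 u v
          · exact disjoint_left.1 (hdis fun hji => hiT (hji ▸ hj) : Disjoint (I j) (I i)) hxj hx.2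
      _ = K * ∑ i ∈ s', A i ^ (1 - α) * volume.real (Ioc u v ∩ I i) ^ α := by
          rw [Finset.mul_sum]
      _ ≤ K * ((∑ i ∈ s', A i) ^ (1 - α) * (∑ i ∈ s', volume.real (Ioc u v ∩ I i)) ^ α) := by
          gcongr
          -- Hölder's inequality with exponents `1/(1-α)` and `1/α`, under which the powers of `A i`
          -- and of the lengths return to the first power and can be summed.
          have hpq : (1 - α)⁻¹.HolderConjugate α⁻¹ :=
            one_div (1 - α) ▸ one_div α ▸ Real.holderConjugate_one_div (by linarith) hα (by ring)
          have := Real.inner_le_Lp_mul_Lq_of_nonneg s' hpq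
            (f := fun i => A i ^ (1 - α)) (g := fun i => volume.real (Ioc u v ∩ I i) ^ α)
            (fun i _ => Real.rpow_nonneg (hA i) _) (fun i _ => Real.rpow_nonneg measureReal_nonneg _)
          simp only [one_div, inv_inv] at this
          have e1 : ∀ i, (A i ^ (1 - α)) ^ (1 - α)⁻¹ = A i := fun i =>
            Real.rpow_rpow_inv (hA i) (by linarith)
          have e2 : ∀ i, (volume.real (Ioc u v ∩ I i) ^ α) ^ α⁻¹ = volume.real (Ioc u v ∩ I i) :=
            fun i => Real.rpow_rpow_inv measureReal_nonneg hα.ne'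
          simp only [e1, e2] at this
          exact this
      _ ≤ K * (η ^ (1 - α) * (v - u) ^ α) := by
          have h3 : 0 ≤ ∑ i ∈ s', A i := Finset.sum_nonneg fun i _ => hA i
          have h4 : 0 ≤ ∑ i ∈ s', volume.real (Ioc u v ∩ I i) :=
            Finset.sum_nonneg fun i _ => measureReal_nonneg
          have h5 : 0 ≤ 1 - α := by linarith
          gcongr
          exact hT s' hsT
      _ = K * η ^ (1 - α) * (v - u) ^ α := by ring

end Gluing
/-! ### Iterated branches -/

/-- The quantitative hypotheses on the map and the weight: `c` is the expansion, `C` the Hölder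
constant of the potential `φ`, `B` bounds the distortion of all iterates, `Λ` bounds `ξ f'`, `M`
bounds `|ξ| |f'|^α`, and `A` is the summable sequence controlling the small branches. -/
structure WeightBounds (f : ℝ → ℝ) (P : Set (Set ℝ)) (ξ φ : ℝ → ℂ) (α β c C B Λ M : ℝ)
    (A : P → ℝ) : Prop where
  expandingMap : IsPiecewiseExpanding f P
  alpha_pos : 0 < α
  alpha_lt_one : α < 1
  beta_pos : 0 < β
  one_lt_add : 1 < α + β
  one_lt : 1 < c
  le_deriv : ∀ p ∈ P, ∀ x ∈ p, c ≤ |deriv f x|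
  eq_exp : ∀ p ∈ P, ∀ x ∈ p, ξ x = Complex.exp (φ x)
  holder : ∀ p ∈ P, ∀ x ∈ p, ∀ y ∈ p, ‖φ x - φ y‖ ≤ C * |x - y| ^ β
  B_nonneg : 0 ≤ B
  add_le : B + C ≤ B * c ^ β
  Λ_nonneg : 0 ≤ Λ
  le_Λ : ∀ p ∈ P, ∀ x ∈ p, ‖ξ x‖ * |deriv f x| ≤ Λ
  M_pos : 0 < M
  le_M : ∀ p ∈ P, ∀ x ∈ p, ‖ξ x‖ * |deriv f x| ^ α ≤ M
  A_nonneg : ∀ p, 0 ≤ A p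
  summable_A : Summable A
  le_A : ∀ p : P, ∀ x ∈ (p : Set ℝ), ‖ξ x‖ * |deriv f x| ^ α ≤ A p ^ (1 - α)

/-- The branches of the `n`-th iterate of the weighted map. -/
structure IsBranchSystem (f : ℝ → ℝ) (P : Set (Set ℝ)) (ξ : ℝ → ℂ) (α β B M : ℝ) (n : ℕ)
    {ι : Type} (I : ι → Set ℝ) (F' : ℝ → ℝ) (Φ : ℝ → ℂ) (A : ι → ℝ) : Prop where
  branch : ∀ i, IsBranch β B (I i) f^[n] F' Φ
  disjoint : Pairwise (Function.onFun Disjoint I)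
  dual_of_mem : ∀ u i, ∀ x ∈ I i, (dualTransfer f P ξ)^[n] u x =
    Complex.exp (Φ x) * ((|F' x| : ℝ) : ℂ) * u (f^[n] x)
  dual_of_notMem : ∀ u x, (∀ i, x ∉ I i) → (dualTransfer f P ξ)^[n] u x = 0
  le_pow : ∀ i, ∀ x ∈ I i, ‖Complex.exp (Φ x)‖ * |F' x| ^ α ≤ M ^ n
  A_nonneg : ∀ i, 0 ≤ A i
  summable_A : Summable A
  le_A : ∀ i, ∀ x ∈ I i, ‖Complex.exp (Φ x)‖ * |F' x| ^ α ≤ A i ^ (1 - α)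

/-- Branches send intervals to intervals. -/
lemma IsBranch.mem_uIcc {β B : ℝ} {I : Set ℝ} {F F' : ℝ → ℝ} {Φ : ℝ → ℂ}
    (h : IsBranch β B I F F' Φ) {x y t : ℝ} (hx : x ∈ I) (hy : y ∈ I) (ht : t ∈ Icc x y) :
    F t ∈ uIcc (F x) (F y) := by
  have hxy : x ≤ y := ht.1.trans ht.2
  have hsub : Icc x y ⊆ I := h.ordConnected.out hx hy
  have hinj : InjOn F (Icc x y) := by
    intro a ha b hb hab
    have := h.abs_sub_le (hsub ha) (hsub hb)
    rw [hab, sub_self, abs_zero] at this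
    exact sub_eq_zero.1 (abs_nonpos_iff.1 this)
  rw [Set.mem_uIcc]
  rcases (h.continuousOn.mono hsub).strictMonoOn_of_injOn_Icc' hxy hinj with hm | hm
  · exact Or.inl ⟨hm.monotoneOn (left_mem_Icc.2 hxy) ht ht.1,
      hm.monotoneOn ht (right_mem_Icc.2 hxy) ht.2⟩
  · exact Or.inr ⟨hm.antitoneOn ht (right_mem_Icc.2 hxy) ht.2,
      hm.antitoneOn (left_mem_Icc.2 hxy) ht ht.1⟩

namespace WeightBounds

variable {f : ℝ → ℝ} {P : Set (Set ℝ)} {ξ φ : ℝ → ℂ} {α β c C B Λ M : ℝ} {A : P → ℝ}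

/-- The reason `B` serves all iterates. Adding one step raises the Hölder constant from `B` to `B +
C`, but re-expressing distances through the next image gains `c ^ β`, and `B + C ≤ B * c ^ β`. -/
lemma holder_comp_le (H : WeightBounds f P ξ φ α β c C B Λ M A) {p : Set ℝ} (hp : p ∈ P)
    {x y : ℝ} (hx : x ∈ p) (hy : y ∈ p) :
    (B + C) * |x - y| ^ β ≤ B * |f x - f y| ^ β := by
  have hc0 : 0 ≤ c := by linarith [H.one_lt]
  have hB := H.B_nonneg
  calc (B + C) * |x - y| ^ β ≤ B * c ^ β * |x - y| ^ β := by
        gcongr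
        exact H.add_le
    _ = B * (c * |x - y|) ^ β := by rw [Real.mul_rpow hc0 (abs_nonneg _), mul_assoc]
    _ ≤ B * |f x - f y| ^ β := by
        have := H.beta_pos.le
        gcongr
        exact mul_abs_sub_le_of_deriv (H.expandingMap.ordConnected hp)
          (fun x hx => H.expandingMap.hasDerivAt hp hx) (H.le_deriv p hp) hx hy

lemma isBranchSystem_one (H : WeightBounds f P ξ φ α β c C B Λ M A) :
    IsBranchSystem f P ξ α β B M 1 (fun p : P => (p : Set ℝ)) (deriv f) φ A where
  branch p :=
    { isOpen := H.expandingMap.isOpen p.2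
      ordConnected := H.expandingMap.ordConnected p.2
      subset_Icc := H.expandingMap.subset_Icc p.2
      mapsTo := H.expandingMap.mapsTo p p.2
      hasDerivAt := fun x hx => H.expandingMap.hasDerivAt p.2 hx
      continuousOn_deriv := H.expandingMap.continuousOn_deriv p.2
      one_le := fun x hx => H.one_lt.le.trans (H.le_deriv p p.2 x hx)
      holder := fun x hx y hy => by
        refine (H.holder p p.2 x hx y hy).trans (le_trans ?_ (H.holder_comp_le p.2 hx hy))
        gcongr
        linarith [H.B_nonneg] }
  disjoint p q hpq := H.expandingMap.disjoint p.2 q.2 fun h => hpq (Subtype.ext h)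
  dual_of_mem u p x hx := by
    rw [Function.iterate_one, Function.iterate_one, dualTransfer,
      indicator_of_mem (mem_sUnion_of_mem hx p.2), H.eq_exp p p.2 x hx]
  dual_of_notMem u x hx := by
    rw [Function.iterate_one, dualTransfer, indicator_of_notMem]
    rintro ⟨p, hp, hxp⟩
    exact hx ⟨p, hp⟩ hxp
  le_pow p x hx := by
    rw [pow_one, ← H.eq_exp p p.2 x hx]
    exact H.le_M p p.2 x hx
  A_nonneg := H.A_nonneg
  summable_A := H.summable_A
  le_A p x hx := by
    rw [← H.eq_exp p p.2 x hx]
    exact H.le_A p x hx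

/-- Weights and derivatives multiply along an orbit, so the bounds `M` and `A` multiply too. The
product family indexed by pairs stays summable; pairs with empty intersection are harmless. -/
lemma isBranchSystem_succ (H : WeightBounds f P ξ φ α β c C B Λ M A) {n : ℕ} {ι : Type}
    {I : ι → Set ℝ} {F' : ℝ → ℝ} {Φ : ℝ → ℂ} {A' : ι → ℝ}
    (S : IsBranchSystem f P ξ α β B M n I F' Φ A') :
    IsBranchSystem f P ξ α β B M (n + 1)
      (fun q : ι × P => I q.1 ∩ f^[n] ⁻¹' (q.2 : Set ℝ))
      (fun x => deriv f (f^[n] x) * F' x) (fun x => Φ x + φ (f^[n] x))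
      (fun q => A' q.1 * A q.2) := by
  have hnorm : ∀ q : ι × P, ∀ x ∈ I q.1 ∩ f^[n] ⁻¹' (q.2 : Set ℝ),
      ‖Complex.exp (Φ x + φ (f^[n] x))‖ * |deriv f (f^[n] x) * F' x| ^ α =
        (‖Complex.exp (Φ x)‖ * |F' x| ^ α) *
          (‖ξ (f^[n] x)‖ * |deriv f (f^[n] x)| ^ α) := by
    rintro q x ⟨-, hx⟩
    rw [Complex.exp_add, norm_mul, abs_mul, Real.mul_rpow (abs_nonneg _) (abs_nonneg _),
      H.eq_exp q.2 q.2.2 _ hx]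
    ring
  refine ⟨fun q => ?_, ?_, ?_, ?_, ?_, ?_, ?_, ?_⟩
  · have h := S.branch q.1
    have hp := q.2.2
    rw [Function.iterate_succ']
    refine ⟨h.continuousOn.isOpen_inter_preimage h.isOpen (H.expandingMap.isOpen hp), ⟨?_⟩,
      inter_subset_left.trans h.subset_Icc, ?_, ?_, ?_, ?_, ?_⟩
    · rintro x ⟨hx, hx'⟩ y ⟨hy, hy'⟩ t ht
      exact ⟨h.ordConnected.out hx hy ht,
        (H.expandingMap.ordConnected hp).uIcc_subset hx' hy' (h.mem_uIcc hx hy ht)⟩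
    · rintro x ⟨-, hx⟩
      exact H.expandingMap.mapsTo q.2 hp hx
    · rintro x ⟨hx, hx'⟩
      exact (H.expandingMap.hasDerivAt hp hx').comp x (h.hasDerivAt x hx)
    · exact ((H.expandingMap.continuousOn_deriv hp).comp (h.continuousOn.mono inter_subset_left)
        fun x hx => hx.2).mul (h.continuousOn_deriv.mono inter_subset_left)
    · rintro x ⟨hx, hx'⟩
      rw [abs_mul]
      exact one_le_mul_of_one_le_of_one_le (H.one_lt.le.trans (H.le_deriv q.2 hp _ hx'))
        (h.one_le x hx)
    · rintro x ⟨hx, hx'⟩ y ⟨hy, hy'⟩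
      refine le_trans ?_ (H.holder_comp_le hp hx' hy')
      rw [add_sub_add_comm, add_mul]
      exact (norm_add_le _ _).trans (add_le_add (h.holder x hx y hy)
        (H.holder q.2 hp _ hx' _ hy'))
  · rintro q r hqr
    by_cases h : q.1 = r.1
    · have h2 : q.2 ≠ r.2 := fun h2 => hqr (Prod.ext h h2)
      have h3 : Disjoint (q.2 : Set ℝ) r.2 :=
        H.expandingMap.disjoint q.2.2 r.2.2 fun h => h2 (Subtype.ext h)
      exact (h3.preimage f^[n]).mono inter_subset_right inter_subset_right
    · exact (S.disjoint h).mono inter_subset_left inter_subset_left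
  · rintro u q x ⟨hx, hx'⟩
    rw [Function.iterate_succ_apply, S.dual_of_mem _ q.1 x hx, dualTransfer,
      indicator_of_mem (mem_sUnion_of_mem (mem_preimage.1 hx') q.2.2), Function.iterate_succ_apply',
      H.eq_exp q.2 q.2.2 _ hx', Complex.exp_add, abs_mul, Complex.ofReal_mul]
    ring
  · intro u x hx
    rw [Function.iterate_succ_apply]
    by_cases hI : ∃ i, x ∈ I i
    · obtain ⟨i, hi⟩ := hI
      rw [S.dual_of_mem _ i x hi, dualTransfer, indicator_of_notMem, mul_zero]
      rintro ⟨p, hp, hxp⟩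
      exact hx (i, ⟨p, hp⟩) ⟨hi, hxp⟩
    · exact S.dual_of_notMem _ x (not_exists.1 hI)
  · rintro q x hx
    rw [hnorm q x hx, pow_succ]
    have := H.M_pos
    exact mul_le_mul (S.le_pow q.1 x hx.1) (H.le_M q.2 q.2.2 _ hx.2) (by positivity) (by positivity)
  · exact fun q => mul_nonneg (S.A_nonneg _) (H.A_nonneg _)
  · exact S.summable_A.mul_of_nonneg H.summable_A S.A_nonneg H.A_nonneg
  · rintro q x hx
    rw [hnorm q x hx, Real.mul_rpow (S.A_nonneg _) (H.A_nonneg _)]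
    exact mul_le_mul (S.le_A q.1 x hx.1) (H.le_A q.2 _ hx.2) (by positivity)
      (Real.rpow_nonneg (S.A_nonneg _) _)

lemma exists_isBranchSystem (H : WeightBounds f P ξ φ α β c C B Λ M A) (n : ℕ) :
    ∃ (ι : Type) (_ : Countable ι) (I : ι → Set ℝ) (F' : ℝ → ℝ) (Φ : ℝ → ℂ) (A' : ι → ℝ),
      IsBranchSystem f P ξ α β B M (n + 1) I F' Φ A' := by
  have hcount : Countable P := H.expandingMap.countable.to_subtype
  induction n with
  | zero => exact ⟨P, hcount, _, _, _, _, H.isBranchSystem_one⟩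
  | succ n ih =>
    obtain ⟨ι, hι, I, F', Φ, A', S⟩ := ih
    exact ⟨ι × P, inferInstance, _, _, _, _, H.isBranchSystem_succ S⟩

lemma continuousOn_weight (H : WeightBounds f P ξ φ α β c C B Λ M A) :
    ∀ p ∈ P, ContinuousOn ξ p := fun p hp =>
  ((H.isBranchSystem_one.branch ⟨p, hp⟩).continuousOn_exp H.beta_pos H.B_nonneg).congr
    fun x hx => H.eq_exp p hp x hx

lemma iterate_dualTransfer (H : WeightBounds f P ξ φ α β c C B Λ M A) (n : ℕ) {u : ℝ → ℂ}
    (hu : Measurable u) (hD : ∃ D, ∀ x, ‖u x‖ ≤ D) :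
    Measurable ((dualTransfer f P ξ)^[n] u) ∧ ∃ D, ∀ x, ‖(dualTransfer f P ξ)^[n] u x‖ ≤ D := by
  induction n with
  | zero => exact ⟨hu, hD⟩
  | succ n ih =>
    obtain ⟨h1, D, h2⟩ := ih
    rw [Function.iterate_succ']
    exact ⟨measurable_dualTransfer H.expandingMap H.continuousOn_weight h1, Λ * D,
      norm_dualTransfer_le H.Λ_nonneg H.le_Λ h2⟩

end WeightBounds

/-- The derivative of a test function, extended by zero. -/
noncomputable def testDeriv (φ : ℝ → ℂ) : ℝ → ℂ :=
  (Icc (0 : ℝ) 1).indicator (derivWithin φ (Icc 0 1))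

lemma measurable_testDeriv {φ : ℝ → ℂ} (hφ : ContDiffOn ℝ 1 φ (Icc 0 1)) :
    Measurable (testDeriv φ) := by
  have hc : ContinuousOn (derivWithin φ (Icc 0 1)) (Icc 0 1) :=
    hφ.continuousOn_derivWithin (uniqueDiffOn_Icc zero_lt_one) le_rfl
  have := hc.measurable_piecewise (continuousOn_const (c := (0 : ℂ))) measurableSet_Icc
  change Measurable ((Icc (0 : ℝ) 1).piecewise _ 0) at this
  rwa [piecewise_eq_indicator] at this

lemma exists_bound_testDeriv {φ : ℝ → ℂ} (hφ : ContDiffOn ℝ 1 φ (Icc 0 1)) :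
    ∃ D, ∀ x, ‖testDeriv φ x‖ ≤ D := by
  have hc : ContinuousOn (derivWithin φ (Icc 0 1)) (Icc 0 1) :=
    hφ.continuousOn_derivWithin (uniqueDiffOn_Icc zero_lt_one) le_rfl
  obtain ⟨C, hC⟩ := isCompact_Icc.exists_bound_of_continuousOn hc
  refine ⟨C, fun x => ?_⟩
  unfold testDeriv
  by_cases hx : x ∈ Icc (0 : ℝ) 1
  · rw [indicator_of_mem hx]; exact hC x hx
  · rw [indicator_of_notMem hx, norm_zero]
    exact (norm_nonneg _).trans (hC 0 (by simp))

lemma pairing_eq_integral_testDeriv (h φ : ℝ → ℂ) :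
    pairing h φ = ∫ x, h x * testDeriv φ x ∂leb := by
  refine setIntegral_congr_fun measurableSet_Icc fun x hx => ?_
  simp only [testDeriv, indicator_of_mem hx]

namespace IsBranchSystem

variable {f : ℝ → ℝ} {P : Set (Set ℝ)} {ξ φ : ℝ → ℂ} {α β c C B Λ M : ℝ} {A : P → ℝ}
  {n : ℕ} {ι : Type} {I : ι → Set ℝ} {F' : ℝ → ℝ} {Φ : ℝ → ℂ} {A' : ι → ℝ}

lemma norm_integral_dual_le (S : IsBranchSystem f P ξ α β B M n I F' Φ A')
    (H : WeightBounds f P ξ φ α β c C B Λ M A) {χ : ℝ → ℂ} (hχ : χ ∈ testFunctions α) (i : ι)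
    {m : ℝ} (hm : ∀ x ∈ I i, ‖Complex.exp (Φ x)‖ * |F' x| ^ α ≤ m) {x y : ℝ} (hx : x ∈ I i)
    (hy : y ∈ I i) (hxy : x ≤ y) :
    ‖∫ t in x..y, (dualTransfer f P ξ)^[n] (testDeriv χ) t‖ ≤
      IsBranch.distConst α β B * m * (y - x) ^ α := by
  have h := (S.branch i).norm_integral_le H.alpha_pos.le H.alpha_lt_one.le H.beta_pos H.one_lt_add
    H.B_nonneg hm hχ hx hy hxy
  convert h using 2
  refine intervalIntegral.integral_congr fun t ht => ?_
  rw [uIcc_of_le hxy] at ht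
  have htI := (S.branch i).ordConnected.out hx hy ht
  rw [S.dual_of_mem _ i t htI, testDeriv, indicator_of_mem ((S.branch i).mapsTo htI)]

/-- The dual Lasota–Yorke inequality. -/
lemma enorm_integral_subAverages_le [Countable ι] (S : IsBranchSystem f P ξ α β B M n I F' Φ A')
    (H : WeightBounds f P ξ φ α β c C B Λ M A) {T : Finset ι} {η : ℝ} (hη : 0 ≤ η)
    (hT : ∀ s : Finset ι, Disjoint s T → ∑ i ∈ s, A' i ≤ η) (h : Lp ℂ 1 leb) {χ : ℝ → ℂ}
    (hχ : χ ∈ testFunctions α) :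
    ‖∫ x, h x * subAverages ((dualTransfer f P ξ)^[n] (testDeriv χ)) I T x ∂leb‖ₑ ≤
      ENNReal.ofReal (2 * (4 * (IsBranch.distConst α β B * M ^ n) +
        IsBranch.distConst α β B * η ^ (1 - α) + M ^ n)) * eNormB α h := by
  obtain ⟨hm, D, hD⟩ := H.iterate_dualTransfer n (measurable_testDeriv hχ.1)
    (exists_bound_testDeriv hχ.1)
  obtain ⟨D', hD'⟩ := exists_bound_subAverages hD I T
  have hMn : 0 < M ^ n := pow_pos H.M_pos n
  have hK : 0 ≤ IsBranch.distConst α β B := IsBranch.distConst_nonneg H.one_lt_add H.B_nonneg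
  have hη' : 0 ≤ η ^ (1 - α) := Real.rpow_nonneg hη _
  have hprim := hasHolderPrimitive_subAverages H.alpha_pos H.alpha_lt_one hm hD
    (fun i => (S.branch i).isOpen) (fun i => (S.branch i).ordConnected)
    (fun i => (S.branch i).subset_Icc) S.disjoint (fun x hx => S.dual_of_notMem _ x hx)
    (C := IsBranch.distConst α β B * M ^ n) (by positivity)
    (fun i x hx y hy hxy => S.norm_integral_dual_le H hχ i (S.le_pow i) hx hy hxy)
    hK S.A_nonneg
    (fun i x hx y hy hxy => S.norm_integral_dual_le H hχ i (S.le_A i) hx hy hxy) hη hT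
  -- The extra summand `M ^ n` makes the Hölder constant strictly positive.
  refine enorm_integral_mul_le H.alpha_pos.le (by positivity)
    (measurable_subAverages hm (fun i => (S.branch i).isOpen) T) hD' ?_ h
  intro u v huv h1
  refine (hprim u v huv h1).trans ?_
  have : 0 ≤ (v - u) ^ α := Real.rpow_nonneg (by linarith) α
  exact mul_le_mul_of_nonneg_right (by linarith) this

end IsBranchSystem
/-! ### The transfer operator on `B_α` -/

section Operator

variable {f : ℝ → ℝ} {P : Set (Set ℝ)} {ξ φ : ℝ → ℂ} {α : Ico (0 : ℝ) 1}
  {β c C B Λ M : ℝ} {A : P → ℝ}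

/-- The `L¹` images are picked by choice, one `h` at a time; this uniqueness statement is what
yields linearity of the resulting map. -/
lemma BSpace.eq_of_forall_integral_eq {h k : BSpace α}
    (hk : ∀ u : ℝ → ℂ, Measurable u → (∃ D, ∀ x, ‖u x‖ ≤ D) →
      ∫ x, h.density x * u x ∂leb = ∫ x, k.density x * u x ∂leb) : h = k := by
  rw [← sub_eq_zero, ← norm_eq_zero, BSpace.norm_def]
  have : eNormB α (h - k).density = 0 := by
    refine le_antisymm (iSup₂_le fun χ hχ => ?_) bot_le
    obtain ⟨D, hD⟩ := exists_bound_testDeriv hχ.1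
    have hm := measurable_testDeriv hχ.1
    have h1 := (integralMul _ hm.aestronglyMeasurable D fun x _ => hD x).map_sub h.density k.density
    simp only [integralMul_apply] at h1
    rw [pairing_eq_integral_testDeriv, BSpace.density_sub, h1, hk _ hm ⟨D, hD⟩, sub_self,
      enorm_zero]
  rw [this, ENNReal.toReal_zero]

/-- The tail condition when no branch is set aside, with `η` the full sum: plain boundedness is this
case of the dual estimate. -/
lemma sum_le_tsum_of_disjoint_empty {ι : Type*} {A : ι → ℝ} (hA : ∀ i, 0 ≤ A i)
    (hs : Summable A) (s : Finset ι) (_ : Disjoint s ∅) : ∑ i ∈ s, A i ≤ ∑' i, A i :=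
  hs.sum_le_tsum s fun i _ => hA i

/-- The transfer operator on `B_α`. -/
theorem WeightBounds.exists_operator (H : WeightBounds f P ξ φ α β c C B Λ M A) :
    ∃ L : BSpace α →L[ℂ] BSpace α,
      (∀ h, IsTransfer f P ξ h.density (L h).density) ∧
      (∀ h, ‖(L h).density‖ ≤ Λ * ‖h.density‖) ∧
      ∀ h, ∀ u : ℝ → ℂ, Measurable u → (∃ D, ∀ x, ‖u x‖ ≤ D) →
        ∫ x, (L h).density x * u x ∂leb = ∫ x, h.density x * dualTransfer f P ξ u x ∂leb := by
  have hcount : Countable P := H.expandingMap.countable.to_subtype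
  choose k hk1 hk2 hk3 using fun h : Lp ℂ 1 leb =>
    exists_transfer H.expandingMap H.continuousOn_weight H.Λ_nonneg H.le_Λ h
  -- The constant of the dual estimate for `n = 1`, `T = ∅` and `η = ∑ A`.
  set K : ℝ := 2 * (4 * (IsBranch.distConst α β B * M ^ 1) +
        IsBranch.distConst α β B * (∑' p, A p) ^ (1 - (α : ℝ)) + M ^ 1) with hK
  have hA0 : 0 ≤ ∑' p, A p := tsum_nonneg H.A_nonneg
  have hK0 : 0 ≤ K := by
    have h1 := IsBranch.distConst_nonneg H.one_lt_add H.B_nonneg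
    have h2 := H.M_pos
    have h3 : 0 ≤ (∑' p, A p) ^ (1 - (α : ℝ)) := Real.rpow_nonneg hA0 _
    positivity
  have hbound : ∀ h : Lp ℂ 1 leb, eNormB α (k h) ≤ ENNReal.ofReal K * eNormB α h := by
    intro h
    refine iSup₂_le fun χ hχ => ?_
    have h1 := H.isBranchSystem_one.enorm_integral_subAverages_le H hA0
      (sum_le_tsum_of_disjoint_empty H.A_nonneg H.summable_A) h hχ
    rw [pairing_eq_integral_testDeriv, hk3 h _ (measurable_testDeriv hχ.1)
      (exists_bound_testDeriv hχ.1)]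
    simpa only [subAverages, Finset.sum_empty, sub_zero, Function.iterate_one] using h1
  let T : BSpace α → BSpace α := fun h => ⟨k h.density,
    (hbound h.density).trans_lt (ENNReal.mul_lt_top ENNReal.ofReal_lt_top h.eNormB_lt_top)⟩
  have hT : ∀ h, (T h).density = k h.density := fun _ => rfl
  have hT3 : ∀ h, ∀ u : ℝ → ℂ, Measurable u → (∃ D, ∀ x, ‖u x‖ ≤ D) →
      ∫ x, (T h).density x * u x ∂leb = ∫ x, h.density x * dualTransfer f P ξ u x ∂leb :=
    fun h u hu hD => hk3 h.density u hu hD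
  have hdual : ∀ u : ℝ → ℂ, Measurable u → (∃ D, ∀ x, ‖u x‖ ≤ D) →
      Measurable (dualTransfer f P ξ u) ∧ ∃ D, ∀ x, ‖dualTransfer f P ξ u x‖ ≤ D :=
    fun u hu hD => H.iterate_dualTransfer 1 hu hD
  refine ⟨LinearMap.mkContinuous
    { toFun := T
      map_add' := fun h g => BSpace.eq_of_forall_integral_eq fun u hu hD => ?_
      map_smul' := fun a h => BSpace.eq_of_forall_integral_eq fun u hu hD => ?_ } K
    fun h => ?_, fun h => hk1 h.density, fun h => hk2 h.density, hT3⟩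
  · obtain ⟨D, hD'⟩ := hD
    obtain ⟨hv, E, hE⟩ := hdual u hu ⟨D, hD'⟩
    have e1 := (integralMul u hu.aestronglyMeasurable D fun x _ => hD' x).map_add
      (T h).density (T g).density
    have e2 := (integralMul _ hv.aestronglyMeasurable E fun x _ => hE x).map_add
      h.density g.density
    simp only [integralMul_apply] at e1 e2
    rw [hT3 _ u hu ⟨D, hD'⟩, BSpace.density_add, e2, BSpace.density_add, e1,
      hT3 _ u hu ⟨D, hD'⟩, hT3 _ u hu ⟨D, hD'⟩]
  · obtain ⟨D, hD'⟩ := hD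
    obtain ⟨hv, E, hE⟩ := hdual u hu ⟨D, hD'⟩
    have e1 := (integralMul u hu.aestronglyMeasurable D fun x _ => hD' x).map_smul
      a (T h).density
    have e2 := (integralMul _ hv.aestronglyMeasurable E fun x _ => hE x).map_smul a h.density
    simp only [integralMul_apply] at e1 e2
    rw [hT3 _ u hu ⟨D, hD'⟩, BSpace.density_smul, e2, RingHom.id_apply, BSpace.density_smul, e1,
      hT3 _ u hu ⟨D, hD'⟩]
  · refine BSpace.norm_le_of_eNormB_le (by positivity) ?_
    rw [ENNReal.ofReal_mul hK0, BSpace.ofReal_norm]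
    exact hbound h.density

/-- The indicator function of an interval belongs to `B_α`. -/
lemma exists_indicator (hα : 0 < (α : ℝ)) {I : Set ℝ} (ho : IsOpen I) (hc : I.OrdConnected)
    (hI : I ⊆ Icc 0 1) : ∃ k : BSpace α, ∀ u : ℝ → ℂ,
      ∫ x, k.density x * u x ∂leb = ∫ x in I, u x := by
  have hint : Integrable (I.indicator fun _ => (1 : ℂ)) leb :=
    (integrable_const (1 : ℂ)).indicator ho.measurableSet
  have hpair : ∀ u : ℝ → ℂ, ∫ x, hint.toL1 _ x * u x ∂leb = ∫ x in I, u x := by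
    intro u
    rw [← leb_restrict_of_subset ho.measurableSet hI, ← integral_indicator ho.measurableSet]
    refine integral_congr_ae ?_
    filter_upwards [hint.coeFn_toL1] with x hx
    rw [hx]
    by_cases hxI : x ∈ I
    · simp [indicator_of_mem hxI]
    · simp [indicator_of_notMem hxI]
  refine ⟨⟨hint.toL1 _, ?_⟩, hpair⟩
  -- The identity with weight `1` is a branch without distortion (`B = 0`), so the one-branch
  -- estimate bounds the integral of `χ'` over `I`.
  have hb : IsBranch 1 0 I id (fun _ => 1) (fun _ => 0) :=
    { isOpen := ho
      ordConnected := hc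
      subset_Icc := hI
      mapsTo := hI
      hasDerivAt := fun x _ => hasDerivAt_id x
      continuousOn_deriv := continuousOn_const
      one_le := fun x _ => by simp
      holder := fun x _ y _ => by simp }
  have hK : 0 ≤ IsBranch.distConst (α : ℝ) 1 0 := IsBranch.distConst_nonneg (by linarith) le_rfl
  refine lt_of_le_of_lt (iSup₂_le fun χ hχ => ?_)
    (ENNReal.ofReal_lt_top (r := IsBranch.distConst (α : ℝ) 1 0))
  rw [pairing_eq_integral_testDeriv, hpair, ← _root_.ofReal_norm]
  refine ENNReal.ofReal_le_ofReal ?_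
  obtain ⟨D, hD⟩ := exists_bound_testDeriv hχ.1
  have hsub : ∀ x ∈ I, ∀ y ∈ I, x ≤ y → ‖∫ t in x..y, testDeriv χ t‖ ≤
      IsBranch.distConst (α : ℝ) 1 0 * (y - x) ^ (α : ℝ) := by
    intro x hx y hy hxy
    have h1 := hb.norm_integral_le hα.le α.2.2.le one_pos (by linarith) le_rfl (m := 1)
      (fun x _ => by simp) hχ hx hy hxy
    rw [mul_one] at h1
    convert h1 using 2
    refine intervalIntegral.integral_congr fun t ht => ?_
    rw [uIcc_of_le hxy] at ht
    simp [testDeriv, indicator_of_mem (hI (hc.out hx hy ht))]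
  obtain ⟨a, b, hab⟩ := exists_eq_Ioo ho hc hI
  rw [hab] at hsub
  have h2 := norm_setIntegral_le_of_subinterval hα.le (measurable_testDeriv hχ.1) hD hK hsub (-1) 1
  rw [← hab] at h2
  have h01 : I ⊆ Ioc (-1 : ℝ) 1 := fun x hx => ⟨by linarith [(hI hx).1], (hI hx).2⟩
  rw [inter_eq_right.2 h01] at h2
  refine h2.trans (mul_le_of_le_one_right hK (Real.rpow_le_one measureReal_nonneg ?_ hα.le))
  refine (measureReal_mono hI (by simp)).trans ?_
  simp

/-- The iterates of the transfer operator are small perturbations of finite rank operators. -/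
theorem WeightBounds.exists_finite_rank (H : WeightBounds f P ξ φ α β c C B Λ M A)
    {L : BSpace α →L[ℂ] BSpace α}
    (hL : ∀ h, ∀ u : ℝ → ℂ, Measurable u → (∃ D, ∀ x, ‖u x‖ ≤ D) →
        ∫ x, (L h).density x * u x ∂leb = ∫ x, h.density x * dualTransfer f P ξ u x ∂leb)
    (n : ℕ) : ∃ K R : BSpace α →L[ℂ] BSpace α, L ^ (n + 1) = K + R ∧
      FiniteDimensional ℂ (LinearMap.range (K : BSpace α →ₗ[ℂ] BSpace α)) ∧
      ‖R‖ ≤ 2 * (4 * IsBranch.distConst α β B + 2) * M ^ (n + 1) := by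
  classical
  obtain ⟨ι, hι, I, F', Φ, A', S⟩ := H.exists_isBranchSystem n
  set κ := IsBranch.distConst (α : ℝ) β B with hκ
  have hκ0 : 0 ≤ κ := IsBranch.distConst_nonneg H.one_lt_add H.B_nonneg
  have hMn : 0 < M ^ (n + 1) := pow_pos H.M_pos _
  have hpow : ∀ m h, ∀ u : ℝ → ℂ, Measurable u → (∃ D, ∀ x, ‖u x‖ ≤ D) →
      ∫ x, ((L ^ m) h).density x * u x ∂leb =
        ∫ x, h.density x * (dualTransfer f P ξ)^[m] u x ∂leb := by
    intro m
    induction m with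
    | zero => intro h u _ _; rfl
    | succ m ih =>
      intro h u hu hD
      obtain ⟨hu', hD'⟩ := H.iterate_dualTransfer m hu hD
      rw [pow_succ, mul_apply_eq_comp, ih (L h) u hu hD, hL h _ hu' hD',
        Function.iterate_succ_apply']
  -- choose the finitely many large branches
  obtain ⟨η, hη0, hη⟩ : ∃ η : ℝ, 0 < η ∧ κ * η ^ (1 - (α : ℝ)) ≤ M ^ (n + 1) := by
    have h1 : 0 < 1 - (α : ℝ) := by linarith [α.2.2]
    refine ⟨(M ^ (n + 1) / (κ + 1)) ^ (1 - (α : ℝ))⁻¹, by positivity, ?_⟩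
    rw [Real.rpow_inv_rpow (by positivity) h1.ne', mul_div_assoc', div_le_iff₀ (by positivity)]
    nlinarith
  obtain ⟨T, hT⟩ := summable_iff_vanishing_norm.1 S.summable_A η hη0
  have hT' : ∀ s : Finset ι, Disjoint s T → ∑ i ∈ s, A' i ≤ η := fun s hs =>
    (le_abs_self _).trans (hT s hs).le
  choose e he using fun i => exists_indicator (α := α) H.alpha_pos (S.branch i).isOpen
    (S.branch i).ordConnected (S.branch i).subset_Icc
  have hmI : ∀ i, Measurable ((I i).indicator fun _ => (1 : ℂ)) := fun i =>
    measurable_const.indicator (S.branch i).isOpen.measurableSet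
  have hbI : ∀ i x, ‖(I i).indicator (fun _ => (1 : ℂ)) x‖ ≤ 1 := fun i x => by
    simpa using norm_indicator_le_norm_self (fun _ : ℝ => (1 : ℂ)) x
  let ℓ : ι → BSpace α →L[ℂ] ℂ := fun i => ((volume.real (I i))⁻¹ : ℂ) •
    (integralMul _ (hmI i).aestronglyMeasurable 1 fun x _ => hbI i x).comp BSpace.toL1
  -- `Pr` replaces `h` by its average on each interval of `T` and by zero elsewhere. The finite rank
  -- part is `L ^ (n + 1)` after `Pr`, the remainder `L ^ (n + 1)` after `1 - Pr`.
  let Pr : BSpace α →L[ℂ] BSpace α := ∑ i ∈ T, (ℓ i).smulRight (e i)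
  have hPr : ∀ h, Pr h = ∑ i ∈ T, ℓ i h • e i := fun h => by
    simp [Pr]
  refine ⟨L ^ (n + 1) * Pr, L ^ (n + 1) * (1 - Pr), by noncomm_ring, ?_, ?_⟩
  · have h1 : FiniteDimensional ℂ (Submodule.span ℂ ((fun i => (L ^ (n + 1)) (e i)) '' T)) :=
      FiniteDimensional.span_of_finite ℂ (T.finite_toSet.image _)
    refine Submodule.finiteDimensional_of_le (S₂ := Submodule.span ℂ
      ((fun i => (L ^ (n + 1)) (e i)) '' T)) ?_
    rintro _ ⟨h, rfl⟩
    change (L ^ (n + 1)) (Pr h) ∈ _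
    rw [hPr, map_sum]
    refine Submodule.sum_mem _ fun i hi => ?_
    rw [map_smul]
    exact Submodule.smul_mem _ _ (Submodule.subset_span ⟨i, hi, rfl⟩)
  · refine ContinuousLinearMap.opNorm_le_bound _ (by positivity) fun h => ?_
    refine BSpace.norm_le_of_eNormB_le (by positivity) (iSup₂_le fun χ hχ => ?_)
    have hum := measurable_testDeriv hχ.1
    have hub := exists_bound_testDeriv hχ.1
    obtain ⟨hψm, D, hψD⟩ := H.iterate_dualTransfer (n + 1) hum hub
    set ψ := (dualTransfer f P ξ)^[n + 1] (testDeriv χ) with hψ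
    have h1 := S.enorm_integral_subAverages_le H hη0.le hT' h.density hχ
    -- Averaging is symmetric under the pairing, so removing `Pr h` from `h` amounts to subtracting
    -- from `ψ` its averages over the intervals of `T`.
    have h2 : pairing ((L ^ (n + 1) * (1 - Pr)) h).density χ =
        ∫ x, h.density x * subAverages ψ I T x ∂leb := by
      rw [pairing_eq_integral_testDeriv, mul_apply_eq_comp, hpow _ _ _ hum hub]
      let J := (integralMul ψ hψm.aestronglyMeasurable D fun x _ => hψD x).comp
        (BSpace.toL1 (α := α))
      have hJ : ∀ g : BSpace α, J g = ∫ x, g.density x * ψ x ∂leb := fun g => rfl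
      rw [← hψ, ← hJ]
      change J (h - Pr h) = _
      rw [map_sub, hPr, map_sum, hJ]
      have hi : ∀ i, Integrable (fun x => h.density x * (I i).indicator
          (fun _ => ((volume.real (I i))⁻¹ : ℂ) * ∫ t in I i, ψ t) x) leb := fun i =>
        integrable_mul_of_bounded _ (measurable_const.indicator
          (S.branch i).isOpen.measurableSet).aestronglyMeasurable fun x _ =>
            norm_indicator_le_norm_self _ _
      simp only [subAverages, mul_sub, Finset.mul_sum]
      rw [integral_sub (integrable_mul_of_bounded _ hψm.aestronglyMeasurable fun x _ => hψD x)
        (integrable_finsetSum _ fun i _ => hi i), integral_finsetSum _ fun i _ => hi i]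
      congr 1
      refine Finset.sum_congr rfl fun i _ => ?_
      rw [map_smul, hJ, he, smul_eq_mul]
      have h3 : ℓ i h = ((volume.real (I i))⁻¹ : ℂ) *
          ∫ x, h.density x * (I i).indicator (fun _ => (1 : ℂ)) x ∂leb := rfl
      rw [h3, mul_right_comm, ← integral_const_mul]
      refine integral_congr_ae (Eventually.of_forall fun x => ?_)
      by_cases hx : x ∈ I i
      · simp only [indicator_of_mem hx]; ring
      · simp only [indicator_of_notMem hx]; ring
    rw [h2, ENNReal.ofReal_mul (by positivity), BSpace.ofReal_norm]
    refine h1.trans ?_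
    -- The `2` in `4 * κ + 2` collects the term in `η`, at most `M ^ (n + 1)`, and the positivity
    -- summand.
    refine mul_le_mul_left (ENNReal.ofReal_le_ofReal ?_) _
    rw [← hκ]
    linarith

end Operator
/-! ### From the hypotheses to the quantitative bounds -/

/-- A continuous function on an open subset of `[0,1]` is bounded pointwise by its essential
supremum. -/
lemma enorm_le_eLpNorm_top {E : Type*} [NormedAddCommGroup E] {p : Set ℝ} (hp : IsOpen p)
    (hI : p ⊆ Icc 0 1) {g : ℝ → E} (hg : ContinuousOn g p) {x : ℝ} (hx : x ∈ p) :
    ‖g x‖ₑ ≤ eLpNorm g ⊤ leb := by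
  by_contra! hlt
  set V := p ∩ g ⁻¹' {y | eLpNorm g ⊤ leb < ‖y‖ₑ} with hV
  have hVo : IsOpen V :=
    hg.isOpen_inter_preimage hp (isOpen_lt continuous_const continuous_enorm)
  have hpos : 0 < volume V := hVo.measure_pos volume ⟨x, hx, hlt⟩
  have hae : ∀ᵐ y ∂leb, ‖g y‖ₑ ≤ eLpNorm g ⊤ leb := by
    rw [eLpNorm_exponent_top]
    exact ae_le_eLpNormEssSup
  have hnull : leb V = 0 :=
    measure_mono_null (fun y hy => not_le.2 hy.2) (ae_iff.1 hae)
  rw [leb, Measure.restrict_apply hVo.measurableSet,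
    inter_eq_left.2 (inter_subset_left.trans hI)] at hnull
  exact hpos.ne' hnull

lemma norm_le_toReal_eLpNorm_top {E : Type*} [NormedAddCommGroup E] {p : Set ℝ} (hp : IsOpen p)
    (hI : p ⊆ Icc 0 1) {g : ℝ → E} (hg : ContinuousOn g p) (hfin : eLpNorm g ⊤ leb ≠ ⊤) {x : ℝ}
    (hx : x ∈ p) : ‖g x‖ ≤ (eLpNorm g ⊤ leb).toReal := by
  rw [← toReal_enorm]
  exact ENNReal.toReal_mono hfin (enorm_le_eLpNorm_top hp hI hg hx)

lemma continuousOn_of_holder {φ : ℝ → ℂ} {p : Set ℝ} {β C : ℝ} (hβ : 0 < β)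
    (h : ∀ x ∈ p, ∀ y ∈ p, ‖φ x - φ y‖ ≤ C * |x - y| ^ β) : ContinuousOn φ p := by
  intro x hx
  rw [ContinuousWithinAt, tendsto_iff_norm_sub_tendsto_zero]
  have h1 : Tendsto (fun y => C * |y - x| ^ β) (𝓝[p] x) (𝓝 (C * |x - x| ^ β)) := by
    refine (Tendsto.rpow_const ?_ (Or.inr hβ.le)).const_mul _
    exact ((continuous_id.sub continuous_const).abs.tendsto x).mono_left nhdsWithin_le_nhds
  rw [sub_self, abs_zero, Real.zero_rpow hβ.ne', mul_zero] at h1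
  refine squeeze_zero' (Eventually.of_forall fun _ => norm_nonneg _) ?_ h1
  filter_upwards [self_mem_nhdsWithin] with y hy using h y hy x hx

/-- Interpolation between the exponents `γ` and `1`. -/
lemma weight_le_interpolation {X D S Λ α γ : ℝ} (hX : 0 < X) (hD : 0 < D) (hα1 : α < 1)
    (hγα : γ < α) (hS : (X * D ^ γ) ^ (1 / (1 - γ)) ≤ S) (hΛ : X * D ≤ Λ) :
    X * D ^ α ≤ (S * Λ ^ (1 / (1 - α) - 1 / (1 - γ))) ^ (1 - α) := by
  have h1 : 0 < 1 - α := by linarith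
  have h2 : 0 < 1 - γ := by linarith
  set r := 1 / (1 - α) with hr
  set s := 1 / (1 - γ) with hs
  have hrs : 0 ≤ r - s := by
    rw [sub_nonneg, hr, hs]
    exact one_div_le_one_div_of_le h1 (by linarith)
  have hr1 : r * (1 - α) = 1 := by rw [hr]; field_simp
  have hs1 : s * (1 - γ) = 1 := by rw [hs]; field_simp
  -- The exponents match: `s + (r - s) = r` for `X`, and `γ s + (r - s) = r - 1 = α r` for `D`.
  have key : (X * D ^ α) ^ r = (X * D ^ γ) ^ s * (X * D) ^ (r - s) := by
    rw [Real.mul_rpow hX.le (by positivity), Real.mul_rpow hX.le (by positivity),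
      Real.mul_rpow hX.le hD.le, ← Real.rpow_mul hD.le, ← Real.rpow_mul hD.le,
      mul_mul_mul_comm, ← Real.rpow_add hX, ← Real.rpow_add hD]
    congr 2
    · ring
    · linear_combination -hr1 + hs1
  have h3 : X * D ^ α = ((X * D ^ α) ^ r) ^ (1 - α) := by
    rw [← Real.rpow_mul (by positivity), hr1, Real.rpow_one]
  have hS0 : 0 ≤ S := le_trans (by positivity) hS
  rw [h3, key]
  gcongr

/-- The constants `c`, `C`, `B`, `A` are chosen before `M`, so the distortion constant stays fixed
while `M` decreases to the essential supremum. Taking `M` strictly larger guarantees `M > 0`. -/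
lemma exists_weightBounds
    {f : ℝ → ℝ} {P : Set (Set ℝ)} (hf : IsPiecewiseExpanding f P)
    {ξ φ : ℝ → ℂ} (hξ : ∀ p ∈ P, ∀ x ∈ p, ξ x = Complex.exp (φ x))
    {β : ℝ} (hβ : β ∈ Ioc (0 : ℝ) 1)
    (hφ : ∃ C : ℝ, ∀ p ∈ P, ∀ x ∈ p, ∀ y ∈ p, ‖φ x - φ y‖ ≤ C * |x - y| ^ β)
    (hξf : MemLp (fun x => ξ x * ((deriv f x : ℝ) : ℂ)) ⊤ leb)
    {γ : ℝ} (hγ : γ ∈ Ico (0 : ℝ) 1)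
    (hsum : ∑' p : P, ⨆ x ∈ (p : Set ℝ),
      ENNReal.ofReal ((‖ξ x‖ * |deriv f x| ^ γ) ^ (1 / (1 - γ))) < ⊤)
    {α : ℝ} (hα1 : α < 1) (hα : max γ (1 - β) < α) :
    eLpNorm (fun x => ‖ξ x‖ * |deriv f x| ^ α) ⊤ leb ≤
        eLpNorm (fun x => ξ x * ((deriv f x : ℝ) : ℂ)) ⊤ leb ∧
      ∃ (c C B : ℝ) (A : P → ℝ),
        ∀ M, (eLpNorm (fun x => ‖ξ x‖ * |deriv f x| ^ α) ⊤ leb).toReal < M →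
          WeightBounds f P ξ φ α β c C B
            (eLpNorm (fun x => ξ x * ((deriv f x : ℝ) : ℂ)) ⊤ leb).toReal M A := by
  obtain ⟨hγα, hβα⟩ := max_lt_iff.1 hα
  have hα0 : 0 < α := hγ.1.trans_lt hγα
  obtain ⟨c, hc1, hc⟩ := hf.expanding
  obtain ⟨C0, hC0⟩ := hφ
  set E1 := eLpNorm (fun x => ξ x * ((deriv f x : ℝ) : ℂ)) ⊤ leb with hE1
  set E2 := eLpNorm (fun x => ‖ξ x‖ * |deriv f x| ^ α) ⊤ leb with hE2
  have hξc : ∀ p ∈ P, ContinuousOn ξ p := fun p hp =>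
    (Complex.continuous_exp.comp_continuousOn
      (continuousOn_of_holder hβ.1 (hC0 p hp))).congr fun x hx => hξ p hp x hx
  have hD1 : ∀ p ∈ P, ∀ x ∈ p, 1 ≤ |deriv f x| := fun p hp x hx => hc1.le.trans (hc p hp x hx)
  have hE1fin : E1 ≠ ⊤ := hξf.2.ne
  have hle : E2 ≤ E1 := by
    refine eLpNorm_mono_ae ?_
    have hmem : ∀ᵐ x ∂leb, x ∈ ⋃₀ P := by
      have hms : MeasurableSet (⋃₀ P) := hf.isOpen_sUnion.measurableSet
      rw [ae_iff, leb, Measure.restrict_apply' measurableSet_Icc]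
      convert hf.full using 2
      ext x
      simp only [mem_inter_iff, Set.mem_sdiff]
      exact and_comm
    filter_upwards [hmem] with x hx
    obtain ⟨p, hp, hxp⟩ := hx
    rw [norm_mul, norm_mul, norm_norm, Complex.norm_real, Real.norm_of_nonneg (by positivity),
      Real.norm_eq_abs]
    gcongr
    exact Real.rpow_le_self_of_one_le (hD1 p hp x hxp) hα1.le
  have hE2fin : E2 ≠ ⊤ := ne_top_of_le_ne_top hE1fin hle
  have hΛ : ∀ p ∈ P, ∀ x ∈ p, ‖ξ x‖ * |deriv f x| ≤ E1.toReal := by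
    intro p hp x hx
    have h1 := norm_le_toReal_eLpNorm_top (hf.isOpen hp) (hf.subset_Icc hp)
      (g := fun x => ξ x * ((deriv f x : ℝ) : ℂ)) ((hξc p hp).mul
        (Complex.continuous_ofReal.comp_continuousOn (hf.continuousOn_deriv hp))) hE1fin hx
    rwa [norm_mul, Complex.norm_real, Real.norm_eq_abs] at h1
  have hM : ∀ p ∈ P, ∀ x ∈ p, ‖ξ x‖ * |deriv f x| ^ α ≤ E2.toReal := by
    intro p hp x hx
    have h1 := norm_le_toReal_eLpNorm_top (hf.isOpen hp) (hf.subset_Icc hp)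
      (g := fun x => ‖ξ x‖ * |deriv f x| ^ α) ((hξc p hp).norm.mul
        ((hf.continuousOn_deriv hp).abs.rpow_const fun x _ => Or.inr hα0.le)) hE2fin hx
    rwa [Real.norm_of_nonneg (by positivity)] at h1
  set S : P → ℝ≥0∞ := fun p => ⨆ x ∈ (p : Set ℝ),
      ENNReal.ofReal ((‖ξ x‖ * |deriv f x| ^ γ) ^ (1 / (1 - γ))) with hS
  have hcβ : 1 < c ^ β := Real.one_lt_rpow hc1 hβ.1
  -- `B = C / (c ^ β - 1)` solves `B + C = B * c ^ β`, the sum of the geometric series of Hölder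
  -- constants along an orbit.
  refine ⟨hle, c, max C0 0, max C0 0 / (c ^ β - 1),
    fun p => (S p).toReal * E1.toReal ^ (1 / (1 - α) - 1 / (1 - γ)), fun M hEM => ?_⟩
  exact
    { expandingMap := hf
      alpha_pos := hα0
      alpha_lt_one := hα1
      beta_pos := hβ.1
      one_lt_add := by linarith
      one_lt := hc1
      le_deriv := hc
      eq_exp := hξ
      holder := fun p hp x hx y hy => (hC0 p hp x hx y hy).trans (by gcongr; exact le_max_left _ _)
      B_nonneg := div_nonneg (le_max_right _ _) (by linarith)
      add_le := by
        have : c ^ β - 1 ≠ 0 := by linarith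
        refine le_of_eq ?_
        field_simp
        ring
      Λ_nonneg := ENNReal.toReal_nonneg
      le_Λ := hΛ
      M_pos := ENNReal.toReal_nonneg.trans_lt hEM
      le_M := fun p hp x hx => (hM p hp x hx).trans hEM.le
      A_nonneg := fun p => by positivity
      summable_A := (ENNReal.summable_toReal hsum.ne).mul_right _
      le_A := fun p x hx => by
        refine weight_le_interpolation ?_ (zero_lt_one.trans_le (hD1 p p.2 x hx)) hα1 hγα ?_
          (hΛ p p.2 x hx)
        · rw [hξ p p.2 x hx]
          exact norm_pos_iff.2 (Complex.exp_ne_zero _)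
        · have h1 : S p ≠ ⊤ := ENNReal.ne_top_of_tsum_ne_top hsum.ne p
          rw [← ENNReal.ofReal_le_iff_le_toReal h1]
          exact le_iSup₂ (f := fun x (_ : x ∈ (p : Set ℝ)) =>
            ENNReal.ofReal ((‖ξ x‖ * |deriv f x| ^ γ) ^ (1 / (1 - γ)))) x hx }

end HolderBV

/-! ### The spectral bounds -/

theorem theorem2
    (f : ℝ → ℝ) (P : Set (Set ℝ)) (hf : HolderBV.IsPiecewiseExpanding f P)
    -- the weight `ξ = e^φ`, the potential `φ` being uniformly `β`-Hölder on the elements of `P`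
    (ξ φ : ℝ → ℂ) (hξ : ∀ p ∈ P, ∀ x ∈ p, ξ x = Complex.exp (φ x))
    (β : ℝ) (hβ : β ∈ Set.Ioc (0 : ℝ) 1)
    (hφ : ∃ C : ℝ, ∀ p ∈ P, ∀ x ∈ p, ∀ y ∈ p, ‖φ x - φ y‖ ≤ C * |x - y| ^ β)
    -- `ξ f' ∈ L^∞`
    (hξf : MeasureTheory.MemLp (fun x => ξ x * ((deriv f x : ℝ) : ℂ)) ⊤ HolderBV.leb)
    -- `∑_p sup_p |ξ (f')^γ|^{1/(1-γ)} < ∞`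
    (γ : ℝ) (hγ : γ ∈ Set.Ico (0 : ℝ) 1)
    (hsum : ∑' p : P, ⨆ x ∈ (p : Set ℝ),
      ENNReal.ofReal ((‖ξ x‖ * |deriv f x| ^ γ) ^ (1 / (1 - γ))) < ⊤)
    (α : Set.Ico (0 : ℝ) 1) (hα : max γ (1 - β) < (α : ℝ)) :
    ∃ L : HolderBV.BSpace α →L[ℂ] HolderBV.BSpace α,
      (∀ h : HolderBV.BSpace α, HolderBV.IsTransfer f P ξ h.density (L h).density) ∧
      spectralRadius ℂ L ≤
        MeasureTheory.eLpNorm (fun x => ξ x * ((deriv f x : ℝ) : ℂ)) ⊤ HolderBV.leb ∧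
      HolderBV.essSpectralRadius L ≤
        min (MeasureTheory.eLpNorm (fun x => ξ x * ((deriv f x : ℝ) : ℂ)) ⊤ HolderBV.leb)
          (8 * MeasureTheory.eLpNorm (fun x => ‖ξ x‖ * |deriv f x| ^ (α : ℝ)) ⊤
            HolderBV.leb) := by
  open HolderBV in
  obtain ⟨hle, c, C, B, A, H⟩ := exists_weightBounds hf hξ hβ hφ hξf hγ hsum α.2.2 hα
  set E1 := eLpNorm (fun x => ξ x * ((deriv f x : ℝ) : ℂ)) ⊤ leb with hE1
  set E2 := eLpNorm (fun x => ‖ξ x‖ * |deriv f x| ^ (α : ℝ)) ⊤ leb with hE2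
  have hE1fin : E1 ≠ ⊤ := hξf.2.ne
  have hE2fin : E2 ≠ ⊤ := ne_top_of_le_ne_top hE1fin hle
  -- Any admissible `M` would do here: the properties kept of `L` do not involve `M`, so other
  -- values can be used below for the same operator.
  obtain ⟨L, hL1, hL2, hL3⟩ := (H (E2.toReal + 1) (lt_add_one _)).exists_operator
  have hdisc : ∀ z ∈ spectrum ℂ L, E2 < ‖z‖ₑ → IsDiscreteEigenvalue L z := by
    intro z hz hlt
    have hz1 : E2.toReal < ‖z‖ := by
      rw [← toReal_enorm]
      exact (ENNReal.toReal_lt_toReal hE2fin enorm_ne_top).2 hlt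
    obtain ⟨M, hM1, hM2⟩ := exists_between hz1
    have HM := H M hM1
    have hM0 := HM.M_pos
    set K : ℝ := 2 * (4 * IsBranch.distConst (α : ℝ) β B + 2) with hK
    have hκ := IsBranch.distConst_nonneg HM.one_lt_add HM.B_nonneg
    have hK0 : 0 < 4 * K := by positivity
    -- As `M < ‖z‖`, the ratio `(M / ‖z‖) ^ n` eventually beats the constant `4 * K`, which does not
    -- depend on `n`.
    obtain ⟨n, hn⟩ := exists_pow_lt_of_lt_one (inv_pos.2 hK0) ((div_lt_one (hM0.trans hM2)).2 hM2)
    obtain ⟨T, R, hTR, hT, hR⟩ := HM.exists_finite_rank hL3 n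
    refine isDiscreteEigenvalue_of_pow_eq n.succ_ne_zero hTR ?_ hz
    have h1 : (M / ‖z‖) ^ (n + 1) < (4 * K)⁻¹ := by
      refine lt_of_le_of_lt ?_ hn
      exact pow_le_pow_of_le_one (by positivity) ((div_lt_one (hM0.trans hM2)).2 hM2).le n.le_succ
    rw [div_pow, div_lt_iff₀ (pow_pos (hM0.trans hM2) _), lt_inv_mul_iff₀ hK0] at h1
    calc 4 * ‖R‖ ≤ 4 * (K * M ^ (n + 1)) := by gcongr
      _ = 4 * K * M ^ (n + 1) := by ring
      _ < _ := h1
  refine ⟨L, hL1, iSup₂_le fun z hz => ?_, iSup₂_le fun z hz => ?_⟩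
  -- Beyond `E1 ≥ E2` a spectral value is an eigenvalue, and its eigenvector, nonzero in `L¹`,
  -- contradicts the `L¹` bound.
  · by_contra! hlt
    have hlt' : E1 < ‖z‖ₑ := hlt
    have hev := (hdisc z hz (hle.trans_lt hlt')).hasEigenvalue
    obtain ⟨h, hh⟩ := hev.exists_hasEigenvector
    have h1 : L h = z • h := hh.apply_eq_smul
    have h2 := hL2 h
    rw [h1, BSpace.density_smul, norm_smul] at h2
    have h3 : h.density ≠ 0 := fun h0 => hh.2 (BSpace.density_injective h0)
    have h4 : ‖z‖ ≤ E1.toReal := le_of_mul_le_mul_right h2 (norm_pos_iff.2 h3)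
    rw [← toReal_enorm, ENNReal.toReal_le_toReal enorm_ne_top hE1fin] at h4
    exact not_lt.2 h4 hlt'
  -- The estimate obtained is `E2` itself; both terms of the minimum are larger, and the factor `8`
  -- is not needed.
  · have h1 : ‖z‖ₑ ≤ E2 := by
      by_contra! hlt
      exact hz.2 (hdisc z hz.1 hlt)
    refine le_min (h1.trans hle) (h1.trans ?_)
    exact le_mul_of_one_le_left' (by norm_num)
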